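/- Let $n\ge 1$, $R,\lambda,\epsilon>0$, $B^n(r)=\{x\in\mathbb R^n:\|x\|\le r\}$, and let $\mathrm{Area}(S^{n-1})=2\pi^{n/2}/\Gamma(n/2)$. For real-valued functions on $B^n(R)$ put $$\|f\|_{L^2}=\Big(\int_{B^n(R)}f^2\,dx\Big)^{1/2},\qquad \|f\|_{H^1}=\Big(\|f\|_{L^2}^2+\int_{B^n(R)}\|\nabla f\|^2\,dx\Big)^{1/2},$$ where $\nabla f$ is the weak gradient; $L^2$ is the space of square-integrable functions on $B^n(R)$, and $H^1$ the space of $f\in L^2$ whose weak gradient exists and is square-integrable. Let $\mathrm I_1$ and $\mathrm J_1$ be the modified and the ordinary Bessel function of the first kind of order one, and set $$K(x,\xi)=-\frac{\sqrt{\lambda/\epsilon}\;\mathrm I_1\big[\sqrt{\tfrac{\lambda}{\epsilon}(\|x\|^2-\|\xi\|^2)}\big]}{\mathrm{Area}(S^{n-1})}\,\frac{\sqrt{\|x\|^2-\|\xi\|^2}}{\|x-\xi\|^n},\qquad L(x,\xi)=-\frac{\sqrt{\lambda/\epsilon}\;\mathrm J_1\big[\sqrt{\tfrac{\lambda}{\epsilon}(\|x\|^2-\|\xi\|^2)}\big]}{\mathrm{Area}(S^{n-1})}\,\frac{\sqrt{\|x\|^2-\|\xi\|^2}}{\|x-\xi\|^n}$$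 for $\|\xi\|\le\|x\|$, and $P(x,\xi)=K(\xi,x)$, $Q(x,\xi)=L(\xi,x)$ for $\|\xi\|\ge\|x\|$. Define $$\mathcal K[f](x)=f(x)-\int_{B^n(\|x\|)}K(x,\xi)f(\xi)\,d\xi,\qquad \mathcal L[g](x)=g(x)+\int_{B^n(\|x\|)}L(x,\xi)g(\xi)\,d\xi,$$ $$\mathcal P[f](x)=f(x)-\int_{B^n(R)\setminus B^n(\|x\|)}P(x,\xi)f(\xi)\,d\xi,\qquad \mathcal R[g](x)=g(x)+\int_{B^n(R)\setminus B^n(\|x\|)}Q(x,\xi)g(\xi)\,d\xi.$$ For every $f\in L^2$ the four integrals (with $f$ as the function integrated) converge absolutely for almost every $x\in B^n(R)$, and the following holds, with all equalities of functions understood almost everywhere on $B^n(R)$. 1. (Control transformation.) For functions $f,g$ on $B^n(R)$: $f\in L^2$ and $g=\mathcal K[f]$ if and only if $g\in L^2$ and $f=\mathcal L[g]$. There are positive constants $C_{KL},C_{LL},C_{KH},C_{LH}$ depending only on $R,\lambda,\epsilon,n$ such that, for all $f\in L^2$ and $g=\mathcal K[f]$, $$\|g\|_{L^2}\le C_{KL}\|f\|_{L^2},\qquad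 \|f\|_{L^2}\le C_{LL}\|g\|_{L^2};$$ moreover $f\in H^1$ if and only if $g\in H^1$, and in that case $$\|g\|_{H^1}\le C_{KH}\|f\|_{H^1},\qquad \|f\|_{H^1}\le C_{LH}\|g\|_{H^1}.$$ 2. (Observer transformation.) For functions $f,g$ on $B^n(R)$: $f\in L^2$ and $g=\mathcal P[f]$ if and only if $g\in L^2$ and $f=\mathcal R[g]$. There are positive constants $C_{PL},C_{RL},C_{PH},C_{RH}$ depending only on $R,\lambda,\epsilon,n$ such that, for all $f\in L^2$ and $g=\mathcal P[f]$, $$\|g\|_{L^2}\le C_{PL}\|f\|_{L^2},\qquad \|f\|_{L^2}\le C_{RL}\|g\|_{L^2};$$ moreover $f\in H^1$ if and only if $g\in H^1$, and in that case $$\|g\|_{H^1}\le C_{PH}\|f\|_{H^1},\qquad \|f\|_{H^1}\le C_{RH}\|g\|_{H^1}.$$ -/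

import Mathlib

open MeasureTheory
open scoped ContDiff Nat

noncomputable section

namespace BallBackstepping

/-- Euclidean `n`-space. -/
abbrev E (n : ℕ) : Type := EuclideanSpace ℝ (Fin n)

/-! ### Bessel functions -/

/-- Bessel function of the first kind of integer order `m`,
`J_m(x) = ∑ (-1)^k (x/2)^(2k+m) / (k! (k+m)!)`. -/
def besselJ (m : ℕ) (x : ℝ) : ℝ :=
  ∑' k : ℕ, (-1) ^ k * (x / 2) ^ (2 * k + m) / ((k ! : ℝ) * ((k + m)! : ℝ))

/-- Modified Bessel function of the first kind of integer order `m`,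
`I_m(x) = ∑ (x/2)^(2k+m) / (k! (k+m)!)`. -/
def besselI (m : ℕ) (x : ℝ) : ℝ :=
  ∑' k : ℕ, (x / 2) ^ (2 * k + m) / ((k ! : ℝ) * ((k + m)! : ℝ))

theorem summable_besselI (m : ℕ) (x : ℝ) :
    Summable fun k : ℕ => (x / 2) ^ (2 * k + m) / ((k ! : ℝ) * ((k + m)! : ℝ)) := by
  have h := (Real.summable_pow_div_factorial ((x / 2) ^ 2)).mul_left (|x / 2| ^ m)
  refine Summable.of_norm_bounded h fun k => ?_
  have h1 : (1 : ℝ) ≤ ((k + m)! : ℝ) := by exact_mod_cast Nat.factorial_pos _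
  have h2 : (0 : ℝ) < (k ! : ℝ) := by exact_mod_cast Nat.factorial_pos _
  have h3 : ‖(x / 2) ^ (2 * k + m) / ((k ! : ℝ) * ((k + m)! : ℝ))‖
      = |x / 2| ^ m * ((x / 2) ^ 2) ^ k / ((k ! : ℝ) * ((k + m)! : ℝ)) := by
    rw [norm_div, norm_pow, Real.norm_eq_abs, Real.norm_eq_abs,
      abs_of_pos (show (0 : ℝ) < (k ! : ℝ) * ((k + m)! : ℝ) by positivity),
      pow_add, pow_mul, sq_abs, mul_comm]
  rw [h3, ← mul_div_assoc]
  exact div_le_div_of_nonneg_left (by positivity) h2 (le_mul_of_one_le_right h2.le h1)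

theorem summable_besselJ (m : ℕ) (x : ℝ) :
    Summable fun k : ℕ =>
      (-1) ^ k * (x / 2) ^ (2 * k + m) / ((k ! : ℝ) * ((k + m)! : ℝ)) := by
  refine Summable.of_norm ?_
  convert (summable_besselI m x).norm using 2 with k
  simp

/-! ### The kernels and the four transformations -/

/-- Surface area of the unit sphere of `ℝⁿ`. -/
def sphereArea (n : ℕ) : ℝ := 2 * Real.pi ^ ((n : ℝ) / 2) / Real.Gamma ((n : ℝ) / 2)

variable {n : ℕ}

/-- The kernel of the control transformation. -/
def kernelK (lam eps : ℝ) (x ξ : E n) : ℝ :=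
  -(Real.sqrt (lam / eps) * besselI 1 (Real.sqrt (lam / eps * (‖x‖ ^ 2 - ‖ξ‖ ^ 2)))
      / sphereArea n) * (Real.sqrt (‖x‖ ^ 2 - ‖ξ‖ ^ 2) / ‖x - ξ‖ ^ n)

/-- The kernel of the inverse control transformation. -/
def kernelL (lam eps : ℝ) (x ξ : E n) : ℝ :=
  -(Real.sqrt (lam / eps) * besselJ 1 (Real.sqrt (lam / eps * (‖x‖ ^ 2 - ‖ξ‖ ^ 2)))
      / sphereArea n) * (Real.sqrt (‖x‖ ^ 2 - ‖ξ‖ ^ 2) / ‖x - ξ‖ ^ n)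

/-- The kernel of the observer transformation. -/
def kernelP (lam eps : ℝ) (x ξ : E n) : ℝ :=
  -(Real.sqrt (lam / eps) * besselI 1 (Real.sqrt (lam / eps * (‖ξ‖ ^ 2 - ‖x‖ ^ 2)))
      / sphereArea n) * (Real.sqrt (‖ξ‖ ^ 2 - ‖x‖ ^ 2) / ‖x - ξ‖ ^ n)

/-- The kernel of the inverse observer transformation. -/
def kernelR (lam eps : ℝ) (x ξ : E n) : ℝ :=
  -(Real.sqrt (lam / eps) * besselJ 1 (Real.sqrt (lam / eps * (‖ξ‖ ^ 2 - ‖x‖ ^ 2)))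
      / sphereArea n) * (Real.sqrt (‖ξ‖ ^ 2 - ‖x‖ ^ 2) / ‖x - ξ‖ ^ n)

/-- The closed ball `Bⁿ(r)` centred at the origin. -/
abbrev B (n : ℕ) (r : ℝ) : Set (E n) := Metric.closedBall 0 r

/-- The control transformation `𝒦`. -/
def transK (lam eps : ℝ) (f : E n → ℝ) (x : E n) : ℝ :=
  f x - ∫ ξ in B n ‖x‖, kernelK lam eps x ξ * f ξ

/-- The inverse control transformation `ℒ`. -/
def transL (lam eps : ℝ) (f : E n → ℝ) (x : E n) : ℝ :=
  f x + ∫ ξ in B n ‖x‖, kernelL lam eps x ξ * f ξ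

/-- The observer transformation `𝒫` on the ball of radius `R`. -/
def transP (R lam eps : ℝ) (f : E n → ℝ) (x : E n) : ℝ :=
  f x - ∫ ξ in B n R \ B n ‖x‖, kernelP lam eps x ξ * f ξ

/-- The inverse observer transformation `ℛ` on the ball of radius `R`. -/
def transR (R lam eps : ℝ) (f : E n → ℝ) (x : E n) : ℝ :=
  f x + ∫ ξ in B n R \ B n ‖x‖, kernelR lam eps x ξ * f ξ

/-! ### The spaces `L²` and `H¹` of the ball -/

/-- Lebesgue measure on the ball `Bⁿ(R)`. -/
abbrev ballMeasure (n : ℕ) (R : ℝ) : Measure (E n) := volume.restrict (B n R)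

/-- `f` is square-integrable over the ball. -/
def MemL2 (R : ℝ) (f : E n → ℝ) : Prop := MemLp f 2 (ballMeasure n R)

/-- `‖f‖_{L²} = (∫_{Bⁿ(R)} f²)^{1/2}`. -/
def l2Norm (R : ℝ) (f : E n → ℝ) : ℝ := Real.sqrt (∫ x in B n R, f x ^ 2)

/-- `F` is a square-integrable weak gradient of `f` on the ball: integration by parts holds
against all smooth functions with compact support in the open ball. -/
def IsL2WeakGradient (R : ℝ) (f : E n → ℝ) (F : E n → E n) : Prop :=
  MemLp F 2 (ballMeasure n R) ∧
    ∀ η : E n → ℝ, ContDiff ℝ ∞ η → HasCompactSupport η → tsupport η ⊆ Metric.ball 0 R →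
      ∀ i : Fin n, ∫ x in B n R, f x * fderiv ℝ η x (EuclideanSpace.single i 1)
        = -∫ x in B n R, F x i * η x

/-- `f` belongs to the Sobolev space `H¹` of the ball. -/
def MemH1 (R : ℝ) (f : E n → ℝ) : Prop :=
  MemL2 R f ∧ ∃ F : E n → E n, IsL2WeakGradient R f F

open Classical in
/-- The weak gradient of an `H¹` function (unique up to a null set; zero by convention if there
is none). -/
def weakGradient (R : ℝ) (f : E n → ℝ) : E n → E n :=
  if h : ∃ F : E n → E n, IsL2WeakGradient R f F then h.choose else 0

/-- `‖f‖_{H¹} = (‖f‖_{L²}² + ∫_{Bⁿ(R)} ‖∇f‖²)^{1/2}`. -/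
def h1Norm (R : ℝ) (f : E n → ℝ) : ℝ :=
  Real.sqrt (l2Norm R f ^ 2 + ∫ x in B n R, ‖weakGradient R f x‖ ^ 2)

end BallBackstepping

end

open BallBackstepping

namespace BallBackstepping

open Set Metric Filter Topology
open scoped ENNReal NNReal

/-! ### Integral operators and the Schur test -/

section Schur

variable {X : Type*} [MeasurableSpace X] {μ : Measure X}

/-! Put `c = lam / eps`. Because `I₁` and `J₁` are odd, the square roots in the kernels combine, and
each kernel becomes minus a Volterra kernel `vker a`, namely a density `a(|x|² - |ξ|²)`, entire in
its argument, times the Poisson-type factor `pois x ξ = (|x|² - |ξ|²) / |x - ξ|^n` over the area of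
the sphere, cut off to `|ξ| < |x|`. The observer kernels are the transposes. Since `|pois x ξ| ≤
(|x| + |ξ|) |x - ξ|^(1-n)`, the singularity is integrable, and Schur's test gives absolute
convergence and boundedness on `L²`.

Invertibility is an algebraic identity of kernels. On each sphere of radius `r` between `|ξ|` and
`|x|` the Poisson integral formula evaluates the integral of `pois x η * pois η ξ` as a multiple of
`pois x ξ` (`integral_sphere_pois_mul_pois_of_radius`). In polar coordinates the composition of
`vker a` and `vker b` is therefore `vker (a ⋆ b)`, with a one-dimensional convolution `⋆` in the
variable `|x|² - |ξ|²` (`integral_vker_mul_vker`). For the two Bessel densities `a ⋆ b = a - b`,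
which comes down to an alternating sum of binomial coefficients (`integral_ser_mul_ser`). As `⋆` is
commutative, `1 + k` and `1 - l` are inverse to each other on both sides (`IsSchur.resolvent`,
`IsSchur.resolvent'`).

For `H¹` the kernel cannot simply be differentiated: that would produce a singularity of order `|x -
ξ|^(-n)`. Instead the derivative is moved to `f` along directions that respect the kernel. The field
`|x|² ∂ⱼ` is a combination of infinitesimal rotations and of the dilation field
(`norm_sq_mul_fderiv`). Rotations leave the kernel invariant, and a dilation turns it into a kernel
of the same type. Integration by parts along rays leaves one boundary term, the trace of the kernel
on `|ξ| = R`. All resulting operators again pass Schur's test, provided that the kernel vanishes to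
first order at `x = 0`, which pays for the division by `|x|²` (`IsConeKernel.hasGradKernels`).

The control kernel has this zero because `|ξ| < |x|` on its support, and its trace vanishes. The
observer kernel has neither property. Its value at `x = 0` is removed by subtracting `smoothKer`,
whose gradient in `x` is only weakly singular, and its trace is dominated by a constant plus a
Poisson kernel, whose total mass is bounded. The identities are proved for `C¹` functions and pass
to Sobolev functions by approximation (`exists_contDiff_approx`). Applying the bounds to a
transformation and to its inverse gives both inequalities and the equivalence of `H¹` membership. -/

theorem eLpNorm_two_sq (f : X → ℝ) : eLpNorm f 2 μ ^ 2 = ∫⁻ x, ‖f x‖ₑ ^ 2 ∂μ := by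
  have := eLpNorm_nnreal_pow_eq_lintegral (f := f) (μ := μ) (p := 2) (by norm_num)
  simpa using this

/-- Cauchy–Schwarz for the splitting `κ v = κ^(1/2) · (κ^(1/2) v)`; this is the form in which the
row bound enters Schur's test. -/
theorem lintegral_mul_sq_le {κ v : X → ℝ≥0∞} (hκ : AEMeasurable κ μ) (hv : AEMeasurable v μ) :
    (∫⁻ x, κ x * v x ∂μ) ^ 2 ≤ (∫⁻ x, κ x ∂μ) * ∫⁻ x, κ x * v x ^ 2 ∂μ := by
  have h := ENNReal.lintegral_mul_le_Lp_mul_Lq μ Real.HolderConjugate.two_two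
    (f := fun x => κ x ^ (1 / 2 : ℝ)) (g := fun x => κ x ^ (1 / 2 : ℝ) * v x)
    (hκ.pow_const _) ((hκ.pow_const _).mul hv)
  have e0 : ∀ a : ℝ≥0∞, a ^ (1 / 2 : ℝ) * a ^ (1 / 2 : ℝ) = a := fun a => by
    rw [← ENNReal.rpow_add_of_nonneg _ _ (by norm_num) (by norm_num)]; norm_num
  have e1 : ∀ a : ℝ≥0∞, (a ^ (1 / 2 : ℝ)) ^ (2 : ℝ) = a := fun a => by
    rw [← ENNReal.rpow_mul]; norm_num
  have e2 : ∀ a b : ℝ≥0∞, (a ^ (1 / 2 : ℝ) * b) ^ (2 : ℝ) = a * b ^ 2 := fun a b => by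
    rw [ENNReal.mul_rpow_of_nonneg _ _ (by norm_num), e1]; norm_num
  have e3 : ∀ a b : ℝ≥0∞, a ^ (1 / 2 : ℝ) * (a ^ (1 / 2 : ℝ) * b) = a * b := fun a b => by
    rw [← mul_assoc, e0]
  simp only [Pi.mul_apply, e1, e2, e3] at h
  calc (∫⁻ x, κ x * v x ∂μ) ^ 2
      ≤ ((∫⁻ x, κ x ∂μ) ^ (1 / 2 : ℝ) * (∫⁻ x, κ x * v x ^ 2 ∂μ) ^ (1 / 2 : ℝ)) ^ 2 := by
        gcongr
    _ = _ := by
        rw [mul_pow]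
        congr 1 <;> · rw [sq]; exact e0 _

/-- The integral operator with kernel `k`. -/
noncomputable def kop (μ : Measure X) (k : X → X → ℝ) (f : X → ℝ) (x : X) : ℝ :=
  ∫ ξ, k x ξ * f ξ ∂μ

/-- The kernel `k` satisfies the hypotheses of the Schur test with constant `C`. -/
structure IsSchur (μ : Measure X) (k : X → X → ℝ) (C : ℝ≥0) : Prop where
  meas : Measurable (Function.uncurry k)
  row : ∀ᵐ x ∂μ, ∫⁻ ξ, ‖k x ξ‖ₑ ∂μ ≤ C
  col : ∀ᵐ ξ ∂μ, ∫⁻ x, ‖k x ξ‖ₑ ∂μ ≤ C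

variable {k l : X → X → ℝ} {C D : ℝ≥0} {f g : X → ℝ}

theorem IsSchur.transpose (h : IsSchur μ k C) : IsSchur μ (fun x ξ => k ξ x) C :=
  ⟨h.meas.comp measurable_swap, h.col, h.row⟩

/-- Nearly every kernel below is compared with `wsing (x - ξ)` through this. The comparison is
assumed in both orders of the two almost-everywhere quantifiers, which avoids any product-measure
argument for exchanging them. -/
theorem IsSchur.of_abs_le (h : IsSchur μ k C) (hl : Measurable (Function.uncurry l)) (D : ℝ≥0)
    (hle : ∀ᵐ x ∂μ, ∀ᵐ ξ ∂μ, |l x ξ| ≤ D * |k x ξ|)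
    (hle' : ∀ᵐ ξ ∂μ, ∀ᵐ x ∂μ, |l x ξ| ≤ D * |k x ξ|) : IsSchur μ l (D * C) := by
  have key : ∀ a b : ℝ, |a| ≤ D * |b| → ‖a‖ₑ ≤ D * ‖b‖ₑ := by
    intro a b hab
    rw [← Real.norm_eq_abs, ← Real.norm_eq_abs] at hab
    have : ‖a‖₊ ≤ D * ‖b‖₊ := by exact_mod_cast hab
    simpa [enorm] using (ENNReal.coe_le_coe.2 this)
  refine ⟨hl, ?_, ?_⟩
  · filter_upwards [hle, h.row] with x hx hr
    calc ∫⁻ ξ, ‖l x ξ‖ₑ ∂μ ≤ ∫⁻ ξ, D * ‖k x ξ‖ₑ ∂μ :=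
          lintegral_mono_ae (hx.mono fun ξ hξ => key _ _ hξ)
      _ = D * ∫⁻ ξ, ‖k x ξ‖ₑ ∂μ := lintegral_const_mul' _ _ ENNReal.coe_ne_top
      _ ≤ _ := by push_cast; gcongr
  · filter_upwards [hle', h.col] with ξ hx hr
    calc ∫⁻ x, ‖l x ξ‖ₑ ∂μ ≤ ∫⁻ x, D * ‖k x ξ‖ₑ ∂μ :=
          lintegral_mono_ae (hx.mono fun ξ hξ => key _ _ hξ)
      _ = D * ∫⁻ x, ‖k x ξ‖ₑ ∂μ := lintegral_const_mul' _ _ ENNReal.coe_ne_top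
      _ ≤ _ := by push_cast; gcongr

theorem IsSchur.add (h : IsSchur μ k C) (h' : IsSchur μ l D) :
    IsSchur μ (fun x ξ => k x ξ + l x ξ) (C + D) := by
  refine ⟨h.meas.add h'.meas, ?_, ?_⟩
  · filter_upwards [h.row, h'.row] with x h1 h2
    calc ∫⁻ ξ, ‖k x ξ + l x ξ‖ₑ ∂μ ≤ ∫⁻ ξ, (‖k x ξ‖ₑ + ‖l x ξ‖ₑ) ∂μ :=
          lintegral_mono fun ξ => enorm_add_le _ _
      _ = _ := lintegral_add_left (h.meas.of_uncurry_left).enorm _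
      _ ≤ _ := by push_cast; gcongr
  · filter_upwards [h.col, h'.col] with ξ h1 h2
    calc ∫⁻ x, ‖k x ξ + l x ξ‖ₑ ∂μ ≤ ∫⁻ x, (‖k x ξ‖ₑ + ‖l x ξ‖ₑ) ∂μ :=
          lintegral_mono fun ξ => enorm_add_le _ _
      _ = _ := lintegral_add_left (h.meas.of_uncurry_right).enorm _
      _ ≤ _ := by push_cast; gcongr

theorem IsSchur.const_mul (h : IsSchur μ k C) (c : ℝ) :
    IsSchur μ (fun x ξ => c * k x ξ) (‖c‖₊ * C) :=
  h.of_abs_le (l := fun x ξ => c * k x ξ) (h.meas.const_mul c) _ (by simp [abs_mul]) (by simp [abs_mul])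

theorem IsSchur.sub (h : IsSchur μ k C) (h' : IsSchur μ l D) :
    IsSchur μ (fun x ξ => k x ξ - l x ξ) (C + D) := by
  simpa [sub_eq_add_neg] using h.add (h'.const_mul (-1))

theorem kop_congr (hfg : f =ᵐ[μ] g) : kop μ k f = kop μ k g := by
  ext x
  exact integral_congr_ae (hfg.mono fun ξ hξ => by simp [hξ])

theorem IsSchur.aestronglyMeasurable_mul (h : IsSchur μ k C) (hf : AEStronglyMeasurable f μ) :
    AEStronglyMeasurable (fun p : X × X => k p.1 p.2 * f p.2) (μ.prod μ) :=
  (h.meas.aestronglyMeasurable (μ := μ.prod μ)).mul hf.comp_snd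

variable [SFinite μ]

/-- Schur's test: weighted Cauchy–Schwarz uses up the row bound, and after Tonelli the column bound
handles the remaining integral. -/
theorem IsSchur.lintegral_sq_le (h : IsSchur μ k C) {v : X → ℝ≥0∞} (hv : AEMeasurable v μ) :
    ∫⁻ x, (∫⁻ ξ, ‖k x ξ‖ₑ * v ξ ∂μ) ^ 2 ∂μ ≤ C ^ 2 * ∫⁻ ξ, v ξ ^ 2 ∂μ := by
  have hm : Measurable fun p : X × X => ‖k p.1 p.2‖ₑ := h.meas.enorm
  calc ∫⁻ x, (∫⁻ ξ, ‖k x ξ‖ₑ * v ξ ∂μ) ^ 2 ∂μ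
      ≤ ∫⁻ x, C * ∫⁻ ξ, ‖k x ξ‖ₑ * v ξ ^ 2 ∂μ ∂μ := by
        refine lintegral_mono_ae (h.row.mono fun x hx => ?_)
        refine (lintegral_mul_sq_le (h.meas.of_uncurry_left).enorm.aemeasurable hv).trans ?_
        gcongr
    _ = C * ∫⁻ x, ∫⁻ ξ, ‖k x ξ‖ₑ * v ξ ^ 2 ∂μ ∂μ := lintegral_const_mul' _ _ ENNReal.coe_ne_top
    _ = C * ∫⁻ ξ, ∫⁻ x, ‖k x ξ‖ₑ * v ξ ^ 2 ∂μ ∂μ := by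
        rw [lintegral_lintegral_swap]
        exact hm.aemeasurable.mul ((hv.pow_const 2).comp_snd)
    _ ≤ C * ∫⁻ ξ, C * v ξ ^ 2 ∂μ := by
        gcongr (C : ℝ≥0∞) * ?_
        refine lintegral_mono_ae (h.col.mono fun ξ hξ => ?_)
        rw [lintegral_mul_const _ (h.meas.of_uncurry_right).enorm]
        gcongr
    _ = _ := by rw [lintegral_const_mul' _ _ ENNReal.coe_ne_top, ← mul_assoc, sq]

theorem IsSchur.lintegral_sq_lt_top (h : IsSchur μ k C) (hf : MemLp f 2 μ) :
    ∫⁻ x, (∫⁻ ξ, ‖k x ξ‖ₑ * ‖f ξ‖ₑ ∂μ) ^ 2 ∂μ < ⊤ := by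
  refine (h.lintegral_sq_le hf.1.enorm).trans_lt ?_
  rw [← eLpNorm_two_sq]
  exact ENNReal.mul_lt_top (by simp) (ENNReal.pow_lt_top hf.2)

theorem IsSchur.ae_integrable (h : IsSchur μ k C) (hf : MemLp f 2 μ) :
    ∀ᵐ x ∂μ, Integrable (fun ξ => k x ξ * f ξ) μ := by
  have hm : AEMeasurable (fun x => (∫⁻ ξ, ‖k x ξ‖ₑ * ‖f ξ‖ₑ ∂μ) ^ 2) μ := by
    have h1 : AEMeasurable (fun p : X × X => ‖k p.1 p.2‖ₑ * ‖f p.2‖ₑ) (μ.prod μ) :=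
      h.meas.enorm.aemeasurable.mul hf.1.enorm.comp_snd
    exact h1.lintegral_prod_right'.pow_const 2
  filter_upwards [ae_lt_top' hm (h.lintegral_sq_lt_top hf).ne] with x hx
  refine ⟨(h.meas.of_uncurry_left).aestronglyMeasurable.mul hf.1, ?_⟩
  simp only [HasFiniteIntegral, enorm_mul]
  by_contra hcon
  rw [not_lt, top_le_iff] at hcon
  simp [hcon] at hx

theorem IsSchur.aestronglyMeasurable_kop (h : IsSchur μ k C) (hf : AEStronglyMeasurable f μ) :
    AEStronglyMeasurable (kop μ k f) μ :=
  (h.aestronglyMeasurable_mul hf).integral_prod_right'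

theorem IsSchur.eLpNorm_kop_le (h : IsSchur μ k C) (hf : MemLp f 2 μ) :
    eLpNorm (kop μ k f) 2 μ ≤ C * eLpNorm f 2 μ := by
  have : eLpNorm (kop μ k f) 2 μ ^ 2 ≤ (C * eLpNorm f 2 μ) ^ 2 := by
    rw [mul_pow, eLpNorm_two_sq, eLpNorm_two_sq]
    refine le_trans (lintegral_mono fun x => ?_) (h.lintegral_sq_le hf.1.enorm)
    gcongr
    exact (enorm_integral_le_lintegral_enorm _).trans_eq (by simp [enorm_mul])
  exact (ENNReal.pow_le_pow_left_iff two_ne_zero).1 this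

theorem IsSchur.memLp_kop (h : IsSchur μ k C) (hf : MemLp f 2 μ) : MemLp (kop μ k f) 2 μ :=
  ⟨h.aestronglyMeasurable_kop hf.1,
    (h.eLpNorm_kop_le hf).trans_lt (ENNReal.mul_lt_top ENNReal.coe_lt_top hf.2)⟩

theorem IsSchur.integrable_prod (h : IsSchur μ k C) (hf : MemLp f 2 μ) (hg : MemLp g 2 μ) :
    Integrable (fun p : X × X => k p.1 p.2 * f p.2 * g p.1) (μ.prod μ) := by
  have hm : AEStronglyMeasurable (fun p : X × X => k p.1 p.2 * f p.2 * g p.1) (μ.prod μ) :=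
    (h.aestronglyMeasurable_mul hf.1).mul hg.1.comp_fst
  refine ⟨hm, ?_⟩
  simp only [HasFiniteIntegral]
  rw [lintegral_prod _ hm.enorm]
  have e : ∀ x, ∫⁻ ξ, ‖k x ξ * f ξ * g x‖ₑ ∂μ = (∫⁻ ξ, ‖k x ξ‖ₑ * ‖f ξ‖ₑ ∂μ) * ‖g x‖ₑ := by
    intro x
    simp only [enorm_mul]
    exact lintegral_mul_const' _ _ (by simp)
  simp only [e]
  have h1 : AEMeasurable (fun x => ∫⁻ ξ, ‖k x ξ‖ₑ * ‖f ξ‖ₑ ∂μ) μ :=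
    (h.meas.enorm.aemeasurable.mul hf.1.enorm.comp_snd :
      AEMeasurable (fun p : X × X => ‖k p.1 p.2‖ₑ * ‖f p.2‖ₑ) (μ.prod μ)).lintegral_prod_right'
  have hH := ENNReal.lintegral_mul_le_Lp_mul_Lq μ Real.HolderConjugate.two_two h1 hg.1.enorm
  refine hH.trans_lt (ENNReal.mul_lt_top ?_ ?_)
  · refine ENNReal.rpow_lt_top_of_nonneg (by norm_num) ?_
    simpa using (h.lintegral_sq_lt_top hf).ne
  · refine ENNReal.rpow_lt_top_of_nonneg (by norm_num) ?_
    have := ENNReal.pow_lt_top (n := 2) hg.2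
    rw [eLpNorm_two_sq] at this
    simpa using this.ne

theorem IsSchur.integral_kop_mul (h : IsSchur μ k C) (hf : MemLp f 2 μ) (hg : MemLp g 2 μ) :
    ∫ x, kop μ k f x * g x ∂μ = ∫ p : X × X, k p.1 p.2 * f p.2 * g p.1 ∂(μ.prod μ) := by
  rw [integral_prod _ (h.integrable_prod hf hg)]
  simp only [kop, integral_mul_const]

/-- Fubini, legitimate since Schur's test makes the double integral absolutely convergent; the
transposed kernel is the adjoint. -/
theorem IsSchur.integral_kop_mul_swap (h : IsSchur μ k C) (hf : MemLp f 2 μ) (hg : MemLp g 2 μ) :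
    ∫ x, kop μ k f x * g x ∂μ = ∫ ξ, f ξ * kop μ (fun x ξ => k ξ x) g ξ ∂μ := by
  rw [h.integral_kop_mul hf hg, integral_prod_symm _ (h.integrable_prod hf hg)]
  refine integral_congr_ae (ae_of_all _ fun ξ => ?_)
  simp only [kop]
  rw [← integral_const_mul]
  congr 1; ext x; ring

theorem IsSchur.kop_add (h : IsSchur μ k C) (hf : MemLp f 2 μ) (hg : MemLp g 2 μ) :
    kop μ k (fun x => f x + g x) =ᵐ[μ] fun x => kop μ k f x + kop μ k g x := by
  filter_upwards [h.ae_integrable hf, h.ae_integrable hg] with x h1 h2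
  simp only [kop, mul_add]
  exact integral_add h1 h2

theorem IsSchur.kop_sub (h : IsSchur μ k C) (hf : MemLp f 2 μ) (hg : MemLp g 2 μ) :
    kop μ k (fun x => f x - g x) =ᵐ[μ] fun x => kop μ k f x - kop μ k g x := by
  filter_upwards [h.ae_integrable hf, h.ae_integrable hg] with x h1 h2
  simp only [kop, mul_sub]
  exact integral_sub h1 h2

/-- The pairing is continuous in its `L²` argument. This carries weak-derivative identities from
smooth approximants to Sobolev functions. -/
theorem IsSchur.tendsto_integral_kop_mul (h : IsSchur μ k C) {u : ℕ → X → ℝ}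
    (hu : ∀ m, MemLp (u m) 2 μ) (hf : MemLp f 2 μ) (hg : MemLp g 2 μ)
    (hlim : Tendsto (fun m => eLpNorm (fun x => u m x - f x) 2 μ) atTop (𝓝 0)) :
    Tendsto (fun m => ∫ x, kop μ k (u m) x * g x ∂μ) atTop (𝓝 (∫ x, kop μ k f x * g x ∂μ)) := by
  have hbd : ∀ m, ‖(∫ x, kop μ k (u m) x * g x ∂μ) - ∫ x, kop μ k f x * g x ∂μ‖ₑ
      ≤ C * eLpNorm (fun x => u m x - f x) 2 μ * eLpNorm g 2 μ := by
    intro m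
    have hd : MemLp (fun x => u m x - f x) 2 μ := (hu m).sub hf
    rw [← integral_sub]
    · have e : (fun x => kop μ k (u m) x * g x - kop μ k f x * g x) =ᵐ[μ]
          fun x => kop μ k (fun x => u m x - f x) x * g x := by
        filter_upwards [h.kop_sub (hu m) hf] with x hx
        rw [hx]; ring
      rw [integral_congr_ae e]
      refine (enorm_integral_le_lintegral_enorm _).trans ?_
      have := eLpNorm_smul_le_mul_eLpNorm (p := 2) (q := 2) (r := 1) hg.1 (h.memLp_kop hd).1
      rw [eLpNorm_one_eq_lintegral_enorm] at this
      refine le_trans this ?_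
      gcongr
      exact h.eLpNorm_kop_le hd
    · exact (h.memLp_kop (hu m)).integrable_mul hg
    · exact (h.memLp_kop hf).integrable_mul hg
  rw [tendsto_iff_edist_tendsto_0]
  have h0 : Tendsto (fun m => (C : ℝ≥0∞) * eLpNorm (fun x => u m x - f x) 2 μ * eLpNorm g 2 μ)
      atTop (𝓝 0) := by
    have h1 := ENNReal.Tendsto.const_mul (a := (C : ℝ≥0∞)) hlim (Or.inr ENNReal.coe_ne_top)
    have h2 := ENNReal.Tendsto.mul_const (b := eLpNorm g 2 μ) h1 (Or.inr hg.2.ne)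
    simpa using h2
  refine tendsto_of_tendsto_of_tendsto_of_le_of_le tendsto_const_nhds h0 (fun _ => bot_le) fun m => ?_
  simpa [edist_eq_enorm_sub] using hbd m

end Schur

/-! ### Polar coordinates -/

variable {n : ℕ}

/-- Surface measure of the unit sphere. -/
noncomputable abbrev surf (n : ℕ) : Measure (sphere (0 : E n) 1) :=
  (volume : Measure (E n)).toSphere

theorem finrank_E : Module.finrank ℝ (E n) = n := by simp

theorem nontrivial_E (hn : 1 ≤ n) : Nontrivial (E n) := by
  apply Module.nontrivial_of_finrank_pos (R := ℝ)
  rw [finrank_E]; omega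

/-- The mass of the sphere is `n` times the volume of the unit ball, and `Γ(n/2 + 1) = (n/2) Γ(n/2)`
turns this into the stated formula. -/
theorem surf_real_univ (hn : 1 ≤ n) : (surf n).real univ = sphereArea n := by
  have := nontrivial_E hn
  have : Nonempty (Fin n) := ⟨⟨0, hn⟩⟩
  rw [Measure.toSphere_real_apply_univ, finrank_E, Measure.real, EuclideanSpace.volume_ball]
  have hn' : (0 : ℝ) < n := by exact_mod_cast hn
  rw [sphereArea, Fintype.card_fin, Real.Gamma_add_one (by positivity)]
  have hG : 0 < Real.Gamma ((n : ℝ) / 2) := Real.Gamma_pos_of_pos (by positivity)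
  rw [ENNReal.ofReal_one, one_pow, one_mul, ENNReal.toReal_ofReal (by positivity)]
  rw [Real.sqrt_eq_rpow, ← Real.rpow_natCast, ← Real.rpow_mul Real.pi_pos.le,
    one_div_mul_eq_div]
  field_simp

theorem sphereArea_pos (hn : 1 ≤ n) : 0 < sphereArea n := by
  have hn' : (0 : ℝ) < n := by exact_mod_cast hn
  have hG : 0 < Real.Gamma ((n : ℝ) / 2) := Real.Gamma_pos_of_pos (by positivity)
  unfold sphereArea
  positivity

theorem lintegral_volumeIoiPow (m : ℕ) (f : ℝ → ℝ≥0∞) (hf : Measurable f) :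
    ∫⁻ r : Ioi (0 : ℝ), f r ∂(Measure.volumeIoiPow m)
      = ∫⁻ r in Ioi (0 : ℝ), ENNReal.ofReal (r ^ m) * f r := by
  rw [Measure.volumeIoiPow, lintegral_withDensity_eq_lintegral_mul _ (by fun_prop) (by fun_prop)]
  exact lintegral_subtype_comap measurableSet_Ioi fun r : ℝ => ENNReal.ofReal (r ^ m) * f r

theorem integral_volumeIoiPow (m : ℕ) (f : ℝ → ℝ) :
    ∫ r : Ioi (0 : ℝ), f r ∂(Measure.volumeIoiPow m) = ∫ r in Ioi (0 : ℝ), r ^ m * f r := by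
  simp only [Measure.volumeIoiPow, ENNReal.ofReal]
  rw [integral_withDensity_eq_integral_smul (by fun_prop),
    integral_subtype_comap measurableSet_Ioi fun a : ℝ ↦ Real.toNNReal (a ^ m) • f a]
  refine setIntegral_congr_fun measurableSet_Ioi fun x hx ↦ ?_
  simp only [NNReal.smul_def, Real.coe_toNNReal _ (pow_nonneg (le_of_lt hx) _), smul_eq_mul]

theorem lintegral_polar (f : E n → ℝ≥0∞) (hf : Measurable f) (hn : 1 ≤ n) :
    ∫⁻ x, f x = ∫⁻ r in Ioi (0 : ℝ), ENNReal.ofReal (r ^ (n - 1)) *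
      ∫⁻ θ : sphere (0 : E n) 1, f (r • (θ : E n)) ∂(surf n) := by
  have := nontrivial_E hn
  have h := (volume : Measure (E n)).measurePreserving_homeomorphUnitSphereProd
  rw [finrank_E] at h
  have hm : Measurable fun p : sphere (0 : E n) 1 × ℝ => f (p.2 • (p.1 : E n)) := by fun_prop
  calc ∫⁻ x, f x = ∫⁻ x in {(0 : E n)}ᶜ, f x := by rw [restrict_compl_singleton]
    _ = ∫⁻ x : ({(0 : E n)}ᶜ : Set (E n)), f x ∂((volume : Measure (E n)).comap (↑)) :=
      (lintegral_subtype_comap (measurableSet_singleton _).compl f).symm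
    _ = ∫⁻ p, f ((p.2 : ℝ) • (p.1 : E n)) ∂((surf n).prod (Measure.volumeIoiPow (n - 1))) := by
      rw [← h.lintegral_comp (by fun_prop)]
      refine lintegral_congr fun x => ?_
      congr 1
      have : ‖(x : E n)‖ ≠ 0 := norm_ne_zero_iff.2 x.2
      simp [smul_inv_smul₀ this]
    _ = ∫⁻ r : Ioi (0 : ℝ), ∫⁻ θ, f ((r : ℝ) • (θ : E n)) ∂(surf n)
          ∂(Measure.volumeIoiPow (n - 1)) := by
      rw [lintegral_prod_symm _ (by fun_prop)]
    _ = _ := lintegral_volumeIoiPow _ (fun r => ∫⁻ θ, f (r • (θ : E n)) ∂(surf n))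
        (hm.lintegral_prod_left')

/-- Integrability on the product is recorded with the formula so that both iterated orders are
available: angles outside for arguments along rays, radii outside for the composition of kernels. -/
theorem integral_polar_prod (f : E n → ℝ) (hf : Integrable f) (hn : 1 ≤ n) :
    Integrable (fun p : sphere (0 : E n) 1 × Ioi (0 : ℝ) => f ((p.2 : ℝ) • (p.1 : E n)))
      ((surf n).prod (Measure.volumeIoiPow (n - 1))) ∧
    ∫ x, f x = ∫ p, f ((p.2 : ℝ) • (p.1 : E n)) ∂((surf n).prod (Measure.volumeIoiPow (n - 1))) := by
  have := nontrivial_E hn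
  have h := (volume : Measure (E n)).measurePreserving_homeomorphUnitSphereProd
  rw [finrank_E] at h
  have e : ∀ x : ({(0 : E n)}ᶜ : Set (E n)),
      ((homeomorphUnitSphereProd (E n) x).2 : ℝ) • ((homeomorphUnitSphereProd (E n) x).1 : E n)
        = x := by
    intro x
    have : ‖(x : E n)‖ ≠ 0 := norm_ne_zero_iff.2 x.2
    simp [smul_inv_smul₀ this]
  constructor
  · rw [← h.integrable_comp_emb (Homeomorph.measurableEmbedding _)]
    have : ((fun p : sphere (0 : E n) 1 × Ioi (0 : ℝ) => f ((p.2 : ℝ) • (p.1 : E n))) ∘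
        (homeomorphUnitSphereProd (E n))) = f ∘ (↑) := by
      ext x; simp only [Function.comp_apply, e]
    rw [this, ← integrableOn_iff_comap_subtypeVal (measurableSet_singleton _).compl]
    exact hf.integrableOn
  · calc ∫ x, f x = ∫ x in {(0 : E n)}ᶜ, f x := by rw [restrict_compl_singleton]
      _ = ∫ x : ({(0 : E n)}ᶜ : Set (E n)), f x ∂((volume : Measure (E n)).comap (↑)) :=
        (integral_subtype_comap (measurableSet_singleton _).compl f).symm
      _ = _ := by
        rw [← h.integral_comp (Homeomorph.measurableEmbedding _)]
        simp only [e]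

theorem integral_polar (f : E n → ℝ) (hf : Integrable f) (hn : 1 ≤ n) :
    ∫ x, f x = ∫ θ : sphere (0 : E n) 1, (∫ r in Ioi (0 : ℝ), r ^ (n - 1) *
      f (r • (θ : E n))) ∂(surf n) := by
  rw [(integral_polar_prod f hf hn).2, integral_prod _ (integral_polar_prod f hf hn).1]
  congr 1; ext θ
  exact integral_volumeIoiPow _ fun r => f (r • (θ : E n))

theorem integral_polar_symm (f : E n → ℝ) (hf : Integrable f) (hn : 1 ≤ n) :
    ∫ x, f x = ∫ r in Ioi (0 : ℝ), r ^ (n - 1) *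
      ∫ θ : sphere (0 : E n) 1, f (r • (θ : E n)) ∂(surf n) := by
  rw [(integral_polar_prod f hf hn).2, integral_prod_symm _ (integral_polar_prod f hf hn).1]
  exact integral_volumeIoiPow _ fun r => ∫ θ : sphere (0 : E n) 1, f (r • (θ : E n)) ∂(surf n)

/-! ### The weak singularity `|z|^(1-n)` -/

/-- The function `|z|^(1-n)` (with value `0` at the origin). -/
noncomputable def wsing (z : E n) : ℝ := ‖z‖ / ‖z‖ ^ n

theorem wsing_nonneg (z : E n) : 0 ≤ wsing z := by unfold wsing; positivity

theorem wsing_neg (z : E n) : wsing (-z) = wsing z := by simp [wsing]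

theorem wsing_sub_comm (x y : E n) : wsing (x - y) = wsing (y - x) := by
  rw [← wsing_neg, neg_sub]

theorem measurable_wsing : Measurable (wsing : E n → ℝ) := by
  unfold wsing; fun_prop

theorem wsing_eq_inv (hn : 1 ≤ n) {z : E n} (hz : z ≠ 0) : wsing z = (‖z‖ ^ (n - 1))⁻¹ := by
  obtain ⟨m, rfl⟩ : ∃ m, n = m + 1 := ⟨n - 1, by omega⟩
  have : ‖z‖ ≠ 0 := norm_ne_zero_iff.2 hz
  simp only [wsing, Nat.add_sub_cancel]
  rw [pow_succ]; field_simp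

/-- The Jacobian `s^(n-1)` cancels the singularity exactly, so the integral grows linearly in the
radius. -/
theorem lintegral_wsing_ball (hn : 1 ≤ n) (r : ℝ) :
    ∫⁻ z in closedBall (0 : E n) r, ‖wsing z‖ₑ = ENNReal.ofReal (sphereArea n * r) := by
  have := nontrivial_E hn
  rw [← lintegral_indicator measurableSet_closedBall,
    lintegral_polar _ (measurable_wsing.enorm.indicator measurableSet_closedBall) hn]
  have e : ∀ s ∈ Ioi (0 : ℝ), ENNReal.ofReal (s ^ (n - 1)) * ∫⁻ θ : sphere (0 : E n) 1,
      (closedBall (0 : E n) r).indicator (fun z => ‖wsing z‖ₑ) (s • (θ : E n)) ∂(surf n)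
      = (Iic r).indicator (fun _ => ENNReal.ofReal (sphereArea n)) s := by
    intro s hs
    have hs' : (0 : ℝ) < s := hs
    have h1 : ∀ θ : sphere (0 : E n) 1, ‖s • (θ : E n)‖ = s := fun θ => by
      rw [norm_smul, norm_eq_of_mem_sphere, Real.norm_of_nonneg hs'.le, mul_one]
    have h2 : ∀ θ : sphere (0 : E n) 1,
        (closedBall (0 : E n) r).indicator (fun z => ‖wsing z‖ₑ) (s • (θ : E n))
        = (Iic r).indicator (fun s => ENNReal.ofReal ((s ^ (n - 1))⁻¹)) s := by
      intro θ
      have hne : s • (θ : E n) ≠ 0 := by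
        rw [← norm_ne_zero_iff, h1]; exact hs'.ne'
      by_cases hsr : s ≤ r
      · rw [indicator_of_mem (by simpa [h1] using hsr), indicator_of_mem (mem_Iic.2 hsr), wsing_eq_inv hn hne,
          h1, Real.enorm_of_nonneg (by positivity)]
      · rw [indicator_of_notMem (by simpa [h1] using hsr), indicator_of_notMem (by simpa using hsr)]
    simp only [h2, lintegral_const]
    by_cases hsr : s ≤ r
    · rw [indicator_of_mem (mem_Iic.2 hsr), indicator_of_mem (mem_Iic.2 hsr), ← mul_assoc,
        ← ENNReal.ofReal_mul (by positivity), mul_inv_cancel₀ (by positivity), ENNReal.ofReal_one,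
        one_mul, ← surf_real_univ hn, Measure.real, ENNReal.ofReal_toReal (measure_ne_top _ _)]
    · rw [indicator_of_notMem (by simpa using hsr), indicator_of_notMem (by simpa using hsr)]; simp
  rw [setLIntegral_congr_fun measurableSet_Ioi e, lintegral_indicator measurableSet_Iic,
    Measure.restrict_restrict measurableSet_Iic, lintegral_const, Measure.restrict_apply_univ,
    Iic_inter_Ioi, Real.volume_Ioc, sub_zero, ← ENNReal.ofReal_mul (sphereArea_pos hn).le]

/-- Constant for the Schur test of `wsing (x - ξ)` on the ball of radius `R`. -/
noncomputable def wConst (n : ℕ) (R : ℝ) : ℝ≥0 := Real.toNNReal (sphereArea n * (2 * R))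

theorem lintegral_wsing_sub_le (hn : 1 ≤ n) {R : ℝ} {x : E n} (hx : ‖x‖ ≤ R) :
    ∫⁻ ξ in closedBall (0 : E n) R, ‖wsing (x - ξ)‖ₑ ≤ wConst n R := by
  have hmp := (volume : Measure (E n)).measurePreserving_sub_left x
  calc ∫⁻ ξ in closedBall (0 : E n) R, ‖wsing (x - ξ)‖ₑ
      ≤ ∫⁻ ξ in (fun ξ => x - ξ) ⁻¹' closedBall (0 : E n) (2 * R), ‖wsing (x - ξ)‖ₑ := by
        refine lintegral_mono_set fun ξ hξ => ?_
        simp only [mem_closedBall_zero_iff, mem_preimage] at hξ ⊢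
        linarith [norm_sub_le x ξ]
    _ = ∫⁻ z in closedBall (0 : E n) (2 * R), ‖wsing z‖ₑ :=
        hmp.setLIntegral_comp_preimage measurableSet_closedBall measurable_wsing.enorm
    _ = _ := by rw [lintegral_wsing_ball hn]; rfl

theorem isSchur_wsing (hn : 1 ≤ n) (R : ℝ) :
    IsSchur (ballMeasure n R) (fun x ξ => wsing (x - ξ)) (wConst n R) := by
  have hm : Measurable (Function.uncurry fun x ξ : E n => wsing (x - ξ)) :=
    measurable_wsing.comp (measurable_fst.sub measurable_snd)
  have hx : ∀ᵐ x ∂(ballMeasure n R), x ∈ closedBall (0 : E n) R :=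
    ae_restrict_mem measurableSet_closedBall
  refine ⟨hm, hx.mono fun x hx => lintegral_wsing_sub_le hn (by simpa using hx),
    hx.mono fun x hx => ?_⟩
  simp only [wsing_sub_comm _ x]
  exact lintegral_wsing_sub_le hn (by simpa using hx)

/-- The kernel `(|x|² - |ξ|²) / |x - ξ|^n`. -/
noncomputable def pois (x ξ : E n) : ℝ := (‖x‖ ^ 2 - ‖ξ‖ ^ 2) / ‖x - ξ‖ ^ n

theorem measurable_pois : Measurable (Function.uncurry (pois : E n → E n → ℝ)) := by
  unfold pois Function.uncurry; fun_prop

/-- The factor `|x| - |ξ|` of the numerator is at most `|x - ξ|`, so the singularity drops by one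
order and becomes integrable. -/
theorem abs_pois_le (x ξ : E n) : |pois x ξ| ≤ (‖x‖ + ‖ξ‖) * wsing (x - ξ) := by
  have h : |‖x‖ ^ 2 - ‖ξ‖ ^ 2| ≤ (‖x‖ + ‖ξ‖) * ‖x - ξ‖ := by
    rw [sq_sub_sq, abs_mul, abs_of_nonneg (by positivity : 0 ≤ ‖x‖ + ‖ξ‖)]
    gcongr
    exact abs_norm_sub_norm_le x ξ
  rw [pois, wsing, abs_div, abs_of_nonneg (by positivity : 0 ≤ ‖x - ξ‖ ^ n), ← mul_div_assoc]
  gcongr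

theorem pois_nonneg {x ξ : E n} (h : ‖ξ‖ ≤ ‖x‖) : 0 ≤ pois x ξ := by
  unfold pois
  have : ‖ξ‖ ^ 2 ≤ ‖x‖ ^ 2 := by gcongr
  exact div_nonneg (by linarith) (by positivity)

theorem pois_smul {s : ℝ} (hs : 0 < s) (x ξ : E n) :
    pois (s • x) (s • ξ) = s ^ 2 / s ^ n * pois x ξ := by
  have : 0 < s ^ n := by positivity
  simp only [pois, ← smul_sub, norm_smul, Real.norm_of_nonneg hs.le, mul_pow]
  rw [← mul_sub, mul_div_mul_comm]

/-! ### Rotation invariance of the surface measure -/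

/-- `∫_0^R r^(n-1) dr`. -/
noncomputable def radialMass (n : ℕ) (R : ℝ) : ℝ≥0∞ :=
  ∫⁻ r in Ioc (0 : ℝ) R, ENNReal.ofReal (r ^ (n - 1))

theorem radialMass_lt_top (n : ℕ) (R : ℝ) : radialMass n R < ⊤ := by
  refine (setLIntegral_mono (g := fun _ => ENNReal.ofReal (R ^ (n - 1))) measurable_const
    fun r hr => ?_).trans_lt ?_
  · have := hr.1; have := hr.2
    gcongr
  · rw [setLIntegral_const]
    exact ENNReal.mul_lt_top (by simp) (by simp)

theorem radialMass_ne_zero (n : ℕ) {R : ℝ} (hR : 0 < R) : radialMass n R ≠ 0 := by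
  rw [radialMass, Ne, lintegral_eq_zero_iff (by fun_prop)]
  intro h
  have h' := ae_restrict_iff' measurableSet_Ioc |>.1 h
  have : volume (Ioc (0 : ℝ) R) = 0 := by
    refine measure_mono_null ?_ (ae_iff.1 h')
    intro r hr
    simp only [mem_ofPred_eq, not_forall]
    refine ⟨hr, ?_⟩
    have := hr.1
    simp only [Pi.zero_apply, ENNReal.ofReal_eq_zero, not_le]
    positivity
  simp [hR.not_ge] at this

theorem lintegral_ball_radial (hn : 1 ≤ n) (R : ℝ) (f : E n → ℝ≥0∞) (hf : Measurable f) :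
    ∫⁻ x in closedBall (0 : E n) R, f (‖x‖⁻¹ • x)
      = radialMass n R * ∫⁻ θ : sphere (0 : E n) 1, f θ ∂(surf n) := by
  have hm : Measurable fun x : E n => f (‖x‖⁻¹ • x) := by fun_prop
  rw [← lintegral_indicator measurableSet_closedBall,
    lintegral_polar _ (hm.indicator measurableSet_closedBall) hn]
  have e : ∀ s ∈ Ioi (0 : ℝ), ENNReal.ofReal (s ^ (n - 1)) * ∫⁻ θ : sphere (0 : E n) 1,
      (closedBall (0 : E n) R).indicator (fun x => f (‖x‖⁻¹ • x)) (s • (θ : E n)) ∂(surf n)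
      = (Iic R).indicator (fun s => ENNReal.ofReal (s ^ (n - 1))) s *
        ∫⁻ θ : sphere (0 : E n) 1, f θ ∂(surf n) := by
    intro s hs
    have hs' : (0 : ℝ) < s := hs
    have h1 : ∀ θ : sphere (0 : E n) 1, ‖s • (θ : E n)‖ = s := fun θ => by
      rw [norm_smul, norm_eq_of_mem_sphere, Real.norm_of_nonneg hs'.le, mul_one]
    by_cases hsr : s ≤ R
    · rw [indicator_of_mem (mem_Iic.2 hsr)]
      congr 1
      refine lintegral_congr fun θ => ?_
      rw [indicator_of_mem (by simpa [h1] using hsr), h1, smul_smul, inv_mul_cancel₀ hs'.ne',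
        one_smul]
    · rw [indicator_of_notMem (by simpa using hsr)]
      have : ∀ θ : sphere (0 : E n) 1, (closedBall (0 : E n) R).indicator
          (fun x => f (‖x‖⁻¹ • x)) (s • (θ : E n)) = 0 := fun θ =>
        indicator_of_notMem (by simpa [h1] using hsr) _
      simp [this]
  rw [setLIntegral_congr_fun measurableSet_Ioi e, lintegral_mul_const _
    ((by fun_prop : Measurable fun s : ℝ => ENNReal.ofReal (s ^ (n - 1))).indicator
      measurableSet_Iic), lintegral_indicator measurableSet_Iic,
    Measure.restrict_restrict measurableSet_Iic, Iic_inter_Ioi, radialMass]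

/-- Extending a function on the sphere to be constant along rays turns its surface integral into a
volume integral, up to the finite nonzero factor `radialMass`. Invariance is then inherited from
Lebesgue measure. -/
theorem lintegral_surf_comp_isometry (hn : 1 ≤ n) (Q : E n ≃ₗᵢ[ℝ] E n) (f : E n → ℝ≥0∞)
    (hf : Measurable f) :
    ∫⁻ θ : sphere (0 : E n) 1, f (Q θ) ∂(surf n) = ∫⁻ θ : sphere (0 : E n) 1, f θ ∂(surf n) := by
  have h1 := lintegral_ball_radial hn 1 (fun x => f (Q x)) (by fun_prop)
  have h2 := lintegral_ball_radial hn 1 f hf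
  have hQ := Q.measurePreserving.setLIntegral_comp_preimage
    (s := closedBall (0 : E n) 1) measurableSet_closedBall
    (f := fun x => f (‖x‖⁻¹ • x)) (by fun_prop)
  have hpre : Q ⁻¹' closedBall (0 : E n) 1 = closedBall 0 1 := by
    ext x; simp
  rw [hpre] at hQ
  simp only [Q.norm_map] at hQ
  simp only [map_smul] at h1
  rw [h1, h2] at hQ
  exact (ENNReal.mul_right_inj (radialMass_ne_zero n one_pos) (radialMass_lt_top n 1).ne).1 hQ

/-- The reflection in the hyperplane orthogonal to `x - y` exchanges two vectors of equal length. -/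
theorem exists_isometry_map_eq {x y : E n} (h : ‖x‖ = ‖y‖) : ∃ Q : E n ≃ₗᵢ[ℝ] E n, Q x = y :=
  ⟨_, Submodule.reflection_sub h⟩

theorem pois_isometry (Q : E n ≃ₗᵢ[ℝ] E n) (x ξ : E n) : pois (Q x) (Q ξ) = pois x ξ := by
  simp only [pois, ← map_sub, Q.norm_map]

/-! ### A maximum principle -/

/-- The `i`-th coordinate vector. -/
noncomputable abbrev ev (i : Fin n) : E n := EuclideanSpace.single i 1

/-- `U` is continuous and has vanishing Laplacian in the open ball of radius `ρ`. -/
def IsHarm (ρ : ℝ) (U : E n → ℝ) : Prop :=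
  ContinuousOn U (ball 0 ρ) ∧ ∃ U₁ U₂ : Fin n → E n → ℝ,
    (∀ i, ∀ ξ ∈ ball (0 : E n) ρ, HasDerivAt (fun t : ℝ => U (ξ + t • ev i)) (U₁ i ξ) 0) ∧
    (∀ i, ∀ ξ ∈ ball (0 : E n) ρ, HasDerivAt (fun t : ℝ => U₁ i (ξ + t • ev i)) (U₂ i ξ) 0) ∧
    ∀ ξ ∈ ball (0 : E n) ρ, ∑ i, U₂ i ξ = 0

theorem IsHarm.sub {ρ : ℝ} {U V : E n → ℝ} (hU : IsHarm ρ U) (hV : IsHarm ρ V) :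
    IsHarm ρ (fun x => U x - V x) := by
  obtain ⟨hU0, U₁, U₂, h1, h2, h3⟩ := hU
  obtain ⟨hV0, V₁, V₂, k1, k2, k3⟩ := hV
  refine ⟨hU0.sub hV0, fun i x => U₁ i x - V₁ i x, fun i x => U₂ i x - V₂ i x,
    fun i ξ hξ => (h1 i ξ hξ).sub (k1 i ξ hξ), fun i ξ hξ => (h2 i ξ hξ).sub (k2 i ξ hξ),
    fun ξ hξ => ?_⟩
  rw [Finset.sum_sub_distrib, h3 ξ hξ, k3 ξ hξ, sub_zero]

theorem IsHarm.const_mul {ρ : ℝ} {U : E n → ℝ} (hU : IsHarm ρ U) (c : ℝ) :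
    IsHarm ρ (fun x => c * U x) := by
  obtain ⟨hU0, U₁, U₂, h1, h2, h3⟩ := hU
  refine ⟨hU0.const_mul c, fun i x => c * U₁ i x, fun i x => c * U₂ i x,
    fun i ξ hξ => (h1 i ξ hξ).const_mul c, fun i ξ hξ => (h2 i ξ hξ).const_mul c,
    fun ξ hξ => ?_⟩
  rw [← Finset.mul_sum, h3 ξ hξ, mul_zero]

theorem isHarm_const (ρ c : ℝ) : IsHarm ρ (fun _ : E n => c) :=
  ⟨continuousOn_const, fun _ _ => 0, fun _ _ => 0, fun _ _ _ => hasDerivAt_const _ _,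
    fun _ _ _ => hasDerivAt_const _ _, by simp⟩

theorem IsHarm.mono {ρ ρ' : ℝ} {U : E n → ℝ} (hU : IsHarm ρ U) (h : ρ' ≤ ρ) : IsHarm ρ' U := by
  obtain ⟨hU0, U₁, U₂, h1, h2, h3⟩ := hU
  have hs := ball_subset_ball (x := (0 : E n)) h
  exact ⟨hU0.mono hs, U₁, U₂, fun i ξ hξ => h1 i ξ (hs hξ), fun i ξ hξ => h2 i ξ (hs hξ),
    fun ξ hξ => h3 ξ (hs hξ)⟩

/-- A positive second derivative would make the point a local minimum as well, hence the function
locally constant, and its second derivative zero. -/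
theorem second_deriv_nonpos_of_isLocalMax {u u₁ : ℝ → ℝ} {c : ℝ} (hmax : IsLocalMax u 0)
    (h1 : ∀ᶠ t in 𝓝 (0 : ℝ), HasDerivAt u (u₁ t) t) (h2 : HasDerivAt u₁ c 0) : c ≤ 0 := by
  by_contra! hc
  have e1 : deriv u =ᶠ[𝓝 0] u₁ := h1.mono fun t ht => ht.deriv
  have e2 : deriv (deriv u) 0 = c := (h2.congr_of_eventuallyEq e1).deriv
  have hmin : IsLocalMin u 0 := isLocalMin_of_deriv_deriv_pos (by rw [e2]; exact hc)
    hmax.deriv_eq_zero h1.self_of_nhds.continuousAt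
  have hconst : u =ᶠ[𝓝 0] fun _ => u 0 := by
    filter_upwards [hmin, hmax] with t h3 h4
    exact le_antisymm h4 h3
  have e3 : deriv u =ᶠ[𝓝 0] fun _ => 0 := by
    have := hconst.deriv
    simpa using this
  have e4 : deriv (deriv u) 0 = 0 := by
    rw [e3.deriv_eq]; simp
  linarith

/-- Adding `δ |ξ|²` makes the Laplacian strictly positive, which is incompatible with an interior
maximum. The boundary condition is imposed on thin shells, as the functions to which this applies
are given only inside the ball. -/
theorem IsHarm.nonpos (hn : 1 ≤ n) {ρ : ℝ} {U : E n → ℝ} (hU : IsHarm ρ U)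
    (hb : ∀ ε > 0, ∃ r < ρ, ∀ ξ : E n, r < ‖ξ‖ → ‖ξ‖ < ρ → U ξ ≤ ε) :
    ∀ ξ ∈ ball (0 : E n) ρ, U ξ ≤ 0 := by
  obtain ⟨hU0, U₁, U₂, h1, h2, h3⟩ := hU
  intro ξ₀ hξ₀
  by_contra! hM
  set M := U ξ₀ with hMdef
  rw [mem_ball_zero_iff] at hξ₀
  have hρ : 0 < ρ := (norm_nonneg _).trans_lt hξ₀
  obtain ⟨r, hr, hbr⟩ := hb (M / 2) (by positivity)
  -- With this choice the perturbation is at most `M / 4`, so on the outer shell the perturbed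
  -- function stays at most `M / 2 + M / 4 < M` and its maximum must lie inside.
  set δ := M / (4 * ρ ^ 2) with hδ
  have hδ0 : 0 < δ := by positivity
  have hδρ : δ * ρ ^ 2 = M / 4 := by rw [hδ]; field_simp
  set r₁ := max r ‖ξ₀‖ with hr₁
  have hr₁ρ : r₁ < ρ := max_lt hr hξ₀
  set r₂ := (r₁ + ρ) / 2 with hr₂
  have hr₂ρ : r₂ < ρ := by rw [hr₂]; linarith
  have hr₁₂ : r₁ < r₂ := by rw [hr₂]; linarith
  have hsub : closedBall (0 : E n) r₂ ⊆ ball 0 ρ := closedBall_subset_ball hr₂ρ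
  have hξ₀₂ : ξ₀ ∈ closedBall (0 : E n) r₂ := by
    rw [mem_closedBall_zero_iff]; exact (le_max_right _ _).trans hr₁₂.le
  obtain ⟨ξ₁, hξ₁, hmax⟩ := (isCompact_closedBall (0 : E n) r₂).exists_isMaxOn ⟨ξ₀, hξ₀₂⟩
    (f := fun ξ => U ξ + δ * ‖ξ‖ ^ 2) ((hU0.mono hsub).add (by fun_prop))
  have hV : M ≤ U ξ₁ + δ * ‖ξ₁‖ ^ 2 := by
    have h := hmax hξ₀₂
    simp only [mem_ofPred_eq] at h
    have : 0 ≤ δ * ‖ξ₀‖ ^ 2 := by positivity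
    linarith
  have hξ₁ρ : ‖ξ₁‖ < ρ := by simpa using hsub hξ₁
  have hξ₁r : ‖ξ₁‖ < r₂ := by
    by_contra! hge
    have h4 := hbr ξ₁ ((le_max_left _ _).trans_lt (hr₁₂.trans_le hge)) hξ₁ρ
    have h5 : δ * ‖ξ₁‖ ^ 2 ≤ δ * ρ ^ 2 := by gcongr
    linarith
  have hloc : IsLocalMax (fun ξ => U ξ + δ * ‖ξ‖ ^ 2) ξ₁ :=
    hmax.isLocalMax (closedBall_mem_nhds_of_mem (by simpa using hξ₁r))
  have key : ∀ i, U₂ i ξ₁ + 2 * δ ≤ 0 := by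
    intro i
    have hline : Continuous fun t : ℝ => ξ₁ + t • ev i := by fun_prop
    have hn2 : ∀ t : ℝ, ‖ξ₁ + t • ev i‖ ^ 2 = ‖ξ₁‖ ^ 2 + 2 * t * ξ₁ i + t ^ 2 := by
      intro t
      rw [norm_add_sq_real, inner_smul_right, norm_smul]
      simp [ev, EuclideanSpace.inner_single_right]
      ring
    refine second_deriv_nonpos_of_isLocalMax
      (u := fun t : ℝ => U (ξ₁ + t • ev i) + δ * ‖ξ₁ + t • ev i‖ ^ 2)
      (u₁ := fun t : ℝ => U₁ i (ξ₁ + t • ev i) + δ * (2 * ξ₁ i + 2 * t)) ?_ ?_ ?_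
    · have : ξ₁ + (0 : ℝ) • ev i = ξ₁ := by simp
      have h6 : IsLocalMax (fun ξ => U ξ + δ * ‖ξ‖ ^ 2) (ξ₁ + (0 : ℝ) • ev i) := by rwa [this]
      exact (hline.continuousAt (x := (0 : ℝ))).eventually h6
    · have hev : ∀ᶠ t in 𝓝 (0 : ℝ), ξ₁ + t • ev i ∈ ball (0 : E n) ρ :=
        hline.continuousAt.eventually (isOpen_ball.mem_nhds (by simpa using hξ₁ρ))
      filter_upwards [hev] with t ht
      refine HasDerivAt.add ?_ ?_
      · have h7 : HasDerivAt (fun s : ℝ => U (ξ₁ + t • ev i + s • ev i)) (U₁ i (ξ₁ + t • ev i))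
            (t - t) := by rw [sub_self]; exact h1 i _ ht
        have h8 := h7.comp_sub_const t t
        refine h8.congr_of_eventuallyEq (Eventually.of_forall fun s => ?_)
        simp only [sub_smul]; congr 1; abel
      · simp only [hn2]
        have h9 := ((((hasDerivAt_id t).const_mul 2).mul_const (ξ₁ i)).const_add (‖ξ₁‖ ^ 2)).add
          ((hasDerivAt_id t).pow 2)
        convert! h9.const_mul δ using 1
        simp
    · have h10 := h2 i ξ₁ (by simpa using hξ₁ρ)
      have h11 := h10.add ((((hasDerivAt_id (0 : ℝ)).const_mul 2).const_add (2 * ξ₁ i)).const_mul δ)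
      convert! h11 using 1
      ring
  have hsum := Finset.sum_le_sum fun i (_ : i ∈ Finset.univ) => key i
  rw [Finset.sum_add_distrib, h3 ξ₁ (by simpa using hξ₁ρ)] at hsum
  simp only [Finset.sum_const, Finset.card_univ, Fintype.card_fin, nsmul_eq_mul, mul_zero,
    zero_add] at hsum
  have : (0 : ℝ) < n := by exact_mod_cast hn
  nlinarith [mul_pos this hδ0]

theorem IsHarm.eq_zero (hn : 1 ≤ n) {ρ : ℝ} {U : E n → ℝ} (hU : IsHarm ρ U)
    (hb : ∀ ε > 0, ∃ r < ρ, ∀ ξ : E n, r < ‖ξ‖ → ‖ξ‖ < ρ → |U ξ| ≤ ε) :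
    ∀ ξ ∈ ball (0 : E n) ρ, U ξ = 0 := by
  intro ξ hξ
  refine le_antisymm (hU.nonpos hn (fun ε hε => ?_) ξ hξ) ?_
  · obtain ⟨r, hr, h⟩ := hb ε hε
    exact ⟨r, hr, fun ξ h1 h2 => (le_abs_self _).trans (h ξ h1 h2)⟩
  · have h' := (hU.const_mul (-1)).nonpos hn (fun ε hε => ?_) ξ hξ
    · linarith
    · obtain ⟨r, hr, h⟩ := hb ε hε
      exact ⟨r, hr, fun ξ h1 h2 => by
        simpa using (neg_le_abs _).trans (h ξ h1 h2)⟩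

/-! ### The Poisson integral formula for the kernel `pois` -/

theorem norm_sub_line_sq (x ξ : E n) (i : Fin n) (t : ℝ) :
    ‖x - (ξ + t • ev i)‖ ^ 2 = ‖x - ξ‖ ^ 2 - 2 * t * (x - ξ) i + t ^ 2 := by
  rw [← sub_sub, norm_sub_sq_real, inner_smul_right, norm_smul]
  simp [ev, EuclideanSpace.inner_single_right]
  ring

theorem norm_line_sq (ξ : E n) (i : Fin n) (t : ℝ) :
    ‖ξ + t • ev i‖ ^ 2 = ‖ξ‖ ^ 2 + 2 * t * ξ i + t ^ 2 := by
  rw [norm_add_sq_real, inner_smul_right, norm_smul]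
  simp [ev, EuclideanSpace.inner_single_right]
  ring

theorem hasDerivAt_norm_line_sq (ξ : E n) (i : Fin n) :
    HasDerivAt (fun t : ℝ => ‖ξ + t • ev i‖ ^ 2) (2 * ξ i) 0 := by
  simp only [norm_line_sq]
  have h9 := ((((hasDerivAt_id (0 : ℝ)).const_mul 2).mul_const (ξ i)).const_add (‖ξ‖ ^ 2)).add
    ((hasDerivAt_id (0 : ℝ)).pow 2)
  convert! h9 using 1
  simp

theorem hasDerivAt_inv_norm_pow_line {x ξ : E n} (h : x ≠ ξ) (i : Fin n) (m : ℕ) :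
    HasDerivAt (fun t : ℝ => (‖x - (ξ + t • ev i)‖ ^ m)⁻¹)
      (m * (x - ξ) i * (‖x - ξ‖ ^ (m + 2))⁻¹) 0 := by
  have hN : 0 < ‖x - ξ‖ := norm_pos_iff.2 (sub_ne_zero.2 h)
  have h1 : HasDerivAt (fun t : ℝ => ‖x - (ξ + t • ev i)‖ ^ 2) (-2 * (x - ξ) i) 0 := by
    simp only [norm_sub_line_sq]
    have h9 := ((((hasDerivAt_id (0 : ℝ)).const_mul 2).mul_const ((x - ξ) i)).const_sub
      (‖x - ξ‖ ^ 2)).add ((hasDerivAt_id (0 : ℝ)).pow 2)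
    convert! h9 using 1
    simp
  have h2 : HasDerivAt (fun t : ℝ => ‖x - (ξ + t • ev i)‖) (-(x - ξ) i / ‖x - ξ‖) 0 := by
    have h3 := h1.sqrt (by simpa using (pow_pos hN 2).ne')
    simp only [Real.sqrt_sq (norm_nonneg _)] at h3
    convert! h3 using 1
    simp only [zero_smul, add_zero]
    field_simp
  have h4 := (h2.pow m).inv (by simpa using (pow_pos hN m).ne')
  convert! h4 using 1
  simp only [Pi.pow_apply, zero_smul, add_zero]
  rcases m with _ | m
  · simp
  · simp only [Nat.add_sub_cancel, pow_succ]
    field_simp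

/-- First derivatives of `ξ ↦ pois x ξ`. -/
noncomputable def poisD (i : Fin n) (x ξ : E n) : ℝ :=
  -2 * ξ i * (‖x - ξ‖ ^ n)⁻¹ + n * (‖x‖ ^ 2 - ‖ξ‖ ^ 2) * (x - ξ) i * (‖x - ξ‖ ^ (n + 2))⁻¹

/-- Pure second derivatives of `ξ ↦ pois x ξ`. -/
noncomputable def poisDD (i : Fin n) (x ξ : E n) : ℝ :=
  -2 * (‖x - ξ‖ ^ n)⁻¹ - 4 * n * ξ i * (x - ξ) i * (‖x - ξ‖ ^ (n + 2))⁻¹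
    - n * (‖x‖ ^ 2 - ‖ξ‖ ^ 2) * (‖x - ξ‖ ^ (n + 2))⁻¹
    + n * (n + 2) * (‖x‖ ^ 2 - ‖ξ‖ ^ 2) * (x - ξ) i ^ 2 * (‖x - ξ‖ ^ (n + 4))⁻¹

theorem hasDerivAt_pois {x ξ : E n} (h : x ≠ ξ) (i : Fin n) :
    HasDerivAt (fun t : ℝ => pois x (ξ + t • ev i)) (poisD i x ξ) 0 := by
  simp only [pois, div_eq_mul_inv]
  have h1 := ((hasDerivAt_norm_line_sq ξ i).const_sub (‖x‖ ^ 2)).mul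
    (hasDerivAt_inv_norm_pow_line h i n)
  convert! h1 using 1
  simp only [zero_smul, add_zero, poisD]
  ring

theorem hasDerivAt_coord_line (ξ : E n) (i : Fin n) :
    HasDerivAt (fun t : ℝ => (ξ + t • ev i) i) 1 0 := by
  have : ∀ t : ℝ, (ξ + t • ev i) i = ξ i + t := by intro t; simp [ev]
  simp only [this]
  exact (hasDerivAt_id (0 : ℝ)).const_add (ξ i)

theorem hasDerivAt_poisD {x ξ : E n} (h : x ≠ ξ) (i : Fin n) :
    HasDerivAt (fun t : ℝ => poisD i x (ξ + t • ev i)) (poisDD i x ξ) 0 := by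
  have h0 : HasDerivAt (fun t : ℝ => (x - (ξ + t • ev i)) i) (-1) 0 := by
    have := (hasDerivAt_coord_line ξ i).const_sub (x i)
    simpa using this
  have h1 := ((hasDerivAt_coord_line ξ i).const_mul (-2)).mul (hasDerivAt_inv_norm_pow_line h i n)
  have h2 := ((((hasDerivAt_norm_line_sq ξ i).const_sub (‖x‖ ^ 2)).const_mul (n : ℝ)).mul h0).mul
    (hasDerivAt_inv_norm_pow_line h i (n + 2))
  convert! h1.add h2 using 1
  simp only [Pi.mul_apply, zero_smul, add_zero, poisDD]
  push_cast
  ring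

/-- Polarization expresses `ξ · (x - ξ)` through `|x|² - |ξ|²` and `|x - ξ|²`. After this
substitution the coefficients of the two remaining types of terms cancel. -/
theorem sum_poisDD {x ξ : E n} (h : x ≠ ξ) : ∑ i, poisDD i x ξ = 0 := by
  have hN : 0 < ‖x - ξ‖ := norm_pos_iff.2 (sub_ne_zero.2 h)
  have h1 : ∑ i, (x - ξ) i ^ 2 = ‖x - ξ‖ ^ 2 := by
    rw [EuclideanSpace.norm_sq_eq]; simp
  have h2 : ∑ i, ξ i * (x - ξ) i = (‖x‖ ^ 2 - ‖ξ‖ ^ 2 - ‖x - ξ‖ ^ 2) / 2 := by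
    have h3 : ‖x‖ ^ 2 = ‖ξ + (x - ξ)‖ ^ 2 := by rw [add_sub_cancel]
    rw [norm_add_sq_real] at h3
    have h4 : inner ℝ ξ (x - ξ) = ∑ i, ξ i * (x - ξ) i := by
      simp [PiLp.inner_apply, mul_comm]
    rw [h4] at h3
    linarith
  set N := ‖x - ξ‖
  set p := ‖x‖ ^ 2 - ‖ξ‖ ^ 2
  have e : ∀ i, poisDD i x ξ = -2 * (N ^ n)⁻¹ - 4 * n * (N ^ (n + 2))⁻¹ * (ξ i * (x - ξ) i)
      - n * p * (N ^ (n + 2))⁻¹ + n * (n + 2) * p * (N ^ (n + 4))⁻¹ * (x - ξ) i ^ 2 := by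
    intro i; simp only [poisDD]; ring
  simp only [e, Finset.sum_add_distrib, Finset.sum_sub_distrib, ← Finset.mul_sum, h1, h2,
    Finset.sum_const, Finset.card_univ, Fintype.card_fin, nsmul_eq_mul]
  simp only [pow_add]
  field_simp
  ring

theorem continuousOn_inv_norm_pow (m : ℕ) :
    ContinuousOn (fun p : E n × E n => (‖p.1 - p.2‖ ^ m)⁻¹) {p | p.1 ≠ p.2} := by
  refine ContinuousOn.inv₀ (by fun_prop) fun p hp => ?_
  have : 0 < ‖p.1 - p.2‖ := norm_pos_iff.2 (sub_ne_zero.2 hp)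
  positivity

theorem continuousOn_pois :
    ContinuousOn (fun p : E n × E n => pois p.1 p.2) {p | p.1 ≠ p.2} := by
  simp only [pois, div_eq_mul_inv]
  exact ContinuousOn.mul (by fun_prop) (continuousOn_inv_norm_pow n)

theorem continuousOn_poisD (i : Fin n) :
    ContinuousOn (fun p : E n × E n => poisD i p.1 p.2) {p | p.1 ≠ p.2} := by
  simp only [poisD]
  exact (ContinuousOn.mul (by fun_prop) (continuousOn_inv_norm_pow n)).add
    (ContinuousOn.mul (by fun_prop) (continuousOn_inv_norm_pow (n + 2)))

theorem continuousOn_poisDD (i : Fin n) :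
    ContinuousOn (fun p : E n × E n => poisDD i p.1 p.2) {p | p.1 ≠ p.2} := by
  simp only [poisDD]
  exact (((ContinuousOn.mul (by fun_prop) (continuousOn_inv_norm_pow n)).sub
    (ContinuousOn.mul (by fun_prop) (continuousOn_inv_norm_pow (n + 2)))).sub
    (ContinuousOn.mul (by fun_prop) (continuousOn_inv_norm_pow (n + 2)))).add
    (ContinuousOn.mul (by fun_prop) (continuousOn_inv_norm_pow (n + 4)))

theorem isHarm_pois {y : E n} {ρ : ℝ} (hy : ρ ≤ ‖y‖) : IsHarm ρ (fun ξ => pois y ξ) := by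
  have hne : ∀ ξ ∈ ball (0 : E n) ρ, y ≠ ξ := by
    rintro ξ hξ rfl
    exact absurd (mem_ball_zero_iff.1 hξ) hy.not_gt
  refine ⟨?_, fun i => poisD i y, fun i => poisDD i y, fun i ξ hξ => hasDerivAt_pois (hne ξ hξ) i,
    fun i ξ hξ => hasDerivAt_poisD (hne ξ hξ) i, fun ξ hξ => sum_poisDD (hne ξ hξ)⟩
  exact continuousOn_pois.comp (f := fun ξ => (y, ξ)) (by fun_prop) fun ξ hξ => hne ξ hξ

section SphereIntegral

variable {F F' : E n → E n → ℝ}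

/-- The product of the sphere with a smaller closed ball is a compact set away from the diagonal.
The bound serves as the dominating constant for integrals over the sphere. -/
theorem exists_bound_sphere_prod (hF : ContinuousOn (fun p : E n × E n => F p.1 p.2)
    {p | p.1 ≠ p.2}) {r : ℝ} (hr : r < 1) :
    ∃ C, ∀ θ : sphere (0 : E n) 1, ∀ ξ : E n, ‖ξ‖ ≤ r → |F θ ξ| ≤ C := by
  have hc : IsCompact (sphere (0 : E n) 1 ×ˢ closedBall (0 : E n) r) :=
    (isCompact_sphere _ _).prod (isCompact_closedBall _ _)
  have hsub : sphere (0 : E n) 1 ×ˢ closedBall (0 : E n) r ⊆ {p | p.1 ≠ p.2} := by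
    rintro ⟨a, b⟩ ⟨ha, hb⟩ (rfl : a = b)
    simp only [mem_sphere_zero_iff_norm, mem_closedBall_zero_iff] at ha hb
    linarith
  obtain ⟨C, hC⟩ := hc.exists_bound_of_continuousOn (hF.mono hsub)
  exact ⟨C, fun θ ξ hξ => hC (θ, ξ) ⟨θ.2, by simpa using hξ⟩⟩

theorem continuous_sphere_section (hF : ContinuousOn (fun p : E n × E n => F p.1 p.2)
    {p | p.1 ≠ p.2}) {ξ : E n} (hξ : ‖ξ‖ < 1) :
    Continuous fun θ : sphere (0 : E n) 1 => F θ ξ := by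
  rw [← continuousOn_univ]
  refine hF.comp (f := fun θ : sphere (0 : E n) 1 => ((θ : E n), ξ)) (by fun_prop) fun θ _ h => ?_
  have := norm_eq_of_mem_sphere θ
  simp only at h
  rw [h] at this; linarith

theorem continuousOn_sphere_integral (hF : ContinuousOn (fun p : E n × E n => F p.1 p.2)
    {p | p.1 ≠ p.2}) {u : sphere (0 : E n) 1 → ℝ} (hu : Continuous u) :
    ContinuousOn (fun ξ => ∫ θ : sphere (0 : E n) 1, F θ ξ * u θ ∂(surf n)) (ball 0 1) := by
  refine isOpen_ball.continuousOn_iff.2 fun {ξ} hξ => ?_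
  rw [mem_ball_zero_iff] at hξ
  obtain ⟨r, hr1, hr2⟩ := exists_between hξ
  obtain ⟨C, hC⟩ := exists_bound_sphere_prod hF hr2
  obtain ⟨M, hM⟩ : ∃ M, ∀ θ, |u θ| ≤ M := by
    obtain ⟨M, hM⟩ := isCompact_univ.exists_bound_of_continuousOn hu.continuousOn
    exact ⟨M, fun θ => hM θ trivial⟩
  have hev : ∀ᶠ y in 𝓝 ξ, ‖y‖ < r := continuous_norm.continuousAt.eventually (gt_mem_nhds hr1)
  refine continuousAt_of_dominated (bound := fun _ => C * M) ?_ ?_ (integrable_const _) ?_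
  · filter_upwards [hev] with y hy
    exact ((continuous_sphere_section hF (hy.trans hr2)).mul hu).aestronglyMeasurable
  · filter_upwards [hev] with y hy
    refine ae_of_all _ fun θ => ?_
    rw [norm_mul]
    exact mul_le_mul (hC θ y hy.le) (hM θ) (norm_nonneg _) ((abs_nonneg _).trans (hC θ y hy.le))
  · refine ae_of_all _ fun θ => ?_
    have hne : ((θ : E n), ξ) ∈ {p : E n × E n | p.1 ≠ p.2} := by
      intro h
      have := norm_eq_of_mem_sphere θ
      simp only at h
      rw [h] at this; linarith
    have ho : IsOpen {p : E n × E n | p.1 ≠ p.2} := isOpen_ne_fun continuous_fst continuous_snd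
    have h1 := hF.continuousAt (ho.mem_nhds hne)
    have h2 : ContinuousAt (fun y : E n => ((θ : E n), y)) ξ := by fun_prop
    exact (ContinuousAt.comp (f := fun y : E n => ((θ : E n), y)) h1 h2).mul continuousAt_const

theorem hasDerivAt_sphere_integral (hF : ContinuousOn (fun p : E n × E n => F p.1 p.2)
    {p | p.1 ≠ p.2}) (hF' : ContinuousOn (fun p : E n × E n => F' p.1 p.2) {p | p.1 ≠ p.2})
    (i : Fin n)
    (hd : ∀ x ξ : E n, x ≠ ξ → HasDerivAt (fun t : ℝ => F x (ξ + t • ev i)) (F' x ξ) 0)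
    {u : sphere (0 : E n) 1 → ℝ} (hu : Continuous u) {ξ : E n} (hξ : ‖ξ‖ < 1) :
    HasDerivAt (fun t : ℝ => ∫ θ : sphere (0 : E n) 1, F θ (ξ + t • ev i) * u θ ∂(surf n))
      (∫ θ : sphere (0 : E n) 1, F' θ ξ * u θ ∂(surf n)) 0 := by
  obtain ⟨r, hr1, hr2⟩ := exists_between hξ
  obtain ⟨C, hC⟩ := exists_bound_sphere_prod hF' hr2
  obtain ⟨M, hM⟩ : ∃ M, ∀ θ, |u θ| ≤ M := by
    obtain ⟨M, hM⟩ := isCompact_univ.exists_bound_of_continuousOn hu.continuousOn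
    exact ⟨M, fun θ => hM θ trivial⟩
  have hline : Continuous fun t : ℝ => ξ + t • ev i := by fun_prop
  have hs : {t : ℝ | ‖ξ + t • ev i‖ < r} ∈ 𝓝 (0 : ℝ) :=
    (isOpen_lt (by fun_prop) continuous_const).mem_nhds (by simpa using hr1)
  have key := hasDerivAt_integral_of_dominated_loc_of_deriv_le (μ := surf n)
    (F := fun (t : ℝ) (θ : sphere (0 : E n) 1) => F θ (ξ + t • ev i) * u θ)
    (F' := fun (t : ℝ) (θ : sphere (0 : E n) 1) => F' θ (ξ + t • ev i) * u θ)
    (x₀ := 0) (bound := fun _ => C * M) hs ?_ ?_ ?_ ?_ (integrable_const _) ?_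
  · simpa using key.2
  · filter_upwards [hs] with t ht
    exact ((continuous_sphere_section hF (lt_trans ht hr2)).mul hu).aestronglyMeasurable
  · have h0 : Continuous fun θ : sphere (0 : E n) 1 => F θ (ξ + (0 : ℝ) • ev i) * u θ :=
      (continuous_sphere_section hF (by simpa using hξ)).mul hu
    exact h0.integrable_of_hasCompactSupport (HasCompactSupport.of_compactSpace _)
  · exact ((continuous_sphere_section hF' (by simpa using hξ)).mul hu).aestronglyMeasurable
  · refine ae_of_all _ fun θ t ht => ?_
    have ht' : ‖ξ + t • ev i‖ < r := ht
    rw [norm_mul]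
    exact mul_le_mul (hC θ _ ht'.le) (hM θ) (norm_nonneg _) ((abs_nonneg _).trans (hC θ _ ht'.le))
  · refine ae_of_all _ fun θ t ht => ?_
    have ht' : ‖ξ + t • ev i‖ < r := ht
    have hne : (θ : E n) ≠ ξ + t • ev i := by
      intro h
      have := norm_eq_of_mem_sphere θ
      rw [h] at this; linarith
    have h7 : HasDerivAt (fun s : ℝ => F θ (ξ + t • ev i + s • ev i)) (F' θ (ξ + t • ev i))
        (t - t) := by rw [sub_self]; exact hd _ _ hne
    have h8 := (h7.comp_sub_const t t).mul_const (u θ)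
    refine h8.congr_of_eventuallyEq (Eventually.of_forall fun s => ?_)
    simp only [sub_smul]; congr 2; abel

theorem isHarm_sphere_integral {u : sphere (0 : E n) 1 → ℝ} (hu : Continuous u) :
    IsHarm 1 (fun ξ : E n => ∫ θ : sphere (0 : E n) 1, pois θ ξ * u θ ∂(surf n)) := by
  refine ⟨continuousOn_sphere_integral continuousOn_pois hu,
    fun i ξ => ∫ θ : sphere (0 : E n) 1, poisD i θ ξ * u θ ∂(surf n),
    fun i ξ => ∫ θ : sphere (0 : E n) 1, poisDD i θ ξ * u θ ∂(surf n),
    fun i ξ hξ => hasDerivAt_sphere_integral continuousOn_pois (continuousOn_poisD i) i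
      (fun x ξ h => hasDerivAt_pois h i) hu (by simpa using hξ),
    fun i ξ hξ => hasDerivAt_sphere_integral (continuousOn_poisD i) (continuousOn_poisDD i) i
      (fun x ξ h => hasDerivAt_poisD h i) hu (by simpa using hξ), fun ξ hξ => ?_⟩
  rw [mem_ball_zero_iff] at hξ
  rw [← integral_finsetSum]
  · simp only [← Finset.sum_mul]
    have : ∀ θ : sphere (0 : E n) 1, ∑ i, poisDD i (θ : E n) ξ = 0 := fun θ => by
      refine sum_poisDD fun h => ?_
      have := norm_eq_of_mem_sphere θ
      rw [h] at this; linarith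
    simp [this]
  · intro i _
    exact ((continuous_sphere_section (continuousOn_poisDD i) hξ).mul
      hu).integrable_of_hasCompactSupport (HasCompactSupport.of_compactSpace _)

theorem integrable_sphere_pois {u : sphere (0 : E n) 1 → ℝ} (hu : Continuous u) {ξ : E n}
    (hξ : ‖ξ‖ < 1) : Integrable (fun θ : sphere (0 : E n) 1 => pois (θ : E n) ξ * u θ) (surf n) :=
  ((continuous_sphere_section continuousOn_pois hξ).mul
      hu).integrable_of_hasCompactSupport (HasCompactSupport.of_compactSpace _)

end SphereIntegral

/-- An isometry carries one point to the other and preserves both the kernel and the surface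
measure. The kernel is nonnegative, so the invariance proved for lower integrals suffices. -/
theorem integral_sphere_pois_of_norm_eq (hn : 1 ≤ n) {ξ η : E n} (h : ‖ξ‖ = ‖η‖) (hξ : ‖ξ‖ < 1) :
    ∫ θ : sphere (0 : E n) 1, pois (θ : E n) ξ ∂(surf n)
      = ∫ θ : sphere (0 : E n) 1, pois (θ : E n) η ∂(surf n) := by
  obtain ⟨Q, rfl⟩ := exists_isometry_map_eq h
  have hpos : ∀ ζ : E n, ‖ζ‖ < 1 → ∀ θ : sphere (0 : E n) 1, 0 ≤ pois (θ : E n) ζ := fun ζ hζ θ =>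
    pois_nonneg (by rw [norm_eq_of_mem_sphere]; exact hζ.le)
  have hQξ : ‖Q ξ‖ < 1 := by rwa [Q.norm_map]
  rw [integral_eq_lintegral_of_nonneg_ae (ae_of_all _ (hpos ξ hξ))
      (continuous_sphere_section continuousOn_pois hξ).aestronglyMeasurable,
    integral_eq_lintegral_of_nonneg_ae (ae_of_all _ (hpos _ hQξ))
      (continuous_sphere_section continuousOn_pois hQξ).aestronglyMeasurable]
  congr 1
  have hm : Measurable fun x : E n => ENNReal.ofReal (pois x (Q ξ)) :=
    (measurable_pois.comp (measurable_id.prodMk measurable_const)).ennreal_ofReal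
  rw [← lintegral_surf_comp_isometry hn Q _ hm]
  simp only [pois_isometry]

/-- The total mass is a harmonic function of `ξ` that depends only on `|ξ|`. By the maximum
principle it is constant, and its value at the origin is the area of the sphere. -/
theorem integral_sphere_pois (hn : 1 ≤ n) {ξ : E n} (hξ : ‖ξ‖ < 1) :
    ∫ θ : sphere (0 : E n) 1, pois (θ : E n) ξ ∂(surf n) = sphereArea n := by
  set v : E n → ℝ := fun ξ => ∫ θ : sphere (0 : E n) 1, pois (θ : E n) ξ ∂(surf n) with hv
  have hvh : IsHarm 1 v := by
    simpa using isHarm_sphere_integral (n := n) (u := fun _ => 1) continuous_const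
  have hv0 : v 0 = sphereArea n := by
    simp only [hv, pois, norm_eq_of_mem_sphere, sub_zero, norm_zero]
    simp [surf_real_univ hn]
  rcases eq_or_ne ξ 0 with rfl | hne
  · exact hv0
  have hpos : 0 < ‖ξ‖ := norm_pos_iff.2 hne
  -- The maximum principle is applied on the ball of radius `|ξ|` itself: near its boundary the
  -- radial function is close to its value at `ξ`.
  have hz := ((hvh.mono hξ.le).sub (isHarm_const ‖ξ‖ (v ξ))).eq_zero hn (fun ε hε => ?_) 0
    (by simpa using hpos)
  · have : v 0 = v ξ := by linarith
    rw [← hv0, this]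
  · have hc : ContinuousAt (fun t : ℝ => v (t • ξ)) 1 := by
      have h1 := hvh.1.continuousAt (isOpen_ball.mem_nhds
        (show (1 : ℝ) • ξ ∈ ball (0 : E n) 1 by simpa using hξ))
      exact ContinuousAt.comp (f := fun t : ℝ => t • ξ) h1 (by fun_prop)
    obtain ⟨δ, hδ, hδ'⟩ := Metric.continuousAt_iff.1 hc ε hε
    refine ⟨(1 - δ) * ‖ξ‖, by nlinarith, fun η h1 h2 => ?_⟩
    have hη : v η = v ((‖η‖ / ‖ξ‖) • ξ) := by
      refine integral_sphere_pois_of_norm_eq hn ?_ (h2.trans hξ)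
      rw [norm_smul, Real.norm_of_nonneg (by positivity)]
      field_simp
    rw [hη]
    have := hδ' (x := ‖η‖ / ‖ξ‖) ?_
    · simpa [Real.dist_eq] using this.le
    · rw [Real.dist_eq, abs_lt]
      have h3 : 1 - δ < ‖η‖ / ‖ξ‖ := by rwa [lt_div_iff₀ hpos]
      have h4 : ‖η‖ / ‖ξ‖ < 1 := by rwa [div_lt_one hpos]
      constructor <;> linarith

/-- As a function of `ζ` the left side is the Poisson integral of the boundary values of `pois y`,
while the right side is harmonic inside because `y` lies outside. Both have the same boundary
behaviour, so uniqueness for the Dirichlet problem applies. -/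
theorem integral_sphere_pois_mul_pois (hn : 1 ≤ n) {y ζ : E n} (hy : 1 < ‖y‖) (hζ : ‖ζ‖ < 1) :
    ∫ θ : sphere (0 : E n) 1, pois (θ : E n) ζ * pois y θ ∂(surf n)
      = sphereArea n * pois y ζ := by
  have hA := sphereArea_pos hn
  have hcont : ContinuousOn (fun ξ => pois y ξ) (closedBall (0 : E n) 1) := by
    refine continuousOn_pois.comp (f := fun ξ => (y, ξ)) (by fun_prop) ?_
    rintro ξ hξ (rfl : y = ξ)
    exact absurd (mem_closedBall_zero_iff.1 hξ) hy.not_ge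
  have hu : Continuous fun θ : sphere (0 : E n) 1 => pois y θ :=
    continuousOn_univ.1 (hcont.comp continuous_subtype_val.continuousOn
      fun θ _ => sphere_subset_closedBall θ.2)
  have hU := (isHarm_sphere_integral hu).sub ((isHarm_pois hy.le).const_mul (sphereArea n))
  suffices h : _ from sub_eq_zero.1 (hU.eq_zero hn h ζ (by simpa using hζ))
  intro ε hε
  have huc := (isCompact_closedBall (0 : E n) 1).uniformContinuousOn_of_continuous hcont
  obtain ⟨M, hM⟩ := (isCompact_closedBall (0 : E n) 1).exists_bound_of_continuousOn hcont
  have hM0 : 0 ≤ M := (norm_nonneg _).trans (hM 0 (by simp))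
  -- Half of `ε` is spent on `θ` near `ξ`, through uniform continuity and the total mass, and half
  -- on the remaining `θ`; each half equals `ε'` times the area.
  set ε' := ε / (2 * sphereArea n) with hε'
  obtain ⟨δ, hδ, hδ'⟩ := Metric.uniformContinuousOn_iff.1 huc ε' (by positivity)
  -- In the shell of thickness `q` the Poisson kernel at distance at least `δ` is at most `2 q / δ^n
  -- = ε' / (2 M + 1)`, which absorbs the oscillation `2 M`; the summand `1` keeps the denominator
  -- positive.
  set q := ε / (2 * sphereArea n) / (2 * (2 * M + 1)) * δ ^ n with hq
  have hq0 : 0 < q := by positivity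
  refine ⟨1 - q, by linarith, fun ξ h1 h2 => ?_⟩
  have hpξ : ∀ θ : sphere (0 : E n) 1, 0 ≤ pois (θ : E n) ξ := fun θ =>
    pois_nonneg (by rw [norm_eq_of_mem_sphere]; exact h2.le)
  have hi1 := integrable_sphere_pois hu h2
  have hi2 := integrable_sphere_pois (u := fun _ => pois y ξ) continuous_const h2
  have hi3 : Integrable (fun θ : sphere (0 : E n) 1 => pois (θ : E n) ξ) (surf n) := by
    simpa using integrable_sphere_pois (u := fun _ => (1 : ℝ)) continuous_const h2
  have e1 : sphereArea n * pois y ξ =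
      ∫ θ : sphere (0 : E n) 1, pois (θ : E n) ξ * pois y ξ ∂(surf n) := by
    rw [integral_mul_const, integral_sphere_pois hn h2]
  rw [e1, ← integral_sub hi1 hi2]
  have hbd : ∀ θ : sphere (0 : E n) 1, ‖pois (θ : E n) ξ * pois y θ - pois (θ : E n) ξ * pois y ξ‖
      ≤ ε' * pois (θ : E n) ξ + ε' := by
    intro θ
    have hθ1 : ‖(θ : E n)‖ = 1 := norm_eq_of_mem_sphere θ
    rw [← mul_sub, norm_mul, Real.norm_of_nonneg (hpξ θ)]
    by_cases hd : dist (θ : E n) ξ < δ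
    · have h3 := hδ' θ (by simp [hθ1]) ξ (by simpa using h2.le) hd
      rw [Real.dist_eq, ← Real.norm_eq_abs] at h3
      have := mul_le_mul_of_nonneg_left h3.le (hpξ θ)
      have : 0 ≤ ε' := by positivity
      linarith
    · rw [not_lt, dist_eq_norm] at hd
      have h4 : ‖pois y θ - pois y ξ‖ ≤ 2 * M := by
        refine (norm_sub_le _ _).trans ?_
        have := hM θ (by simp [hθ1])
        have := hM ξ (by simpa using h2.le)
        linarith
      have h5 : pois (θ : E n) ξ ≤ 2 * q / δ ^ n := by
        rw [pois, hθ1]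
        have : (1 : ℝ) ^ 2 - ‖ξ‖ ^ 2 ≤ 2 * q := by nlinarith [norm_nonneg ξ]
        gcongr
      have h6 : 2 * q / δ ^ n = ε' / (2 * M + 1) := by
        rw [hq, ← hε']; field_simp
      have h7 : pois (θ : E n) ξ * ‖pois y θ - pois y ξ‖ ≤ ε' / (2 * M + 1) * (2 * M) := by
        rw [h6] at h5
        exact mul_le_mul h5 h4 (norm_nonneg _) (by positivity)
      have h8 : ε' / (2 * M + 1) * (2 * M) ≤ ε' := by
        rw [div_mul_eq_mul_div, div_le_iff₀ (by positivity)]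
        have : 0 ≤ ε' := by positivity
        nlinarith
      have h9 : 0 ≤ ε' * pois (θ : E n) ξ := mul_nonneg (by positivity) (hpξ θ)
      linarith
  have h10 := norm_integral_le_of_norm_le (μ := surf n) ((hi3.const_mul ε').add
    (integrable_const ε')) (ae_of_all _ hbd)
  refine h10.trans_eq ?_
  simp only [Pi.add_apply]
  rw [integral_add (hi3.const_mul ε') (integrable_const ε'), integral_const_mul,
    integral_sphere_pois hn h2, integral_const, surf_real_univ hn, smul_eq_mul, hε']
  field_simp
  norm_num

/-- The unit-sphere formula after rescaling by `ρ`, under which `pois` is homogeneous of degree `2 -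
n`. -/
theorem integral_sphere_pois_mul_pois_of_radius (hn : 1 ≤ n) {x ξ : E n} {ρ : ℝ} (h1 : ‖ξ‖ < ρ)
    (h2 : ρ < ‖x‖) :
    ∫ θ : sphere (0 : E n) 1, pois x (ρ • (θ : E n)) * pois (ρ • (θ : E n)) ξ ∂(surf n)
      = ρ ^ 2 / ρ ^ n * (sphereArea n * pois x ξ) := by
  have hρ : 0 < ρ := (norm_nonneg _).trans_lt h1
  have e : ∀ z : E n, z = ρ • (ρ⁻¹ • z) := fun z => (smul_inv_smul₀ hρ.ne' z).symm
  have hx : 1 < ‖ρ⁻¹ • x‖ := by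
    rw [norm_smul, norm_inv, Real.norm_of_nonneg hρ.le, ← div_eq_inv_mul]
    exact (one_lt_div hρ).2 h2
  have hξ : ‖ρ⁻¹ • ξ‖ < 1 := by
    rw [norm_smul, norm_inv, Real.norm_of_nonneg hρ.le, ← div_eq_inv_mul]
    exact (div_lt_one hρ).2 h1
  have key := integral_sphere_pois_mul_pois hn hx hξ
  have e1 : pois x ξ = ρ ^ 2 / ρ ^ n * pois (ρ⁻¹ • x) (ρ⁻¹ • ξ) := by
    rw [← pois_smul hρ, ← e, ← e]
  have e2 : ∀ θ : E n, pois x (ρ • θ) = ρ ^ 2 / ρ ^ n * pois (ρ⁻¹ • x) θ := fun θ => by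
    rw [← pois_smul hρ, ← e]
  have e3 : ∀ θ : E n, pois (ρ • θ) ξ = ρ ^ 2 / ρ ^ n * pois θ (ρ⁻¹ • ξ) := fun θ => by
    rw [← pois_smul hρ, ← e]
  simp only [e2, e3]
  have e4 : ∀ θ : sphere (0 : E n) 1, ρ ^ 2 / ρ ^ n * pois (ρ⁻¹ • x) (θ : E n) *
      (ρ ^ 2 / ρ ^ n * pois (θ : E n) (ρ⁻¹ • ξ)) = (ρ ^ 2 / ρ ^ n) ^ 2 *
      (pois (θ : E n) (ρ⁻¹ • ξ) * pois (ρ⁻¹ • x) θ) := fun θ => by ring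
  simp only [e4]
  rw [integral_const_mul, key, e1]
  ring

/-! ### Inverting integral operators -/

section Inversion

variable {X : Type*} [MeasurableSpace X] {μ : Measure X} {k l m : X → X → ℝ} {C D D' : ℝ≥0}
  {f g : X → ℝ}

theorem IsSchur.abs (h : IsSchur μ k C) : IsSchur μ (fun x ξ => |k x ξ|) C :=
  ⟨continuous_abs.measurable.comp h.meas, by simpa using h.row, by simpa using h.col⟩

variable [SFinite μ]

/-- For a good row `x`, integrating the product of absolute values over both remaining variables
gives at most `C D`. Hence the composition integral converges for almost every `ξ`. -/
theorem IsSchur.ae_integrable_comp (hk : IsSchur μ k C) (hl : IsSchur μ l D) :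
    ∀ᵐ x ∂μ, ∀ᵐ ξ ∂μ, Integrable (fun η => k x η * l η ξ) μ := by
  filter_upwards [hk.row] with x hx
  have hkm : Measurable fun η => ‖k x η‖ₑ := hk.meas.of_uncurry_left.enorm
  have hm : Measurable fun p : X × X => ‖k x p.2‖ₑ * ‖l p.2 p.1‖ₑ :=
    (hkm.comp measurable_snd).mul (hl.meas.enorm.comp measurable_swap)
  have hfin : ∫⁻ ξ, ∫⁻ η, ‖k x η‖ₑ * ‖l η ξ‖ₑ ∂μ ∂μ < ⊤ := by
    rw [lintegral_lintegral_swap hm.aemeasurable]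
    calc ∫⁻ η, ∫⁻ ξ, ‖k x η‖ₑ * ‖l η ξ‖ₑ ∂μ ∂μ ≤ ∫⁻ η, ‖k x η‖ₑ * D ∂μ := by
          refine lintegral_mono_ae (hl.row.mono fun η hη => ?_)
          rw [lintegral_const_mul _ hl.meas.of_uncurry_left.enorm]
          gcongr
      _ ≤ C * D := by rw [lintegral_mul_const _ hkm]; gcongr
      _ < ⊤ := by finiteness
  filter_upwards [ae_lt_top hm.lintegral_prod_right' hfin.ne] with ξ hξ
  refine ⟨(hk.meas.of_uncurry_left.mul hl.meas.of_uncurry_right).aestronglyMeasurable, ?_⟩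
  simpa [HasFiniteIntegral, enorm_mul] using hξ

/-- Fubini for fixed `x`. Absolute convergence follows by applying `|k|` to the square-integrable
function obtained from `|l|` and `|f|`. -/
theorem IsSchur.kop_kop (hk : IsSchur μ k C) (hl : IsSchur μ l D)
    (hm : ∀ᵐ x ∂μ, ∀ᵐ ξ ∂μ, ∫ η, k x η * l η ξ ∂μ = m x ξ) (hf : MemLp f 2 μ) :
    kop μ k (kop μ l f) =ᵐ[μ] kop μ m f := by
  have habs := hk.abs.ae_integrable (hl.abs.memLp_kop hf.norm)
  filter_upwards [habs, hm] with x hx hmx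
  have hmeas : AEStronglyMeasurable (fun p : X × X => k x p.1 * (l p.1 p.2 * f p.2)) (μ.prod μ) :=
    ((hk.meas.of_uncurry_left).comp measurable_fst).aestronglyMeasurable.mul
      (hl.aestronglyMeasurable_mul hf.1)
  have hInt : Integrable (fun p : X × X => k x p.1 * (l p.1 p.2 * f p.2)) (μ.prod μ) := by
    rw [integrable_prod_iff hmeas]
    refine ⟨(hl.ae_integrable hf).mono fun η hη => hη.const_mul (k x η), ?_⟩
    refine hx.congr (ae_of_all _ fun η => ?_)
    simp only [kop, norm_mul, Real.norm_eq_abs, integral_const_mul]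
  calc kop μ k (kop μ l f) x = ∫ η, ∫ ξ, k x η * (l η ξ * f ξ) ∂μ ∂μ := by
        simp only [kop, integral_const_mul]
    _ = ∫ ξ, ∫ η, k x η * (l η ξ * f ξ) ∂μ ∂μ := integral_integral_swap hInt
    _ = ∫ ξ, m x ξ * f ξ ∂μ := by
        refine integral_congr_ae (hmx.mono fun ξ hξ => ?_)
        simp only [← mul_assoc, integral_mul_const, hξ]

/-- The identity says `(1 - l)(1 + k) = 1 + k - l - l k = 1`. The companion below uses the product
in the other order. -/
theorem IsSchur.resolvent (hk : IsSchur μ k C) (hl : IsSchur μ l D)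
    (hlk : ∀ᵐ x ∂μ, ∀ᵐ ξ ∂μ, ∫ η, l x η * k η ξ ∂μ = k x ξ - l x ξ) (hf : MemLp f 2 μ)
    (hg : g =ᵐ[μ] fun x => f x + kop μ k f x) :
    MemLp g 2 μ ∧ f =ᵐ[μ] fun x => g x - kop μ l g x := by
  have hkf := hk.memLp_kop hf
  refine ⟨(memLp_congr_ae hg).2 (hf.add hkf), ?_⟩
  have h3 : kop μ (fun x ξ => k x ξ - l x ξ) f =ᵐ[μ] fun x => kop μ k f x - kop μ l f x := by
    filter_upwards [hk.ae_integrable hf, hl.ae_integrable hf] with x h1 h2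
    simp only [kop, sub_mul]
    exact integral_sub h1 h2
  rw [kop_congr hg]
  filter_upwards [hg, hl.kop_add hf hkf, hl.kop_kop hk hlk hf, h3] with x h1 h2 h4 h5
  rw [h1, h2, h4, h5]; ring

theorem IsSchur.resolvent' (hk : IsSchur μ k C) (hl : IsSchur μ l D)
    (hkl : ∀ᵐ x ∂μ, ∀ᵐ ξ ∂μ, ∫ η, k x η * l η ξ ∂μ = k x ξ - l x ξ) (hg : MemLp g 2 μ)
    (hf : f =ᵐ[μ] fun x => g x - kop μ l g x) :
    MemLp f 2 μ ∧ g =ᵐ[μ] fun x => f x + kop μ k f x := by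
  have hlg := hl.memLp_kop hg
  refine ⟨(memLp_congr_ae hf).2 (hg.sub hlg), ?_⟩
  have h3 : kop μ (fun x ξ => k x ξ - l x ξ) g =ᵐ[μ] fun x => kop μ k g x - kop μ l g x := by
    filter_upwards [hk.ae_integrable hg, hl.ae_integrable hg] with x h1 h2
    simp only [kop, sub_mul]
    exact integral_sub h1 h2
  rw [kop_congr hf]
  filter_upwards [hf, hk.kop_sub hg hlg, hk.kop_kop hl hkl hg, h3] with x h1 h2 h4 h5
  rw [h1, h2, h4, h5]; ring

end Inversion

/-! ### Composition of Volterra kernels -/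

/-- The Volterra kernel `a(|x|² - |ξ|²) (|x|² - |ξ|²) / (A |x - ξ|^n)` on `|ξ| < |x|`. -/
noncomputable def vker (a : ℝ → ℝ) (x ξ : E n) : ℝ :=
  if ‖ξ‖ < ‖x‖ then a (‖x‖ ^ 2 - ‖ξ‖ ^ 2) * pois x ξ / sphereArea n else 0

/-- `(a ⋆ b)(s) = ½ ∫_0^s a(s - t) b(t) dt`. -/
noncomputable def vconv (a b : ℝ → ℝ) (s : ℝ) : ℝ := 1 / 2 * ∫ t in (0 : ℝ)..s, a (s - t) * b t

/-- Commutativity is what makes one resolvent identity serve as both a left and a right inverse. -/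
theorem vconv_comm (a b : ℝ → ℝ) : vconv a b = vconv b a := by
  ext s
  simp only [vconv]
  congr 1
  have := intervalIntegral.integral_comp_sub_left (fun t => b (s - t) * a t) s (a := 0) (b := s)
  simp only [sub_sub_cancel, sub_self, sub_zero] at this
  rw [← this]
  congr 1; ext t; ring

theorem measurable_vker {a : ℝ → ℝ} (ha : Measurable a) :
    Measurable (Function.uncurry (vker a : E n → E n → ℝ)) := by
  unfold vker Function.uncurry
  refine Measurable.ite (measurableSet_lt (by fun_prop) (by fun_prop)) ?_ measurable_const
  exact ((ha.comp (by fun_prop)).mul measurable_pois).div_const _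

/-- On the support `|x| + |ξ| ≤ 2 |x|`. The factor `|x|` is kept, since it supplies the first-order
zero at the origin needed for the `H¹` bound. -/
theorem abs_vker_le {a : ℝ → ℝ} (hn : 1 ≤ n) {C : ℝ} {x : E n} {r : ℝ} (hx : ‖x‖ ≤ r)
    (hC : ∀ s ∈ Icc 0 (r ^ 2), |a s| ≤ C) (ξ : E n) :
    |vker a x ξ| ≤ 2 * C / sphereArea n * (‖x‖ * wsing (x - ξ)) := by
  have hA := sphereArea_pos hn
  have hC0 : 0 ≤ C := (abs_nonneg _).trans (hC 0 ⟨le_rfl, by positivity⟩)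
  have hw := wsing_nonneg (x - ξ)
  unfold vker
  split_ifs with h
  · have h1 : |a (‖x‖ ^ 2 - ‖ξ‖ ^ 2)| ≤ C := by
      apply hC
      have h2 : ‖ξ‖ ^ 2 ≤ ‖x‖ ^ 2 := by gcongr
      have h3 : ‖x‖ ^ 2 ≤ r ^ 2 := by gcongr
      exact ⟨by linarith, by nlinarith [sq_nonneg ‖ξ‖]⟩
    have h2 : |pois x ξ| ≤ 2 * (‖x‖ * wsing (x - ξ)) := by
      refine (abs_pois_le x ξ).trans ?_
      nlinarith
    rw [abs_div, abs_mul, abs_of_pos hA, div_mul_eq_mul_div]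
    refine div_le_div_of_nonneg_right ?_ hA.le
    calc _ ≤ C * (2 * (‖x‖ * wsing (x - ξ))) := by gcongr
      _ = _ := by ring
  · rw [abs_zero]; positivity

theorem exists_bound_Icc {a : ℝ → ℝ} (ha : Continuous a) (r : ℝ) :
    ∃ C, 0 ≤ C ∧ ∀ s ∈ Icc (0 : ℝ) (r ^ 2), |a s| ≤ C := by
  obtain ⟨C, hC⟩ := isCompact_Icc.exists_bound_of_continuousOn (s := Icc (0 : ℝ) (r ^ 2))
    ha.continuousOn
  exact ⟨C, (norm_nonneg _).trans (hC 0 ⟨le_rfl, by positivity⟩), hC⟩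

theorem ae_mem_ball (R : ℝ) : ∀ᵐ x ∂(ballMeasure n R), ‖x‖ ≤ R := by
  filter_upwards [ae_restrict_mem (measurableSet_closedBall (x := (0 : E n)) (ε := R))] with x hx
  simpa using hx

theorem exists_isSchur_vker (hn : 1 ≤ n) (R : ℝ) {a : ℝ → ℝ} (ha : Continuous a) :
    ∃ C, IsSchur (ballMeasure n R) (vker a) C := by
  obtain ⟨C, hC0, hC⟩ := exists_bound_Icc ha R
  have hA := sphereArea_pos hn
  refine ⟨_, (isSchur_wsing hn R).of_abs_le (measurable_vker ha.measurable)
    (Real.toNNReal (2 * C / sphereArea n * R)) ?_ ?_⟩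
  · filter_upwards [ae_mem_ball R] with x hx
    have hR := (norm_nonneg _).trans hx
    refine ae_of_all _ fun ξ => (abs_vker_le hn hx hC ξ).trans ?_
    rw [Real.coe_toNNReal _ (by positivity), abs_of_nonneg (wsing_nonneg _), mul_assoc]
    have := wsing_nonneg (x - ξ)
    gcongr
  · refine ae_of_all _ fun ξ => ?_
    filter_upwards [ae_mem_ball R] with x hx
    have hR := (norm_nonneg _).trans hx
    refine (abs_vker_le hn hx hC ξ).trans ?_
    rw [Real.coe_toNNReal _ (by positivity), abs_of_nonneg (wsing_nonneg _), mul_assoc]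
    have := wsing_nonneg (x - ξ)
    gcongr

/-- The substitution `t = r² - q²`; its derivative `2 r` accounts for the factor `1/2` in `vconv`.
-/
theorem integral_radial_eq_vconv {a b : ℝ → ℝ} (ha : Continuous a) (hb : Continuous b) (p q : ℝ) :
    ∫ r in q..p, r * (a (p ^ 2 - r ^ 2) * b (r ^ 2 - q ^ 2)) = vconv a b (p ^ 2 - q ^ 2) := by
  have h := intervalIntegral.integral_comp_mul_deriv (a := q) (b := p)
    (f := fun r => r ^ 2 - q ^ 2) (f' := fun r => 2 * r)
    (g := fun t => a (p ^ 2 - q ^ 2 - t) * b t) (fun r _ => by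
      simpa using (hasDerivAt_pow 2 r).sub_const (q ^ 2)) (by fun_prop) (by fun_prop)
  simp only [sub_self, Function.comp_def] at h
  rw [vconv, ← h, ← intervalIntegral.integral_const_mul]
  congr 1; ext r
  rw [show p ^ 2 - q ^ 2 - (r ^ 2 - q ^ 2) = p ^ 2 - r ^ 2 by ring]
  ring

/-- The densities depend only on the radius of `η`, so the Poisson formula does the angular
integral. The power of `r` left over is exactly one, and the radial integral becomes a convolution
in `|x|² - |ξ|²`. -/
theorem integral_vker_mul_vker (hn : 1 ≤ n) {R : ℝ} {a b : ℝ → ℝ} (ha : Continuous a)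
    (hb : Continuous b) {x ξ : E n} (hx : ‖x‖ ≤ R)
    (hInt : Integrable (fun η => vker a x η * vker b η ξ) (ballMeasure n R)) :
    ∫ η, vker a x η * vker b η ξ ∂(ballMeasure n R) = vker (vconv a b) x ξ := by
  have hA := sphereArea_pos hn
  have hz : ∀ η : E n, ¬ (‖ξ‖ < ‖η‖ ∧ ‖η‖ < ‖x‖) → vker a x η * vker b η ξ = 0 := by
    intro η h
    by_cases h1 : ‖η‖ < ‖x‖
    · have h2 : ¬ ‖ξ‖ < ‖η‖ := fun h2 => h ⟨h2, h1⟩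
      simp [vker, h2]
    · simp [vker, h1]
  by_cases hξx : ‖ξ‖ < ‖x‖
  swap
  · have : ∀ η : E n, vker a x η * vker b η ξ = 0 := fun η =>
      hz η fun h => hξx (h.1.trans h.2)
    simp only [this, integral_zero]
    simp [vker, hξx]
  have hsupp : ∀ η : E n, η ∉ B n R → vker a x η * vker b η ξ = 0 := fun η hη => by
    refine hz η fun h => hη ?_
    simpa using h.2.le.trans hx
  have hInt' : Integrable (fun η => vker a x η * vker b η ξ) := by
    rwa [← integrableOn_iff_integrable_of_support_subset (s := B n R)]
    intro η hη
    by_contra h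
    exact hη (hsupp η h)
  rw [setIntegral_eq_integral_of_forall_compl_eq_zero hsupp, integral_polar_symm _ hInt' hn]
  have e : ∀ r ∈ Ioi (0 : ℝ), r ^ (n - 1) * ∫ θ : sphere (0 : E n) 1,
      vker a x (r • (θ : E n)) * vker b (r • (θ : E n)) ξ ∂(surf n)
      = (Ioo ‖ξ‖ ‖x‖).indicator (fun r => r * (a (‖x‖ ^ 2 - r ^ 2) * b (r ^ 2 - ‖ξ‖ ^ 2)) *
          (pois x ξ / sphereArea n)) r := by
    intro r hr
    have hr' : (0 : ℝ) < r := hr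
    have h1 : ∀ θ : sphere (0 : E n) 1, ‖r • (θ : E n)‖ = r := fun θ => by
      rw [norm_smul, norm_eq_of_mem_sphere, Real.norm_of_nonneg hr'.le, mul_one]
    by_cases hmem : r ∈ Ioo ‖ξ‖ ‖x‖
    · rw [indicator_of_mem hmem]
      have h2 : ∀ θ : sphere (0 : E n) 1, vker a x (r • (θ : E n)) * vker b (r • (θ : E n)) ξ
          = a (‖x‖ ^ 2 - r ^ 2) * b (r ^ 2 - ‖ξ‖ ^ 2) / sphereArea n ^ 2 *
            (pois x (r • (θ : E n)) * pois (r • (θ : E n)) ξ) := by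
        intro θ
        simp only [vker, h1, hmem.1, hmem.2, if_true]
        field_simp
      simp only [h2]
      rw [integral_const_mul, integral_sphere_pois_mul_pois_of_radius hn hmem.1 hmem.2]
      obtain ⟨m, rfl⟩ : ∃ m, n = m + 1 := ⟨n - 1, by omega⟩
      rw [Nat.add_sub_cancel, pow_succ r m]
      field_simp
    · rw [indicator_of_notMem hmem]
      have h2 : ∀ θ : sphere (0 : E n) 1,
          vker a x (r • (θ : E n)) * vker b (r • (θ : E n)) ξ = 0 := fun θ =>
        hz _ fun h => hmem (by rw [h1] at h; exact h)
      simp [h2]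
  rw [setIntegral_congr_fun measurableSet_Ioi e, integral_indicator measurableSet_Ioo,
    Measure.restrict_restrict measurableSet_Ioo, Set.inter_eq_left.2 (show Ioo ‖ξ‖ ‖x‖ ⊆ Ioi 0 from
      fun r hr => (norm_nonneg ξ).trans_lt hr.1), integral_mul_const, ← integral_Ioc_eq_integral_Ioo,
    ← intervalIntegral.integral_of_le hξx.le, integral_radial_eq_vconv ha hb]
  simp only [vker, hξx, if_true]
  ring

/-! ### The power series behind the Bessel functions -/

/-- The coefficients `1 / (k! (k+1)!)`. -/
noncomputable def serCoeff (k : ℕ) : ℝ := ((k ! : ℝ) * ((k + 1)! : ℝ))⁻¹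

/-- The entire function `∑ z^k / (k! (k+1)!)`. -/
noncomputable def ser (z : ℝ) : ℝ := ∑' k : ℕ, serCoeff k * z ^ k

theorem serCoeff_pos (k : ℕ) : 0 < serCoeff k := by unfold serCoeff; positivity

theorem summable_ser (z : ℝ) : Summable fun k : ℕ => ‖serCoeff k * z ^ k‖ := by
  refine Summable.of_nonneg_of_le (fun _ => norm_nonneg _) (fun k => ?_)
    (Real.summable_pow_div_factorial |z|)
  have h1 : (1 : ℝ) ≤ ((k + 1)! : ℝ) := by exact_mod_cast Nat.factorial_pos _
  have h2 : (0 : ℝ) < (k ! : ℝ) := by exact_mod_cast Nat.factorial_pos _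
  rw [norm_mul, norm_pow, Real.norm_eq_abs, Real.norm_eq_abs, abs_of_pos (serCoeff_pos k), serCoeff,
    div_eq_inv_mul]
  gcongr
  exact le_mul_of_one_le_right h2.le h1

theorem contDiff_ser : ContDiff ℝ ∞ ser := by
  have hr : (FormalMultilinearSeries.ofScalars ℝ serCoeff).radius = ⊤ := by
    refine FormalMultilinearSeries.radius_eq_top_of_summable_norm _ fun r => ?_
    refine (summable_ser r).congr fun k => ?_
    rw [FormalMultilinearSeries.ofScalars_norm, norm_mul, norm_pow, NNReal.norm_eq]
  have h := (FormalMultilinearSeries.ofScalars ℝ serCoeff).hasFPowerSeriesOnBall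
    (by rw [hr]; exact ENNReal.zero_lt_top)
  rw [hr] at h
  have hs : (FormalMultilinearSeries.ofScalars ℝ serCoeff).sum = ser := by
    ext z
    exact FormalMultilinearSeries.ofScalars_sum_eq serCoeff z
  rw [hs] at h
  have ha : AnalyticOnNhd ℝ ser univ := by
    have := h.analyticOnNhd
    simpa using this
  exact ha.contDiff

/-- The Beta integral with integer exponents, by induction on one exponent through integration by
parts. -/
theorem integral_pow_mul_pow (z : ℝ) (i : ℕ) : ∀ j : ℕ,
    ∫ t in (0 : ℝ)..z, t ^ j * (z - t) ^ i
      = (j ! * i ! : ℝ) / ((j + i + 1)! : ℝ) * z ^ (j + i + 1) := by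
  induction i with
  | zero =>
    intro j
    simp [Nat.factorial_succ]
    have h1 : (0 : ℝ) < (j ! : ℝ) := by exact_mod_cast Nat.factorial_pos _
    field_simp
  | succ i ih =>
    intro j
    have hd : ∀ t ∈ uIcc 0 z, HasDerivAt (fun t : ℝ => t ^ (j + 1) * (z - t) ^ (i + 1))
        ((j + 1) * (t ^ j * (z - t) ^ (i + 1)) - (i + 1) * (t ^ (j + 1) * (z - t) ^ i)) t := by
      intro t _
      have h := (hasDerivAt_pow (j + 1) t).mul (((hasDerivAt_id t).const_sub z).pow (i + 1))
      convert! h using 1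
      simp
      ring
    have h := intervalIntegral.integral_eq_sub_of_hasDerivAt hd
      ((by fun_prop : Continuous _).intervalIntegrable _ _)
    rw [intervalIntegral.integral_sub ((by fun_prop : Continuous _).intervalIntegrable _ _)
      ((by fun_prop : Continuous _).intervalIntegrable _ _),
      intervalIntegral.integral_const_mul, intervalIntegral.integral_const_mul, ih (j + 1)] at h
    simp only [sub_self, zero_pow (Nat.succ_ne_zero _), mul_zero, zero_mul, sub_zero] at h
    have e : j + 1 + i + 1 = j + (i + 1) + 1 := by ring
    rw [e] at h
    have hj : ((j : ℝ) + 1) ≠ 0 := by positivity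
    apply mul_left_cancel₀ hj
    rw [sub_eq_zero] at h
    rw [h, Nat.factorial_succ j, Nat.factorial_succ i]
    push_cast
    ring

/-- Multiplied by `(N + 2)!`, the summands are, up to sign, the interior terms of the vanishing
alternating sum of the binomials `N + 2` over `m`; the two end terms give the right side. -/
theorem sum_antidiagonal_inv_factorial (N : ℕ) :
    ∑ p ∈ Finset.HasAntidiagonal.antidiagonal N, (-1 : ℝ) ^ p.1 * (((p.1 + 1)! : ℝ) * ((p.2 + 1)! : ℝ))⁻¹
      = (1 - (-1) ^ (N + 1)) / ((N + 2)! : ℝ) := by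
  rw [Finset.Nat.sum_antidiagonal_eq_sum_range_succ_mk]
  have hF : (0 : ℝ) < ((N + 2)! : ℝ) := by exact_mod_cast Nat.factorial_pos _
  rw [eq_div_iff hF.ne', Finset.sum_mul]
  have h := Int.alternating_sum_range_choose_of_ne (n := N + 2) (by omega)
  have h' : ∑ m ∈ Finset.range (N + 2 + 1), ((-1 : ℝ) ^ m * ((N + 2).choose m : ℝ)) = 0 := by
    exact_mod_cast h
  rw [Finset.sum_range_succ, Finset.sum_range_succ'] at h'
  have e : ∀ k ∈ Finset.range N.succ, (-1 : ℝ) ^ k * (((k + 1)! : ℝ) * ((N - k + 1)! : ℝ))⁻¹ *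
      ((N + 2)! : ℝ) = -((-1) ^ (k + 1) * ((N + 2).choose (k + 1) : ℝ)) := by
    intro k hk
    have hk' : k + 1 ≤ N + 2 := by
      have := Finset.mem_range.1 hk
      omega
    have hk'' : N + 2 - (k + 1) = N - k + 1 := by
      have := Finset.mem_range.1 hk
      omega
    rw [Nat.cast_choose ℝ hk', hk'', pow_succ]
    have h1 : (0 : ℝ) < ((k + 1)! : ℝ) := by exact_mod_cast Nat.factorial_pos _
    have h2 : (0 : ℝ) < ((N - k + 1)! : ℝ) := by exact_mod_cast Nat.factorial_pos _
    field_simp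
  rw [Finset.sum_congr rfl e, Finset.sum_neg_distrib]
  simp only [Nat.choose_self, Nat.choose_zero_right, pow_zero, Nat.cast_one, mul_one] at h'
  have : (-1 : ℝ) ^ (N + 2) = - (-1) ^ (N + 1) := by rw [pow_succ]; ring
  rw [this] at h'
  simp only [Nat.succ_eq_add_one]
  linarith

/-- The Cauchy product is integrated term by term with the Beta integral. The binomial sum then
leaves only the odd powers of `z`, each twice, as in the difference on the right. -/
theorem integral_ser_mul_ser {z : ℝ} (hz : 0 ≤ z) :
    ∫ t in (0 : ℝ)..z, ser (-t) * ser (z - t) = ser z - ser (-z) := by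
  set F : ℕ → ℝ → ℝ := fun N t => ∑ p ∈ Finset.HasAntidiagonal.antidiagonal N,
    (serCoeff p.1 * (-t) ^ p.1) * (serCoeff p.2 * (z - t) ^ p.2) with hF
  have hprod : ∀ t, HasSum (fun N => F N t) (ser (-t) * ser (z - t)) := by
    intro t
    have h1 := summable_norm_sum_mul_antidiagonal_of_summable_norm (summable_ser (-t))
      (summable_ser (z - t))
    have h2 := tsum_mul_tsum_eq_tsum_sum_antidiagonal_of_summable_norm (summable_ser (-t))
      (summable_ser (z - t))
    rw [ser, ser, h2]
    exact h1.of_norm.hasSum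
  have hb := summable_norm_sum_mul_antidiagonal_of_summable_norm (summable_ser z) (summable_ser z)
  have hInt := intervalIntegral.hasSum_integral_of_dominated_convergence (μ := volume) (a := 0)
    (b := z) (F := F)
    (fun N _ => ‖∑ p ∈ Finset.HasAntidiagonal.antidiagonal N, (serCoeff p.1 * z ^ p.1) * (serCoeff p.2 * z ^ p.2)‖)
    (f := fun t => ser (-t) * ser (z - t))
    (fun N => (by simp only [hF]; fun_prop : Continuous (F N)).aestronglyMeasurable) ?_
    (ae_of_all _ fun t _ => hb) (by simp) (ae_of_all _ fun t _ => hprod t)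
  · have hterm : ∀ N, ∫ t in (0 : ℝ)..z, F N t
        = serCoeff (N + 1) * z ^ (N + 1) - serCoeff (N + 1) * (-z) ^ (N + 1) := by
      intro N
      simp only [hF]
      rw [intervalIntegral.integral_finsetSum fun p _ =>
        (by fun_prop : Continuous _).intervalIntegrable _ _]
      have e : ∀ p ∈ Finset.HasAntidiagonal.antidiagonal N, ∫ t in (0 : ℝ)..z,
          (serCoeff p.1 * (-t) ^ p.1) * (serCoeff p.2 * (z - t) ^ p.2)
          = z ^ (N + 1) / ((N + 1)! : ℝ) *
            ((-1 : ℝ) ^ p.1 * (((p.1 + 1)! : ℝ) * ((p.2 + 1)! : ℝ))⁻¹) := by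
        intro p hp
        rw [Finset.HasAntidiagonal.mem_antidiagonal] at hp
        have e1 : ∀ t : ℝ, (serCoeff p.1 * (-t) ^ p.1) * (serCoeff p.2 * (z - t) ^ p.2)
            = ((-1) ^ p.1 * serCoeff p.1 * serCoeff p.2) * (t ^ p.1 * (z - t) ^ p.2) := by
          intro t; rw [neg_pow]; ring
        simp only [e1]
        rw [intervalIntegral.integral_const_mul, integral_pow_mul_pow, hp, serCoeff, serCoeff]
        have h1 : (0 : ℝ) < (p.1 ! : ℝ) := by exact_mod_cast Nat.factorial_pos _
        have h2 : (0 : ℝ) < (p.2 ! : ℝ) := by exact_mod_cast Nat.factorial_pos _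
        field_simp
      rw [Finset.sum_congr rfl e, ← Finset.mul_sum, sum_antidiagonal_inv_factorial, serCoeff,
        neg_pow z]
      have h1 : (0 : ℝ) < ((N + 1)! : ℝ) := by exact_mod_cast Nat.factorial_pos _
      have h2 : (0 : ℝ) < ((N + 1 + 1)! : ℝ) := by exact_mod_cast Nat.factorial_pos _
      field_simp
    simp only [hterm] at hInt
    have h1 := (summable_ser z).of_norm
    have h2 := (summable_ser (-z)).of_norm
    -- The constant terms of the two series cancel, which matches the shift from `N` to `N + 1` on
    -- the integrated side.
    rw [← hInt.tsum_eq, ser, ser, ← h1.tsum_sub h2, (h1.sub h2).tsum_eq_zero_add]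
    simp
  · intro N
    refine ae_of_all _ fun t ht => ?_
    rw [uIoc_of_le hz] at ht
    have hz' : ∀ k : ℕ, 0 ≤ serCoeff k * z ^ k := fun k =>
      mul_nonneg (serCoeff_pos k).le (pow_nonneg hz k)
    rw [Real.norm_of_nonneg (Finset.sum_nonneg fun p _ => mul_nonneg (hz' _) (hz' _))]
    refine (norm_sum_le _ _).trans (Finset.sum_le_sum fun p _ => ?_)
    rw [norm_mul]
    have hle : ∀ (k : ℕ) (s : ℝ), |s| ≤ z → ‖serCoeff k * s ^ k‖ ≤ serCoeff k * z ^ k := by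
      intro k s hs
      rw [norm_mul, norm_pow, Real.norm_of_nonneg (serCoeff_pos k).le, Real.norm_eq_abs]
      have := (serCoeff_pos k).le
      gcongr
    refine mul_le_mul (hle _ _ ?_) (hle _ _ ?_) (norm_nonneg _) (hz' _)
    · rw [abs_neg, abs_of_pos ht.1]; exact ht.2
    · rw [abs_of_nonneg (by linarith [ht.2])]; linarith [ht.1]

/-- The density `a` of the kernel `vker a` of the direct (`σ = 1`) and of the inverse (`σ = -1`)
transformations. -/
noncomputable def besselDensity (c σ s : ℝ) : ℝ := c / 2 * ser (σ * (c * s / 4))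

theorem contDiff_besselDensity (c σ : ℝ) : ContDiff ℝ ∞ (besselDensity c σ) := by
  unfold besselDensity
  exact contDiff_const.mul (contDiff_ser.comp (by fun_prop))

theorem vconv_besselDensity {c s : ℝ} (hc : 0 < c) (hs : 0 ≤ s) :
    vconv (besselDensity c 1) (besselDensity c (-1)) s
      = besselDensity c 1 s - besselDensity c (-1) s := by
  have h := intervalIntegral.integral_comp_mul_left (a := 0) (b := s)
    (fun t => ser (-t) * ser (c / 4 * s - t)) (c := c / 4) (by positivity)
  rw [mul_zero, integral_ser_mul_ser (by positivity)] at h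
  simp only [vconv, besselDensity]
  have e : ∀ t, c / 2 * ser (1 * (c * (s - t) / 4)) * (c / 2 * ser (-1 * (c * t / 4)))
      = c ^ 2 / 4 * (ser (-(c / 4 * t)) * ser (c / 4 * s - c / 4 * t)) := by
    intro t
    rw [show 1 * (c * (s - t) / 4) = c / 4 * s - c / 4 * t by ring,
      show -1 * (c * t / 4) = -(c / 4 * t) by ring]
    ring
  simp only [e]
  rw [intervalIntegral.integral_const_mul, h, smul_eq_mul,
    show 1 * (c * s / 4) = c / 4 * s by ring, show -1 * (c * s / 4) = -(c / 4 * s) by ring]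
  field_simp

theorem besselI_one (z : ℝ) : besselI 1 z = z / 2 * ser ((z / 2) ^ 2) := by
  rw [besselI, ser, ← tsum_mul_left]
  refine tsum_congr fun k => ?_
  rw [serCoeff, pow_add, pow_mul, pow_one, div_eq_mul_inv]
  ring

theorem besselJ_one (z : ℝ) : besselJ 1 z = z / 2 * ser (-(z / 2) ^ 2) := by
  rw [besselJ, ser, ← tsum_mul_left]
  refine tsum_congr fun k => ?_
  rw [serCoeff, pow_add, pow_mul, pow_one, div_eq_mul_inv, neg_pow ((z / 2) ^ 2)]
  ring

section Kernels

variable {lam eps : ℝ}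

/-- The square roots in the prefactor, in the Bessel argument and in the kernel pair off, so the
kernel is smooth in `|x|² - |ξ|²` apart from its Poisson denominator. -/
theorem sqrt_mul_bessel {c s F : ℝ} (hc : 0 ≤ c) (hs : 0 ≤ s) :
    Real.sqrt c * (Real.sqrt (c * s) / 2 * F) * Real.sqrt s = c * s / 2 * F := by
  have h1 : Real.sqrt c * Real.sqrt c = c := Real.mul_self_sqrt hc
  have h2 : Real.sqrt s * Real.sqrt s = s := Real.mul_self_sqrt hs
  rw [Real.sqrt_mul hc]
  calc _ = (Real.sqrt c * Real.sqrt c) * (Real.sqrt s * Real.sqrt s) / 2 * F := by ring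
    _ = _ := by rw [h1, h2]

theorem vker_besselDensity {c σ : ℝ} {x ξ : E n} (h : ‖ξ‖ ≤ ‖x‖) :
    vker (besselDensity c σ) x ξ = c * (‖x‖ ^ 2 - ‖ξ‖ ^ 2) / 2 *
      ser (σ * (c * (‖x‖ ^ 2 - ‖ξ‖ ^ 2) / 4)) / sphereArea n / ‖x - ξ‖ ^ n := by
  rcases h.lt_or_eq with h | h
  · simp only [vker, h, if_true, besselDensity, pois]
    ring
  · simp [vker, h]

theorem kernelK_eq (hc : 0 ≤ lam / eps) {x ξ : E n} (h : ‖ξ‖ ≤ ‖x‖) :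
    kernelK lam eps x ξ = -vker (besselDensity (lam / eps) 1) x ξ := by
  have hs : 0 ≤ ‖x‖ ^ 2 - ‖ξ‖ ^ 2 := sub_nonneg.2 (by gcongr)
  rw [vker_besselDensity h, ← sqrt_mul_bessel hc hs, kernelK, besselI_one, div_pow,
    Real.sq_sqrt (by positivity), show (2 : ℝ) ^ 2 = 4 by norm_num, one_mul]
  ring

theorem kernelL_eq (hc : 0 ≤ lam / eps) {x ξ : E n} (h : ‖ξ‖ ≤ ‖x‖) :
    kernelL lam eps x ξ = -vker (besselDensity (lam / eps) (-1)) x ξ := by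
  have hs : 0 ≤ ‖x‖ ^ 2 - ‖ξ‖ ^ 2 := sub_nonneg.2 (by gcongr)
  rw [vker_besselDensity h, ← sqrt_mul_bessel hc hs, kernelL, besselJ_one, div_pow,
    Real.sq_sqrt (by positivity), show (2 : ℝ) ^ 2 = 4 by norm_num, neg_one_mul]
  ring

theorem kernelP_eq_kernelK (x ξ : E n) : kernelP lam eps x ξ = kernelK lam eps ξ x := by
  rw [kernelP, kernelK, norm_sub_rev]

theorem kernelR_eq_kernelL (x ξ : E n) : kernelR lam eps x ξ = kernelL lam eps ξ x := by
  rw [kernelR, kernelL, norm_sub_rev]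

variable {R : ℝ}

/-- The cutoff in `vker` lets the moving domain of integration be replaced by the fixed ball, so the
transformation becomes an integral operator on one measure space. -/
theorem integral_ball_kernel {k : E n → E n → ℝ} {a : ℝ → ℝ} {x : E n} (hx : ‖x‖ ≤ R)
    (hk : ∀ ξ, ‖ξ‖ ≤ ‖x‖ → k x ξ = -vker a x ξ) (f : E n → ℝ) :
    ∫ ξ in B n ‖x‖, k x ξ * f ξ = -kop (ballMeasure n R) (vker a) f x := by
  have hsub : B n ‖x‖ ⊆ B n R := closedBall_subset_closedBall hx
  rw [kop, setIntegral_eq_of_subset_of_forall_sdiff_eq_zero measurableSet_closedBall hsub,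
    ← integral_neg]
  · refine setIntegral_congr_fun measurableSet_closedBall fun ξ hξ => ?_
    simp only [hk ξ (by simpa using hξ), neg_mul]
  · intro ξ hξ
    have : ¬ ‖ξ‖ < ‖x‖ := fun h => hξ.2 (by simpa using h.le)
    simp [vker, this]

theorem integrableOn_ball_kernel {k : E n → E n → ℝ} {a : ℝ → ℝ} {x : E n} (hx : ‖x‖ ≤ R)
    (hk : ∀ ξ, ‖ξ‖ ≤ ‖x‖ → k x ξ = -vker a x ξ) {f : E n → ℝ}
    (h : Integrable (fun ξ => vker a x ξ * f ξ) (ballMeasure n R)) :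
    IntegrableOn (fun ξ => k x ξ * f ξ) (B n ‖x‖) := by
  have hsub : B n ‖x‖ ⊆ B n R := closedBall_subset_closedBall hx
  have h1 : IntegrableOn (fun ξ => -(vker a x ξ * f ξ)) (B n ‖x‖) :=
    (IntegrableOn.mono_set h hsub).neg
  refine h1.congr_fun (fun ξ hξ => ?_) measurableSet_closedBall
  simp only [hk ξ (by simpa using hξ), neg_mul]

theorem integral_shell_kernel {k : E n → E n → ℝ} {a : ℝ → ℝ} {x : E n}
    (hk : ∀ ξ, ‖x‖ ≤ ‖ξ‖ → k x ξ = -vker a ξ x) (f : E n → ℝ) :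
    ∫ ξ in B n R \ B n ‖x‖, k x ξ * f ξ
      = -kop (ballMeasure n R) (fun x ξ => vker a ξ x) f x := by
  rw [kop, setIntegral_eq_of_subset_of_forall_sdiff_eq_zero measurableSet_closedBall
    (sdiff_subset (s := B n R) (t := B n ‖x‖)), ← integral_neg]
  · refine setIntegral_congr_fun (measurableSet_closedBall.diff measurableSet_closedBall)
      fun ξ hξ => ?_
    have : ‖x‖ < ‖ξ‖ := by simpa using hξ.2
    simp only [hk ξ this.le, neg_mul]
  · intro ξ hξ
    have : ¬ ‖x‖ < ‖ξ‖ := fun h => hξ.2 ⟨hξ.1, by simpa using h⟩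
    simp [vker, this]

theorem integrableOn_shell_kernel {k : E n → E n → ℝ} {a : ℝ → ℝ} {x : E n}
    (hk : ∀ ξ, ‖x‖ ≤ ‖ξ‖ → k x ξ = -vker a ξ x) {f : E n → ℝ}
    (h : Integrable (fun ξ => vker a ξ x * f ξ) (ballMeasure n R)) :
    IntegrableOn (fun ξ => k x ξ * f ξ) (B n R \ B n ‖x‖) := by
  have h1 : IntegrableOn (fun ξ => -(vker a ξ x * f ξ)) (B n R \ B n ‖x‖) :=
    (IntegrableOn.mono_set h sdiff_subset).neg
  refine h1.congr_fun (fun ξ hξ => ?_) (measurableSet_closedBall.diff measurableSet_closedBall)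
  have : ‖x‖ < ‖ξ‖ := by simpa using hξ.2
  simp only [hk ξ this.le, neg_mul]

theorem vker_vconv_besselDensity {c : ℝ} (hc : 0 < c) (x ξ : E n) :
    vker (vconv (besselDensity c 1) (besselDensity c (-1))) x ξ
      = vker (besselDensity c 1) x ξ - vker (besselDensity c (-1)) x ξ := by
  by_cases h : ‖ξ‖ < ‖x‖
  · have hs : 0 ≤ ‖x‖ ^ 2 - ‖ξ‖ ^ 2 := sub_nonneg.2 (by gcongr)
    simp only [vker, h, if_true, vconv_besselDensity hc hs]
    ring
  · simp [vker, h]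

end Kernels

/-! ### Approximation of Sobolev functions by smooth functions -/

instance isFiniteMeasure_ballMeasure (R : ℝ) : IsFiniteMeasure (ballMeasure n R) :=
  ⟨by rw [Measure.restrict_apply_univ]; exact measure_closedBall_lt_top⟩

/-- The kernel of a dilation followed by a mollification. -/
noncomputable def mollKer (s : ℝ) (ρ : ContDiffBump (0 : E n)) (x y : E n) : ℝ :=
  (s ^ n)⁻¹ * ρ.normed volume (x - s⁻¹ • y)

section Mollify

variable {s R : ℝ} {ρ : ContDiffBump (0 : E n)}

theorem mollKer_nonneg (hs : 0 < s) (x y : E n) : 0 ≤ mollKer s ρ x y :=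
  mul_nonneg (by positivity) (ρ.nonneg_normed _)

theorem integrable_mollKer_right (hs : 0 < s) (x : E n) : Integrable (mollKer s ρ x) := by
  have h := ((ρ.integrable_normed (μ := volume)).comp_sub_left x).comp_smul
    (inv_ne_zero hs.ne')
  exact h.const_mul _

theorem integral_mollKer_right (hs : 0 < s) (x : E n) : ∫ y, mollKer s ρ x y = 1 := by
  simp only [mollKer]
  rw [integral_const_mul,
    Measure.integral_comp_inv_smul_of_nonneg volume (fun z => ρ.normed volume (x - z)) hs.le,
    integral_sub_left_eq_self (fun z => ρ.normed volume z), ρ.integral_normed, finrank_E,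
    smul_eq_mul, mul_one, inv_mul_cancel₀ (by positivity)]

theorem measurable_mollKer : Measurable (Function.uncurry (mollKer s ρ)) := by
  have : Continuous (ρ.normed (volume : Measure (E n))) := ρ.continuous_normed
  unfold mollKer Function.uncurry
  exact (Continuous.comp this (by fun_prop)).measurable.const_mul _

/-- Rows integrate to at most `1` and columns to at most `s^(-n)`; the lower bound on `s` makes the
Schur constant uniform along the approximation. -/
theorem isSchur_mollKer (hs : 1 / 2 ≤ s) :
    IsSchur (ballMeasure n R) (mollKer s ρ) (2 ^ n) := by
  have hs0 : 0 < s := by linarith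
  refine ⟨measurable_mollKer, ae_of_all _ fun x => ?_, ae_of_all _ fun y => ?_⟩
  · calc ∫⁻ y, ‖mollKer s ρ x y‖ₑ ∂(ballMeasure n R) ≤ ∫⁻ y, ‖mollKer s ρ x y‖ₑ :=
          setLIntegral_le_lintegral _ _
      _ = ENNReal.ofReal (∫ y, mollKer s ρ x y) := by
          rw [ofReal_integral_eq_lintegral_ofReal (integrable_mollKer_right hs0 x)
            (ae_of_all _ fun y => mollKer_nonneg hs0 x y)]
          exact lintegral_congr fun y => Real.enorm_of_nonneg (mollKer_nonneg hs0 x y)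
      _ ≤ _ := by
          rw [integral_mollKer_right hs0, ENNReal.ofReal_one]
          exact_mod_cast Nat.one_le_two_pow
  · have hi : Integrable (fun x => mollKer s ρ x y) :=
      ((ρ.integrable_normed (μ := volume)).comp_sub_right (s⁻¹ • y)).const_mul _
    calc ∫⁻ x, ‖mollKer s ρ x y‖ₑ ∂(ballMeasure n R) ≤ ∫⁻ x, ‖mollKer s ρ x y‖ₑ :=
          setLIntegral_le_lintegral _ _
      _ = ENNReal.ofReal (∫ x, mollKer s ρ x y) := by
          rw [ofReal_integral_eq_lintegral_ofReal hi
            (ae_of_all _ fun x => mollKer_nonneg hs0 x y)]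
          exact lintegral_congr fun x => Real.enorm_of_nonneg (mollKer_nonneg hs0 x y)
      _ = ENNReal.ofReal ((s ^ n)⁻¹) := by
          simp only [mollKer]
          rw [integral_const_mul, integral_sub_right_eq_self (fun z => ρ.normed volume z),
            ρ.integral_normed, mul_one]
      _ ≤ ENNReal.ofReal (2 ^ n) := by
          refine ENNReal.ofReal_le_ofReal ?_
          rw [← inv_pow]
          gcongr
          rw [inv_le_comm₀ hs0 (by norm_num)]; linarith
      _ = _ := by rw [ENNReal.ofReal_pow (by norm_num)]; simp

theorem mollKer_eq_zero {x y : E n} (h : ρ.rOut ≤ ‖x - s⁻¹ • y‖) : mollKer s ρ x y = 0 := by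
  have : x - s⁻¹ • y ∉ Function.support (ρ.normed (volume : Measure (E n))) := by
    rw [ρ.support_normed_eq, mem_ball_zero_iff, not_lt]; exact h
  rw [mollKer, Function.notMem_support.1 this, mul_zero]

/-- The margin `s (R + rOut) ≤ R` ensures that the dilated mollifier at a point of the closed ball
sees only values from inside the ball, so no mass is lost at the boundary. -/
theorem norm_lt_of_dist_lt {x y : E n} (hs : 0 < s) (hx : ‖x‖ ≤ R)
    (hρ : s * (R + ρ.rOut) ≤ R) (h : ‖x - s⁻¹ • y‖ < ρ.rOut) : ‖y‖ < R := by
  have h1 : ‖s⁻¹ • y‖ < R + ρ.rOut := by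
    have : s⁻¹ • y = x - (x - s⁻¹ • y) := by abel
    rw [this]
    linarith [norm_sub_le x (x - s⁻¹ • y)]
  rw [norm_smul, norm_inv, Real.norm_of_nonneg hs.le, inv_mul_lt_iff₀ hs] at h1
  linarith

theorem abs_kop_mollKer_sub_le (hs : 0 < s) (hs1 : s ≤ 1) (hρ : s * (R + ρ.rOut) ≤ R)
    {g : E n → ℝ} (hg : Continuous g) {ε : ℝ}
    (hgε : ∀ x y : E n, ‖x - y‖ ≤ (R + ρ.rOut) * (1 - s) + ρ.rOut → |g x - g y| ≤ ε)
    {x : E n} (hx : ‖x‖ ≤ R) :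
    ‖kop (ballMeasure n R) (mollKer s ρ) g x - g x‖ ≤ ε := by
  have hi := integrable_mollKer_right (ρ := ρ) hs x
  have hz : ∀ y, y ∉ B n R → mollKer s ρ x y = 0 := by
    intro y hy
    refine mollKer_eq_zero (not_lt.1 fun h => hy ?_)
    simpa using (norm_lt_of_dist_lt hs hx hρ h).le
  have h1 : ∫ y, mollKer s ρ x y ∂(ballMeasure n R) = 1 := by
    rw [setIntegral_eq_integral_of_forall_compl_eq_zero hz, integral_mollKer_right hs]
  have e : kop (ballMeasure n R) (mollKer s ρ) g x - g x
      = ∫ y, mollKer s ρ x y * (g y - g x) ∂(ballMeasure n R) := by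
    have hig : Integrable (fun y => mollKer s ρ x y * g y) (ballMeasure n R) := by
      obtain ⟨M, hM⟩ := (isCompact_closedBall (0 : E n) R).exists_bound_of_continuousOn
        hg.continuousOn
      refine Integrable.mul_bdd (c := M) hi.integrableOn hg.aestronglyMeasurable ?_
      filter_upwards [ae_restrict_mem measurableSet_closedBall] with y hy using hM y hy
    simp only [mul_sub]
    rw [integral_sub hig (hi.integrableOn.mul_const _), integral_mul_const, h1, one_mul, kop]
  rw [e]
  calc _ ≤ ∫ y, mollKer s ρ x y * ε ∂(ballMeasure n R) := by
        refine norm_integral_le_of_norm_le (hi.integrableOn.mul_const _) (ae_of_all _ fun y => ?_)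
        rw [norm_mul, Real.norm_of_nonneg (mollKer_nonneg hs x y)]
        by_cases h : ρ.rOut ≤ ‖x - s⁻¹ • y‖
        · simp [mollKer_eq_zero h]
        · refine mul_le_mul_of_nonneg_left ?_ (mollKer_nonneg hs x y)
          apply hgε
          rw [not_le] at h
          have h2 : ‖s⁻¹ • y‖ ≤ R + ρ.rOut := by
            have : s⁻¹ • y = x - (x - s⁻¹ • y) := by abel
            rw [this]
            linarith [norm_sub_le x (x - s⁻¹ • y)]
          have h3 : y - x = -((1 - s) • (s⁻¹ • y)) - (x - s⁻¹ • y) := by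
            rw [sub_smul, smul_inv_smul₀ hs.ne', one_smul]; abel
          rw [h3]
          refine (norm_sub_le _ _).trans ?_
          rw [norm_neg, norm_smul, Real.norm_of_nonneg (by linarith : 0 ≤ 1 - s), mul_comm]
          have h4 : 0 ≤ 1 - s := by linarith
          gcongr
    _ = ε := by rw [integral_mul_const, h1, one_mul]

/-- The dilation followed by mollification, as a globally smooth function. -/
noncomputable def mollify (R s : ℝ) (ρ : ContDiffBump (0 : E n)) (f : E n → ℝ) : E n → ℝ :=
  convolution (fun t => (B n R).indicator f (s • t)) (ρ.normed volume)
    (ContinuousLinearMap.mul ℝ ℝ) volume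

theorem integral_dilate_eq_kop (hs : 0 < s) (f r : E n → ℝ) (x : E n) :
    ∫ t, (B n R).indicator f (s • t) * r (x - t)
      = ∫ y, (s ^ n)⁻¹ * r (x - s⁻¹ • y) * f y ∂(ballMeasure n R) := by
  have h := Measure.integral_comp_smul_of_nonneg (volume : Measure (E n))
    (fun y => (B n R).indicator f y * r (x - s⁻¹ • y)) s (hR := hs.le)
  simp only [inv_smul_smul₀ hs.ne'] at h
  rw [h, finrank_E, smul_eq_mul, ← integral_const_mul, ← integral_indicator measurableSet_closedBall]
  congr 1; ext y
  by_cases hy : y ∈ B n R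
  · rw [indicator_of_mem hy, indicator_of_mem hy]; ring
  · rw [indicator_of_notMem hy, indicator_of_notMem hy]; ring

theorem mollify_eq_kop (hs : 0 < s) (f : E n → ℝ) :
    mollify R s ρ f = kop (ballMeasure n R) (mollKer s ρ) f := by
  ext x
  exact integral_dilate_eq_kop hs f (ρ.normed volume) x

theorem locallyIntegrable_dilate (hs : 0 < s) {f : E n → ℝ} (hf : MemLp f 2 (ballMeasure n R)) :
    LocallyIntegrable fun t => (B n R).indicator f (s • t) := by
  have h1 : Integrable f (ballMeasure n R) := hf.integrable (by norm_num)
  have h2 : Integrable ((B n R).indicator f) := (integrable_indicator_iff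
    measurableSet_closedBall).2 h1
  exact (h2.comp_smul hs.ne').locallyIntegrable

theorem contDiff_mollify (hs : 0 < s) {f : E n → ℝ} (hf : MemLp f 2 (ballMeasure n R)) :
    ContDiff ℝ 1 (mollify R s ρ f) :=
  ρ.hasCompactSupport_normed.contDiff_convolution_right _ (locallyIntegrable_dilate hs hf)
    ρ.contDiff_normed

/-- The derivative falls on the bump function, which as a function of `y` is an admissible test
function because its support stays strictly inside the ball. The definition of the weak gradient
then moves it to `f`; the factor `s` comes from the dilation. -/
theorem fderiv_mollify (hs : 0 < s) (hρ : s * (R + ρ.rOut) < R) {f : E n → ℝ}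
    (hf : MemLp f 2 (ballMeasure n R)) {F : E n → E n} (hF : IsL2WeakGradient R f F) (i : Fin n)
    {x : E n} (hx : ‖x‖ ≤ R) :
    fderiv ℝ (mollify R s ρ f) x (ev i)
      = s * kop (ballMeasure n R) (mollKer s ρ) (fun y => F y i) x := by
  have hρ1 : ContDiff ℝ 1 (ρ.normed (volume : Measure (E n))) := ρ.contDiff_normed
  have hd := ρ.hasCompactSupport_normed.hasFDerivAt_convolution_right (μ := volume)
    (ContinuousLinearMap.mul ℝ ℝ) (locallyIntegrable_dilate (R := R) hs hf) hρ1 x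
  rw [mollify, hd.fderiv, convolution_precompR_apply _ (locallyIntegrable_dilate hs hf)
    (ρ.hasCompactSupport_normed.fderiv ℝ) (hρ1.continuous_fderiv one_ne_zero)]
  have e := integral_dilate_eq_kop (R := R) hs f
    (fun a => fderiv ℝ (ρ.normed (volume : Measure (E n))) a (ev i)) x
  rw [convolution]
  simp only [ContinuousLinearMap.mul_apply']
  rw [e]
  set η : E n → ℝ := fun y => ρ.normed volume (x - s⁻¹ • y) with hη
  have hη1 : ContDiff ℝ ∞ η := by
    have : ContDiff ℝ ∞ (ρ.normed (volume : Measure (E n))) := ρ.contDiff_normed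
    exact this.comp (by fun_prop)
  have hsub : Function.support η ⊆ closedBall (0 : E n) (s * (R + ρ.rOut)) := by
    intro y hy
    have h1 : ‖x - s⁻¹ • y‖ < ρ.rOut := by
      have : x - s⁻¹ • y ∈ Function.support (ρ.normed (volume : Measure (E n))) := hy
      rwa [ρ.support_normed_eq, mem_ball_zero_iff] at this
    have h2 : ‖s⁻¹ • y‖ ≤ R + ρ.rOut := by
      have : s⁻¹ • y = x - (x - s⁻¹ • y) := by abel
      rw [this]
      linarith [norm_sub_le x (x - s⁻¹ • y)]
    rw [norm_smul, norm_inv, Real.norm_of_nonneg hs.le, inv_mul_le_iff₀ hs] at h2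
    simpa using h2
  have hts : tsupport η ⊆ closedBall (0 : E n) (s * (R + ρ.rOut)) :=
    closure_minimal hsub isClosed_closedBall
  have hcs : HasCompactSupport η :=
    (isCompact_closedBall (0 : E n) _).of_isClosed_subset (isClosed_tsupport _) hts
  have hw := hF.2 η hη1 hcs (hts.trans (closedBall_subset_ball hρ)) i
  have hdη : ∀ y, fderiv ℝ η y (ev i)
      = -(s⁻¹ * fderiv ℝ (ρ.normed (volume : Measure (E n))) (x - s⁻¹ • y) (ev i)) := by
    intro y
    have h1 : HasFDerivAt (fun y : E n => x - s⁻¹ • y)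
        (-(s⁻¹ • ContinuousLinearMap.id ℝ (E n))) y :=
      ((hasFDerivAt_id y).const_smul s⁻¹).const_sub x
    have h2 := (hρ1.differentiable one_ne_zero (x - s⁻¹ • y)).hasFDerivAt.comp y h1
    have h3 : HasFDerivAt η _ y := h2
    rw [h3.fderiv]
    simp
  have e1 : ∀ y, (s ^ n)⁻¹ * fderiv ℝ (ρ.normed (volume : Measure (E n))) (x - s⁻¹ • y) (ev i) * f y
      = -(s * (s ^ n)⁻¹) * (f y * fderiv ℝ η y (ev i)) := by
    intro y; rw [hdη]; field_simp
  simp only [e1]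
  rw [integral_const_mul, hw, kop, ← integral_const_mul, mul_neg, neg_mul, neg_neg,
    ← integral_const_mul]
  congr 1; ext y
  simp only [mollKer, hη]
  ring

end Mollify

/-- The operators are uniformly bounded on `L²` and converge uniformly on continuous compactly
supported functions, which are dense. -/
theorem tendsto_kop_mollKer {R : ℝ} {s : ℕ → ℝ} {ρ : ℕ → ContDiffBump (0 : E n)}
    (hs : ∀ m, 1 / 2 ≤ s m) (hs1 : ∀ m, s m ≤ 1) (hρ : ∀ m, s m * (R + (ρ m).rOut) ≤ R)
    (hs2 : Tendsto s atTop (𝓝 1)) (hρ0 : Tendsto (fun m => (ρ m).rOut) atTop (𝓝 0))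
    {f : E n → ℝ} (hf : MemLp f 2 (ballMeasure n R)) :
    Tendsto (fun m => eLpNorm (fun x => kop (ballMeasure n R) (mollKer (s m) (ρ m)) f x - f x) 2
      (ballMeasure n R)) atTop (𝓝 0) := by
  set μ := ballMeasure n R with hμ
  rw [ENNReal.tendsto_nhds_zero]
  intro ε hε
  rcases eq_or_ne ε ⊤ with rfl | hεtop
  · simp
  -- Replacing `f` by `g` costs `2^n δ` inside the operator and `δ` outside it; the other half of
  -- `ε` is for `g`.
  obtain ⟨δ, hδ, hδε⟩ : ∃ δ : ℝ≥0∞, δ ≠ 0 ∧ (2 ^ n + 1) * δ ≤ ε / 2 := by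
    refine ⟨ε / 2 / (2 ^ n + 1), ?_, ENNReal.mul_div_le⟩
    refine (ENNReal.div_pos (ENNReal.half_pos hε.ne').ne' ?_).ne'
    finiteness
  obtain ⟨g, hgc, hgδ, hg, hgL⟩ := hf.exists_hasCompactSupport_eLpNorm_sub_le
    (ENNReal.ofNat_ne_top) hδ
  obtain ⟨τ, hτ, hτε⟩ : ∃ τ : ℝ, 0 < τ ∧ μ univ ^ (2 : ℝ≥0∞).toReal⁻¹ * ENNReal.ofReal τ ≤ ε / 2 := by
    have hc : μ univ ^ (2 : ℝ≥0∞).toReal⁻¹ ≠ ⊤ := by finiteness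
    have h1 : Tendsto (fun τ : ℝ => μ univ ^ (2 : ℝ≥0∞).toReal⁻¹ * ENNReal.ofReal τ) (𝓝[>] 0)
        (𝓝 (μ univ ^ (2 : ℝ≥0∞).toReal⁻¹ * ENNReal.ofReal 0)) :=
      ENNReal.Tendsto.const_mul ((ENNReal.continuous_ofReal.tendsto 0).mono_left
        nhdsWithin_le_nhds) (Or.inr hc)
    rw [ENNReal.ofReal_zero, mul_zero] at h1
    have h2 := (h1.eventually (ge_mem_nhds (ENNReal.half_pos hε.ne'))).and self_mem_nhdsWithin
    obtain ⟨τ, h3, h4⟩ := h2.exists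
    exact ⟨τ, h4, h3⟩
  obtain ⟨d, hd, hgd⟩ := Metric.uniformContinuous_iff.1 (hg.uniformContinuous_of_tendsto_cocompact
    hgc.is_zero_at_infty) τ hτ
  have hlim : Tendsto (fun m => (R + (ρ m).rOut) * (1 - s m) + (ρ m).rOut) atTop (𝓝 0) := by
    have := ((hρ0.const_add R).mul (hs2.const_sub 1)).add hρ0
    simpa using this
  filter_upwards [hlim.eventually (gt_mem_nhds hd)] with m hm
  have hS : IsSchur μ (mollKer (s m) (ρ m)) (2 ^ n) := isSchur_mollKer (hs m)
  have hs0 : 0 < s m := by linarith [hs m]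
  set k := mollKer (s m) (ρ m)
  have hfg : MemLp (fun x => f x - g x) 2 μ := hf.sub hgL
  have e : (fun x => kop μ k f x - f x) =ᵐ[μ]
      (fun x => kop μ k (fun x => f x - g x) x) + ((fun x => kop μ k g x - g x) -
        fun x => f x - g x) := by
    filter_upwards [hS.kop_sub hf hgL] with x hx
    simp only [Pi.add_apply, Pi.sub_apply, hx]; ring
  rw [eLpNorm_congr_ae e]
  have hkg : MemLp (fun x => kop μ k g x - g x) 2 μ := (hS.memLp_kop hgL).sub hgL
  have h1 : eLpNorm (fun x => kop μ k (fun x => f x - g x) x) 2 μ ≤ 2 ^ n * δ := by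
    refine (hS.eLpNorm_kop_le hfg).trans ?_
    push_cast
    gcongr
    exact hgδ
  have h2 : eLpNorm (fun x => kop μ k g x - g x) 2 μ ≤ ε / 2 := by
    refine (eLpNorm_le_of_ae_bound (C := τ) ?_).trans hτε
    filter_upwards [ae_mem_ball R] with x hx
    refine abs_kop_mollKer_sub_le hs0 (hs1 m) (hρ m) hg (fun x y hxy => ?_) hx
    have := hgd (a := x) (b := y) (by rw [dist_eq_norm]; exact hxy.trans_lt hm)
    rw [Real.dist_eq] at this
    exact this.le
  calc _ ≤ eLpNorm (fun x => kop μ k (fun x => f x - g x) x) 2 μ +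
        (eLpNorm (fun x => kop μ k g x - g x) 2 μ + eLpNorm (fun x => f x - g x) 2 μ) := by
        refine (eLpNorm_add_le (hS.memLp_kop hfg).1 (hkg.sub hfg).1 (by norm_num)).trans ?_
        gcongr
        exact eLpNorm_sub_le hkg.1 hfg.1 (by norm_num)
    _ ≤ 2 ^ n * δ + (ε / 2 + δ) := by gcongr; exact hgδ
    _ = (2 ^ n + 1) * δ + ε / 2 := by ring
    _ ≤ ε / 2 + ε / 2 := by gcongr
    _ = ε := ENNReal.add_halves ε

/-- The ball is star-shaped: contracting the argument toward the centre before mollifying gives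
functions that are smooth up to the boundary. -/
theorem exists_contDiff_approx {R : ℝ} (hR : 0 < R) {f : E n → ℝ}
    (hf : MemLp f 2 (ballMeasure n R)) {F : E n → E n} (hF : IsL2WeakGradient R f F) :
    ∃ u : ℕ → E n → ℝ, (∀ m, ContDiff ℝ 1 (u m)) ∧
      Tendsto (fun m => eLpNorm (fun x => u m x - f x) 2 (ballMeasure n R)) atTop (𝓝 0) ∧
      ∀ i, Tendsto (fun m => eLpNorm (fun x => fderiv ℝ (u m) x (ev i) - F x i) 2
        (ballMeasure n R)) atTop (𝓝 0) := by
  -- The shift by `2` keeps `q ≤ 1/2`, hence `s = 1 - q ≥ 1/2`. With outer radius `R q / 2` the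
  -- margin condition reads `(1 - q)(1 + q / 2) < 1`.
  set q : ℕ → ℝ := fun m => 1 / ((m : ℝ) + 2) with hq
  have hq0 : ∀ m, 0 < q m := fun m => by simp only [hq]; positivity
  have hq1 : ∀ m, q m ≤ 1 / 2 := fun m => by
    simp only [hq]
    gcongr
    linarith [(Nat.cast_nonneg m : (0 : ℝ) ≤ m)]
  have hqlim : Tendsto q atTop (𝓝 0) := by
    have := (tendsto_const_div_atTop_nhds_zero_nat (1 : ℝ)).comp (tendsto_add_atTop_nat 2)
    refine this.congr fun m => ?_
    simp [hq]
  set s : ℕ → ℝ := fun m => 1 - q m with hs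
  set ρ : ℕ → ContDiffBump (0 : E n) := fun m =>
    ⟨R * q m / 4, R * q m / 2, by have := hq0 m; positivity, by
      have := mul_pos hR (hq0 m); linarith⟩ with hρ
  have hsρ : ∀ m, s m * (R + (ρ m).rOut) < R := by
    intro m
    simp only [hs, hρ]
    have := mul_pos hR (hq0 m)
    nlinarith [mul_pos this (hq0 m)]
  have hs0 : ∀ m, 1 / 2 ≤ s m := fun m => by simp only [hs]; linarith [hq1 m]
  have hs0' : ∀ m, 0 < s m := fun m => by linarith [hs0 m]
  have hs1 : ∀ m, s m ≤ 1 := fun m => by simp only [hs]; linarith [hq0 m]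
  have hslim : Tendsto s atTop (𝓝 1) := by simpa using hqlim.const_sub 1
  have hρlim : Tendsto (fun m => (ρ m).rOut) atTop (𝓝 0) := by
    simpa [hρ] using (hqlim.const_mul R).div_const 2
  refine ⟨fun m => mollify R (s m) (ρ m) f, fun m => contDiff_mollify (hs0' m) hf, ?_, fun i => ?_⟩
  · have := tendsto_kop_mollKer hs0 hs1 (fun m => (hsρ m).le) hslim hρlim hf
    simpa only [mollify_eq_kop (hs0' _)] using this
  · set μ := ballMeasure n R with hμ
    have hFi : MemLp (fun x => F x i) 2 μ := hF.1.continuousLinearMap_comp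
      (EuclideanSpace.proj i : E n →L[ℝ] ℝ)
    have h1 := tendsto_kop_mollKer hs0 hs1 (fun m => (hsρ m).le) hslim hρlim hFi
    have h2 : Tendsto (fun m => eLpNorm (fun x => kop μ (mollKer (s m) (ρ m)) (fun y => F y i) x
        - F x i) 2 μ + ENNReal.ofReal (q m) * eLpNorm (fun x => F x i) 2 μ) atTop (𝓝 0) := by
      have h3 : Tendsto (fun m => ENNReal.ofReal (q m)) atTop (𝓝 0) := by
        simpa [Function.comp_def] using (ENNReal.continuous_ofReal.tendsto 0).comp hqlim
      have h4 := ENNReal.Tendsto.mul_const (b := eLpNorm (fun x => F x i) 2 μ) h3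
        (Or.inr hFi.2.ne)
      simpa using h1.add h4
    refine tendsto_of_tendsto_of_tendsto_of_le_of_le tendsto_const_nhds h2 (fun _ => bot_le)
      fun m => ?_
    have hS := isSchur_mollKer (n := n) (R := R) (ρ := ρ m) (hs0 m)
    have hk : MemLp (fun x => kop μ (mollKer (s m) (ρ m)) (fun y => F y i) x - F x i) 2 μ :=
      (hS.memLp_kop hFi).sub hFi
    have e : (fun x => fderiv ℝ (mollify R (s m) (ρ m) f) x (ev i) - F x i) =ᵐ[μ]
        (s m • fun x => kop μ (mollKer (s m) (ρ m)) (fun y => F y i) x - F x i) -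
          (q m • fun x => F x i) := by
      filter_upwards [ae_mem_ball R] with x hx
      rw [fderiv_mollify (hs0' m) (hsρ m) hf hF i hx]
      simp only [Pi.sub_apply, Pi.smul_apply, smul_eq_mul, hs]
      ring
    rw [eLpNorm_congr_ae e]
    refine (eLpNorm_sub_le (hk.const_smul _).1 (hFi.const_smul _).1 (by norm_num)).trans ?_
    rw [eLpNorm_const_smul, eLpNorm_const_smul, Real.enorm_of_nonneg (hs0' m).le,
      Real.enorm_of_nonneg (hq0 m).le]
    gcongr
    refine mul_le_of_le_one_left bot_le ?_
    rw [ENNReal.ofReal_le_one]; exact hs1 m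

/-! ### Rotational and radial integration by parts -/

/-- The form `∬ k(x, ξ) f(ξ) g(x)`. -/
noncomputable def pairing (R : ℝ) (k : E n → E n → ℝ) (f g : E n → ℝ) : ℝ :=
  ∫ q : E n × E n, k q.1 q.2 * f q.2 * g q.1 ∂((ballMeasure n R).prod (ballMeasure n R))

theorem ae_mem_ball_prod (R : ℝ) :
    ∀ᵐ q ∂((ballMeasure n R).prod (ballMeasure n R)), ‖q.1‖ ≤ R ∧ ‖q.2‖ ≤ R := by
  filter_upwards [Measure.quasiMeasurePreserving_fst.ae (ae_mem_ball (n := n) R),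
    Measure.quasiMeasurePreserving_snd.ae (ae_mem_ball (n := n) R)] with q h1 h2 using ⟨h1, h2⟩

theorem integrable_wsing_prod (hn : 1 ≤ n) (R D : ℝ) :
    Integrable (fun q : E n × E n => D * wsing (q.1 - q.2))
      ((ballMeasure n R).prod (ballMeasure n R)) := by
  have h := (isSchur_wsing hn R).integrable_prod (memLp_const (1 : ℝ)) (memLp_const (1 : ℝ))
  simpa using h.const_mul D

theorem abs_triple_le {k u v w x C M A : ℝ} (hk : |k| * x ≤ C * w) (hu : |u| ≤ A)
    (hv : |v| ≤ M * x) (hA : 0 ≤ A) (hM : 0 ≤ M) :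
    |k * u * v| ≤ A * M * C * w := by
  rw [abs_mul, abs_mul]
  calc |k| * |u| * |v| ≤ |k| * A * (M * x) := by gcongr
    _ = A * M * (|k| * x) := by ring
    _ ≤ A * M * (C * w) := by gcongr
    _ = _ := by ring

theorem integrable_pairing (hn : 1 ≤ n) {R C A M : ℝ} {k : E n → E n → ℝ} {f g : E n → ℝ}
    (hk : Measurable (Function.uncurry k))
    (hb : ∀ x ξ, ‖x‖ ≤ R → ‖ξ‖ ≤ R → |k x ξ| * ‖x‖ ≤ C * wsing (x - ξ))
    (hf : Measurable f) (hA : 0 ≤ A) (hfA : ∀ ξ, ‖ξ‖ ≤ R → |f ξ| ≤ A)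
    (hg : Measurable g) (hM : 0 ≤ M) (hgM : ∀ x, ‖x‖ ≤ R → |g x| ≤ M * ‖x‖) :
    Integrable (fun q : E n × E n => k q.1 q.2 * f q.2 * g q.1)
      ((ballMeasure n R).prod (ballMeasure n R)) := by
  refine (integrable_wsing_prod hn R (A * M * C)).mono' ?_ ?_
  · exact ((hk.mul (hf.comp measurable_snd)).mul (hg.comp measurable_fst)).aestronglyMeasurable
  · filter_upwards [ae_mem_ball_prod (n := n) R] with q hq
    exact abs_triple_le (hb _ _ hq.1 hq.2) (hfA _ hq.2) (hgM _ hq.1)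
      hA hM

theorem measurePreserving_isometry_ball (R : ℝ) (Q : E n ≃ₗᵢ[ℝ] E n) :
    MeasurePreserving Q (ballMeasure n R) (ballMeasure n R) := by
  have h := Q.measurePreserving.restrict_preimage (s := B n R) measurableSet_closedBall
  have h2 : Q ⁻¹' (B n R) = B n R := by
    ext x
    simp
  rwa [h2] at h

theorem integral_prod_isometry (R : ℝ) (Q : E n ≃ₗᵢ[ℝ] E n) (G : E n × E n → ℝ) :
    ∫ q, G (Q q.1, Q q.2) ∂((ballMeasure n R).prod (ballMeasure n R))
      = ∫ q, G q ∂((ballMeasure n R).prod (ballMeasure n R)) := by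
  have h := (measurePreserving_isometry_ball R Q).prod (measurePreserving_isometry_ball R Q)
  refine h.integral_comp ?_ G
  exact (Q.toHomeomorph.prodCongr Q.toHomeomorph).measurableEmbedding

/-- Integration by parts along a one-parameter group of rotations. -/
theorem pairing_rotation (hn : 1 ≤ n) {R C M : ℝ} {p : E n → E n → ℝ} {f ζ : E n → ℝ}
    (hp : Measurable (Function.uncurry p))
    (hb : ∀ x ξ, ‖x‖ ≤ R → ‖ξ‖ ≤ R → |p x ξ| * ‖x‖ ≤ C * wsing (x - ξ))
    (hiso : ∀ (Q : E n ≃ₗᵢ[ℝ] E n) (x ξ : E n), p (Q x) (Q ξ) = p x ξ)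
    (hf : ContDiff ℝ 1 f) (hζ : ContDiff ℝ 1 ζ) (hM : 0 ≤ M)
    (hζM : ∀ x, ‖x‖ ≤ R → |ζ x| ≤ M * ‖x‖) (hζM' : ∀ x, ‖x‖ ≤ R → ‖fderiv ℝ ζ x‖ ≤ M)
    {A : E n →L[ℝ] E n} {Q : ℝ → E n ≃ₗᵢ[ℝ] E n} (hQ0 : ∀ x, Q 0 x = x)
    (hQ : ∀ x t, HasDerivAt (fun t => Q t x) (A (Q t x)) t) :
    pairing R p f (fun x => fderiv ℝ ζ x (A x))
      = - pairing R p (fun ξ => fderiv ℝ f ξ (A ξ)) ζ := by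
  have hfd : Continuous (fderiv ℝ f) := hf.continuous_fderiv one_ne_zero
  have hζd : Continuous (fderiv ℝ ζ) := hζ.continuous_fderiv one_ne_zero
  have hfA : Continuous fun ξ => fderiv ℝ f ξ (A ξ) := hfd.clm_apply A.continuous
  have hζA : Continuous fun ξ => fderiv ℝ ζ ξ (A ξ) := hζd.clm_apply A.continuous
  have hζA_le : ∀ x, ‖x‖ ≤ R → |fderiv ℝ ζ x (A x)| ≤ M * ‖A‖ * ‖x‖ := fun x hx =>
    calc |fderiv ℝ ζ x (A x)| ≤ ‖fderiv ℝ ζ x‖ * ‖A x‖ := (fderiv ℝ ζ x).le_opNorm _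
      _ ≤ M * (‖A‖ * ‖x‖) := by
        gcongr
        · exact hζM' x hx
        · exact A.le_opNorm x
      _ = _ := by ring
  obtain ⟨F0, hF0⟩ := (isCompact_closedBall (0 : E n) R).exists_bound_of_continuousOn
    hf.continuous.continuousOn
  obtain ⟨F1, hF1⟩ := (isCompact_closedBall (0 : E n) R).exists_bound_of_continuousOn
    hfA.continuousOn
  have hF0' : ∀ ξ : E n, ‖ξ‖ ≤ R → |f ξ| ≤ |F0| := fun ξ h =>
    (hF0 ξ (by simpa using h)).trans (le_abs_self _)
  have hF1' : ∀ ξ : E n, ‖ξ‖ ≤ R → |fderiv ℝ f ξ (A ξ)| ≤ |F1| := fun ξ h =>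
    (hF1 ξ (by simpa using h)).trans (le_abs_self _)
  set ν := (ballMeasure n R).prod (ballMeasure n R) with hν
  set G : ℝ → E n × E n → ℝ := fun t q => p q.1 q.2 * f (Q t q.2) * ζ (Q t q.1) with hG
  set G' : ℝ → E n × E n → ℝ := fun t q =>
    p q.1 q.2 * fderiv ℝ f (Q t q.2) (A (Q t q.2)) * ζ (Q t q.1)
      + p q.1 q.2 * f (Q t q.2) * fderiv ℝ ζ (Q t q.1) (A (Q t q.1)) with hG'
  have i1 := integrable_pairing hn hp hb hf.continuous.measurable (abs_nonneg F0) hF0'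
    hζA.measurable (by positivity : 0 ≤ M * ‖A‖) hζA_le
  have i2 := integrable_pairing hn hp hb hfA.measurable (abs_nonneg F1) hF1'
    hζ.continuous.measurable hM hζM
  have i0 := integrable_pairing hn hp hb hf.continuous.measurable (abs_nonneg F0) hF0'
    hζ.continuous.measurable hM hζM
  have key := hasDerivAt_integral_of_dominated_loc_of_deriv_le (μ := ν) (F := G) (F' := G')
    (x₀ := (0 : ℝ)) (s := univ)
    (bound := fun q => |F1| * M * C * wsing (q.1 - q.2)
      + |F0| * (M * ‖A‖) * C * wsing (q.1 - q.2)) univ_mem ?_ ?_ ?_ ?_ ?_ ?_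
  -- Rotating both variables preserves the measure and the kernel, so the integral does not depend
  -- on `t`. Its derivative at `0` vanishes, and the product rule yields the identity.
  · have hconst : (fun t => ∫ q, G t q ∂ν) = fun _ => ∫ q, p q.1 q.2 * f q.2 * ζ q.1 ∂ν := by
      funext t
      rw [hν, ← integral_prod_isometry R (Q t) fun q => p q.1 q.2 * f q.2 * ζ q.1]
      simp only [hG, hiso]
    have h0 := key.2.unique (by rw [hconst]; exact hasDerivAt_const _ _)
    simp only [hG', hQ0] at h0
    rw [integral_add i2 i1] at h0
    rw [pairing, pairing]
    linarith
  · refine Eventually.of_forall fun t => Measurable.aestronglyMeasurable ?_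
    exact (hp.mul (hf.continuous.measurable.comp ((Q t).continuous.measurable.comp
      measurable_snd))).mul (hζ.continuous.measurable.comp
        ((Q t).continuous.measurable.comp measurable_fst))
  · simpa only [hG, hQ0] using i0
  · simp only [hG', hQ0]
    exact (i2.add i1).aestronglyMeasurable
  · filter_upwards [ae_mem_ball_prod (n := n) R] with q hq t _
    have h1 : ‖Q t q.1‖ ≤ R := by simpa using hq.1
    have h2 : ‖Q t q.2‖ ≤ R := by simpa using hq.2
    have e1 := hζM _ h1
    have e2 := hζA_le _ h1
    rw [LinearIsometryEquiv.norm_map] at e1 e2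
    refine (norm_add_le _ _).trans (add_le_add ?_ ?_)
    · exact abs_triple_le (hb _ _ hq.1 hq.2) (hF1' _ h2) e1 (abs_nonneg _) hM
    · exact abs_triple_le (hb _ _ hq.1 hq.2) (hF0' _ h2) e2 (abs_nonneg _) (by positivity)
  · exact (integrable_wsing_prod hn R _).add (integrable_wsing_prod hn R _)
  · refine Eventually.of_forall fun q t _ => ?_
    have d1 := ((hf.differentiable one_ne_zero) (Q t q.2)).hasFDerivAt.comp_hasDerivAt t
      (hQ q.2 t)
    have d2 := ((hζ.differentiable one_ne_zero) (Q t q.1)).hasFDerivAt.comp_hasDerivAt t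
      (hQ q.1 t)
    exact (d1.const_mul (p q.1 q.2)).mul d2

/-! ### Rotations of coordinate planes -/

/-- The generator of the rotations of the plane spanned by the `i`-th and the `j`-th axis. -/
noncomputable def rotGen (i j : Fin n) : E n →L[ℝ] E n :=
  (EuclideanSpace.proj i).smulRight (ev j) - (EuclideanSpace.proj j).smulRight (ev i)

theorem rotGen_apply (i j : Fin n) (x : E n) : rotGen i j x = x i • ev j - x j • ev i := by
  simp [rotGen]

theorem inner_ev_left (i : Fin n) (x : E n) : inner ℝ (ev i) x = x i := by
  simp [ev, EuclideanSpace.inner_single_left]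

theorem inner_ev_right (i : Fin n) (x : E n) : inner ℝ x (ev i) = x i := by
  rw [real_inner_comm, inner_ev_left]

theorem rotGen_mem_skewAdjoint (i j : Fin n) :
    rotGen i j ∈ skewAdjoint (E n →L[ℝ] E n) := by
  rw [skewAdjoint.mem_iff, ContinuousLinearMap.star_eq_adjoint, eq_comm,
    ContinuousLinearMap.eq_adjoint_iff]
  intro x y
  simp only [neg_apply, rotGen_apply, inner_neg_left, inner_sub_left,
    inner_sub_right, real_inner_smul_left, real_inner_smul_right, inner_ev_left, inner_ev_right]
  ring

/-- The generator is skew-adjoint, so its exponentials are unitary. -/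
theorem exists_rotation (i j : Fin n) : ∃ Q : ℝ → E n ≃ₗᵢ[ℝ] E n, (∀ x, Q 0 x = x) ∧
    ∀ x t, HasDerivAt (fun t => Q t x) (rotGen i j (Q t x)) t := by
  let _ : NormedAlgebra ℚ (E n →L[ℝ] E n) := NormedAlgebra.restrictScalars ℚ ℝ _
  have hU : ∀ t : ℝ, NormedSpace.exp (t • rotGen i j) ∈ unitary (E n →L[ℝ] E n) := fun t =>
    NormedSpace.exp_mem_unitary_of_mem_skewAdjoint
      (skewAdjoint.smul_mem t (rotGen_mem_skewAdjoint i j))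
  refine ⟨fun t => Unitary.linearIsometryEquiv ⟨_, hU t⟩, fun x => ?_, fun x t => ?_⟩
  · have h : NormedSpace.exp ((0 : ℝ) • rotGen i j) x = x := by
      have h0 : (0 : ℝ) • rotGen i j = 0 := zero_smul ℝ (rotGen i j)
      rw [h0, NormedSpace.exp_zero, one_apply_eq_self]
    exact h
  · have h := hasDerivAt_exp_smul_const' (𝕂 := ℝ) (rotGen i j) t
    have h2 := (ContinuousLinearMap.apply ℝ (E n) x).hasFDerivAt.comp_hasDerivAt t h
    exact h2

/-! ### Weakly singular kernels paired with test functions -/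

/-- The adjoint operator `ξ ↦ ∫ k(x, ξ) g(x) dx`. -/
noncomputable def slice (k : E n → E n → ℝ) (g : E n → ℝ) (ξ : E n) : ℝ := ∫ x, k x ξ * g x

/-- `k(x, ξ)` is at most `C |x|⁻¹ |x - ξ|^(1-n)` for `x`, `ξ` in the ball of radius `r`. -/
structure IsWeakKernel (r C : ℝ) (k : E n → E n → ℝ) : Prop where
  meas : Measurable (Function.uncurry k)
  nonneg : 0 ≤ C
  bound : ∀ x ξ, ‖x‖ ≤ r → ‖ξ‖ ≤ r → |k x ξ| * ‖x‖ ≤ C * wsing (x - ξ)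

/-- `g` is supported in the ball of radius `R` and vanishes to first order at the origin. -/
structure IsTest (R M : ℝ) (g : E n → ℝ) : Prop where
  meas : Measurable g
  nonneg : 0 ≤ M
  bound : ∀ x, |g x| ≤ M * ‖x‖
  supp : ∀ x, R < ‖x‖ → g x = 0

section

variable {R r C M : ℝ} {k : E n → E n → ℝ} {g : E n → ℝ} {ξ : E n}

theorem integrableOn_wsing_sub (hn : 1 ≤ n) (hξ : ‖ξ‖ ≤ r) :
    IntegrableOn (fun x => wsing (x - ξ)) (closedBall (0 : E n) r) := by
  have hm : Measurable fun x : E n => wsing (x - ξ) :=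
    measurable_wsing.comp (measurable_id.sub_const ξ)
  refine ⟨hm.aestronglyMeasurable, ?_⟩
  simp only [HasFiniteIntegral, wsing_sub_comm _ ξ]
  exact (lintegral_wsing_sub_le hn hξ).trans_lt ENNReal.coe_lt_top

theorem integrable_indicator_wsing (hn : 1 ≤ n) (hRr : R ≤ r) (hξ : ‖ξ‖ ≤ r) (D : ℝ) :
    Integrable ((closedBall (0 : E n) R).indicator fun x => D * wsing (x - ξ)) := by
  have h : IntegrableOn (fun x => D * wsing (x - ξ)) (closedBall (0 : E n) R) :=
    ((integrableOn_wsing_sub hn hξ).mono_set (closedBall_subset_closedBall hRr)).const_mul D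
  exact h.integrable_indicator measurableSet_closedBall

/-- The zero of the test function at the origin pays for the factor `|x|⁻¹` allowed in the kernel.
-/
theorem IsWeakKernel.abs_mul_le (hk : IsWeakKernel r C k) (hg : IsTest R M g) (hRr : R ≤ r)
    (hξ : ‖ξ‖ ≤ r) (x : E n) :
    |k x ξ * g x| ≤ (closedBall (0 : E n) R).indicator (fun x => M * C * wsing (x - ξ)) x := by
  by_cases hx : ‖x‖ ≤ R
  · rw [indicator_of_mem (by simpa using hx), abs_mul]
    calc |k x ξ| * |g x| ≤ |k x ξ| * (M * ‖x‖) := by gcongr; exact hg.bound x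
      _ = M * (|k x ξ| * ‖x‖) := by ring
      _ ≤ M * (C * wsing (x - ξ)) := by
        have := hg.nonneg
        exact mul_le_mul_of_nonneg_left (hk.bound x ξ (hx.trans hRr) hξ) this
      _ = _ := by ring
  · rw [indicator_of_notMem (by simpa using hx), hg.supp x (not_le.1 hx)]
    simp

theorem IsWeakKernel.integrable_mul (hn : 1 ≤ n) (hk : IsWeakKernel r C k) (hg : IsTest R M g)
    (hRr : R ≤ r) (hξ : ‖ξ‖ ≤ r) : Integrable fun x => k x ξ * g x := by
  refine (integrable_indicator_wsing hn hRr hξ (M * C)).mono' ?_ (ae_of_all _ fun x => hk.abs_mul_le hg hRr hξ x)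
  exact ((hk.meas.comp (measurable_id.prodMk measurable_const)).mul hg.meas).aestronglyMeasurable

theorem IsWeakKernel.abs_slice_le (hn : 1 ≤ n) (hk : IsWeakKernel r C k) (hg : IsTest R M g)
    (hRr : R ≤ r) (hξ : ‖ξ‖ ≤ r) : |slice k g ξ| ≤ M * C * wConst n r := by
  have hi := integrableOn_wsing_sub hn hξ
  have h0 : 0 ≤ M * C := mul_nonneg hg.nonneg hk.nonneg
  calc |slice k g ξ| ≤ ∫ x, |k x ξ * g x| := abs_integral_le_integral_abs
    _ ≤ ∫ x, (closedBall (0 : E n) r).indicator (fun x => M * C * wsing (x - ξ)) x := by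
      refine integral_mono (hk.integrable_mul hn hg hRr hξ).abs
        (integrable_indicator_wsing hn le_rfl hξ (M * C)) fun x => ?_
      refine (hk.abs_mul_le hg hRr hξ x).trans ?_
      exact indicator_le_indicator_of_subset (closedBall_subset_closedBall hRr)
        (fun x => mul_nonneg h0 (wsing_nonneg _)) x
    _ = M * C * ∫ x in closedBall (0 : E n) r, wsing (x - ξ) := by
      rw [integral_indicator measurableSet_closedBall, integral_const_mul]
    _ ≤ M * C * wConst n r := by
      gcongr
      rw [integral_eq_lintegral_of_nonneg_ae (ae_of_all _ fun x => wsing_nonneg _)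
        hi.aestronglyMeasurable]
      refine ENNReal.toReal_le_of_le_ofReal (by positivity) ?_
      rw [ENNReal.ofReal_coe_nnreal]
      refine le_trans (le_of_eq ?_) (lintegral_wsing_sub_le hn hξ)
      refine lintegral_congr fun x => ?_
      rw [wsing_sub_comm, Real.enorm_of_nonneg (wsing_nonneg _)]

theorem measurable_slice (hk : Measurable (Function.uncurry k)) (hg : Measurable g) :
    Measurable (slice k g) := by
  have h : StronglyMeasurable (Function.uncurry fun ξ x : E n => k x ξ * g x) :=
    ((hk.comp measurable_swap).mul (hg.comp measurable_snd)).stronglyMeasurable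
  exact h.integral_prod_right.measurable

theorem slice_eq_setIntegral (hg : IsTest R M g) (ξ : E n) :
    slice k g ξ = ∫ x in B n R, k x ξ * g x := by
  rw [slice, setIntegral_eq_integral_of_forall_compl_eq_zero]
  intro x hx
  rw [hg.supp x (by simpa using hx), mul_zero]

theorem integral_mul_slice {f : E n → ℝ} (hg : IsTest R M g)
    (hi : Integrable (fun q : E n × E n => k q.1 q.2 * f q.2 * g q.1)
      ((ballMeasure n R).prod (ballMeasure n R))) :
    Integrable (fun ξ => f ξ * slice k g ξ) (ballMeasure n R) ∧
      ∫ ξ in B n R, f ξ * slice k g ξ = pairing R k f g := by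
  have h : ∀ ξ, f ξ * slice k g ξ = ∫ x in B n R, k x ξ * f ξ * g x := fun ξ => by
    rw [slice_eq_setIntegral hg, ← integral_const_mul]
    congr 1; ext x; ring
  simp only [h]
  exact ⟨hi.integral_prod_right, (integral_prod_symm _ hi).symm⟩

theorem IsWeakKernel.mono {R r C : ℝ} {k : E n → E n → ℝ} (hk : IsWeakKernel r C k)
    (hRr : R ≤ r) : IsWeakKernel R C k :=
  ⟨hk.meas, hk.nonneg, fun x ξ hx hξ => hk.bound x ξ (hx.trans hRr) (hξ.trans hRr)⟩

theorem IsWeakKernel.integrable_pairing (hn : 1 ≤ n) (hk : IsWeakKernel r C k) (hRr : R ≤ r)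
    {f : E n → ℝ} (hf : Continuous f) (hg : IsTest R M g) :
    Integrable (fun q : E n × E n => k q.1 q.2 * f q.2 * g q.1)
      ((ballMeasure n R).prod (ballMeasure n R)) := by
  obtain ⟨F0, hF0⟩ := (isCompact_closedBall (0 : E n) R).exists_bound_of_continuousOn
    hf.continuousOn
  exact BallBackstepping.integrable_pairing hn hk.meas (hk.mono hRr).bound hf.measurable
    (abs_nonneg F0) (fun ξ h => (hF0 ξ (by simpa using h)).trans (le_abs_self _)) hg.meas
    hg.nonneg fun x _ => hg.bound x

end

/-! ### Differentiation along dilations -/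

theorem pow_mul_wsing_smul (hn : 1 ≤ n) {s : ℝ} (hs : 0 < s) (z : E n) :
    s ^ (n - 1) * wsing (s • z) = wsing z := by
  obtain ⟨m, rfl⟩ : ∃ m, n = m + 1 := ⟨n - 1, by omega⟩
  rw [wsing, wsing, norm_smul, Real.norm_of_nonneg hs.le, Nat.add_sub_cancel, mul_pow, pow_succ s]
  field_simp

/-- The function `n g + x · ∇g`. -/
noncomputable def dilDiv (g : E n → ℝ) (x : E n) : ℝ := n * g x + fderiv ℝ g x x

theorem continuous_dilDiv {g : E n → ℝ} (hg : ContDiff ℝ 1 g) : Continuous (dilDiv g) :=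
  (continuous_const.mul hg.continuous).add
    ((hg.continuous_fderiv one_ne_zero).clm_apply continuous_id)

/-- `ζ` is continuously differentiable, supported in the open ball of radius `R` and vanishes at
the origin. -/
structure IsCTest (R M : ℝ) (ζ : E n → ℝ) : Prop where
  contDiff : ContDiff ℝ 1 ζ
  nonneg : 0 ≤ M
  bound : ∀ x, |ζ x| ≤ M * ‖x‖
  bound_fderiv : ∀ x, ‖fderiv ℝ ζ x‖ ≤ M
  supp : tsupport ζ ⊆ ball 0 R

/-- `p` and its dilation derivative `r` are weakly singular. -/
structure IsDilationPair (R C : ℝ) (p r : E n → E n → ℝ) : Prop where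
  ker : IsWeakKernel (2 * R) C p
  ker_deriv : IsWeakKernel (2 * R) C r
  hasDerivAt : ∀ x ξ : E n, x ≠ ξ → x ≠ 0 → ∀ s : ℝ, 0 < s →
    HasDerivAt (fun s : ℝ => p (s • x) (s • ξ)) (s⁻¹ * r (s • x) (s • ξ)) s

section

variable {R C M : ℝ} {p r : E n → E n → ℝ} {ζ : E n → ℝ}

theorem IsCTest.isTest (hζ : IsCTest R M ζ) : IsTest R M ζ := by
  refine ⟨hζ.contDiff.continuous.measurable, hζ.nonneg, hζ.bound,
    fun x hx => image_eq_zero_of_notMem_tsupport ?_⟩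
  intro h
  have := hζ.supp h
  rw [mem_ball_zero_iff] at this
  linarith

theorem IsCTest.isTest_dilDiv (hζ : IsCTest R M ζ) : IsTest R ((n + 1) * M) (dilDiv ζ) := by
  obtain ⟨hζ, hM, hζM, hζM', hsupp⟩ := hζ
  refine ⟨(continuous_dilDiv hζ).measurable, by positivity, fun x => ?_, fun x hx => ?_⟩
  · calc |dilDiv ζ x| ≤ |n * ζ x| + |fderiv ℝ ζ x x| := abs_add_le _ _
      _ ≤ n * (M * ‖x‖) + M * ‖x‖ := by
        rw [abs_mul, Nat.abs_cast]
        gcongr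
        · exact hζM x
        · exact ((fderiv ℝ ζ x).le_opNorm x).trans (by gcongr; exact hζM' x)
      _ = _ := by ring
  · have h0 : x ∉ tsupport ζ := fun h => by
      have := hsupp h
      rw [mem_ball_zero_iff] at this
      linarith
    rw [dilDiv, image_eq_zero_of_notMem_tsupport h0, fderiv_of_notMem_tsupport ℝ h0]
    simp

/-- Derivative of the adjoint operator under dilations. -/
theorem hasDerivAt_slice_smul (hn : 1 ≤ n) (hR : 0 < R)
    (hpr : IsDilationPair R C p r) (hζ : IsCTest R M ζ) {ξ : E n} (hξ : ‖ξ‖ ≤ R) :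
    HasDerivAt (fun s : ℝ => slice p ζ (s • ξ)) (slice p (dilDiv ζ) ξ + slice r ζ ξ) 1 := by
  have t1 := hζ.isTest
  have t2 := hζ.isTest_dilDiv
  obtain ⟨hp, hr, hE⟩ := hpr
  obtain ⟨hζ, hM, -, -, -⟩ := hζ
  have hR2 : R ≤ 2 * R := by linarith
  have hξ2 : ‖ξ‖ ≤ 2 * R := by linarith
  have := nontrivial_E hn
  have hnull : ∀ y : E n, ∀ᵐ x : E n, x ≠ y := fun y => by
    rw [ae_iff]
    simp
  set G : ℝ → E n → ℝ := fun s x => s ^ n * (p (s • x) (s • ξ) * ζ (s • x)) with hG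
  set G' : ℝ → E n → ℝ := fun s x => s ^ (n - 1) *
    (p (s • x) (s • ξ) * dilDiv ζ (s • x) + r (s • x) (s • ξ) * ζ (s • x)) with hG'
  -- The substitution `y = s x` dilates both arguments of the kernel, so differentiation in `s`
  -- never acts across the diagonal. The Jacobian `s^n` and the test function together produce
  -- `dilDiv ζ`.
  have hcov : ∀ s : ℝ, 0 < s → slice p ζ (s • ξ) = ∫ x, G s x := by
    intro s hs
    have h := Measure.integral_comp_smul (volume : Measure (E n))
      (fun y => p y (s • ξ) * ζ y) s
    rw [finrank_E, abs_of_pos (by positivity), smul_eq_mul] at h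
    simp only [hG, integral_const_mul, h, slice]
    field_simp
  have mG : ∀ s : ℝ, Measurable (G s) := fun s =>
    ((hp.meas.comp (Measurable.prodMk (measurable_const_smul s) measurable_const)).mul
      (t1.meas.comp (measurable_const_smul s))).const_mul _
  have i1 := hp.integrable_mul hn t2 hR2 hξ2
  have i2 := hr.integrable_mul hn t1 hR2 hξ2
  -- For `1/2 < s < 2` the point `s ξ` stays in the ball of radius `2 R`, and the integrand vanishes
  -- for `|x| > 2 R`. This is why the kernel bounds are required on the doubled ball.
  have key := hasDerivAt_integral_of_dominated_loc_of_deriv_le (μ := volume) (F := G) (F' := G')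
    (x₀ := (1 : ℝ)) (s := Ioo (1 / 2) 2)
    (bound := (closedBall (0 : E n) (2 * R)).indicator fun x =>
      ((n + 1) * M * C + M * C) * wsing (x - ξ))
    (Ioo_mem_nhds (by norm_num) (by norm_num)) ?_ ?_ ?_ ?_ ?_ ?_
  · have h1 : ∫ x, G' 1 x = slice p (dilDiv ζ) ξ + slice r ζ ξ := by
      simp only [hG', one_smul, one_pow, one_mul]
      rw [integral_add i1 i2, slice, slice]
    rw [← h1]
    refine key.2.congr_of_eventuallyEq ?_
    filter_upwards [Ioi_mem_nhds (zero_lt_one' ℝ)] with s hs using hcov s hs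
  · exact Eventually.of_forall fun s => (mG s).aestronglyMeasurable
  · simpa only [hG, one_smul, one_pow, one_mul] using hp.integrable_mul hn t1 hR2 hξ2
  · simp only [hG', one_smul, one_pow, one_mul]
    exact (i1.add i2).aestronglyMeasurable
  · refine ae_of_all _ fun x s hs => ?_
    have hs0 : 0 < s := by linarith [hs.1]
    have hsξ : ‖s • ξ‖ ≤ 2 * R := by
      rw [norm_smul, Real.norm_of_nonneg hs0.le]
      nlinarith [hs.2, norm_nonneg ξ]
    have b1 := hp.abs_mul_le t2 hR2 hsξ (s • x)
    have b2 := hr.abs_mul_le t1 hR2 hsξ (s • x)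
    by_cases hx : ‖x‖ ≤ 2 * R
    · rw [indicator_of_mem (by simpa using hx)]
      have hnn : ∀ c : ℝ, 0 ≤ c → (closedBall (0 : E n) R).indicator
          (fun x => c * wsing (x - s • ξ)) (s • x) ≤ c * wsing (s • x - s • ξ) := fun c hc =>
        indicator_le_self' (fun _ _ => mul_nonneg hc (wsing_nonneg _)) _
      have hC := hp.nonneg
      rw [Real.norm_eq_abs, hG', abs_mul, abs_of_pos (by positivity)]
      calc s ^ (n - 1) * |p (s • x) (s • ξ) * dilDiv ζ (s • x) + r (s • x) (s • ξ) * ζ (s • x)|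
          ≤ s ^ (n - 1) * ((n + 1) * M * C * wsing (s • x - s • ξ)
            + M * C * wsing (s • x - s • ξ)) := by
            gcongr
            refine (abs_add_le _ _).trans (add_le_add (b1.trans (hnn _ (by positivity)))
              (b2.trans (hnn _ (by positivity))))
        _ = ((n + 1) * M * C + M * C) * (s ^ (n - 1) * wsing (s • (x - ξ))) := by
            rw [smul_sub]; ring
        _ = _ := by rw [pow_mul_wsing_smul hn hs0]
    · have hsx : R < ‖s • x‖ := by
        rw [norm_smul, Real.norm_of_nonneg hs0.le]
        nlinarith [hs.1]
      rw [indicator_of_notMem (by simpa using hx), hG']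
      simp [t1.supp _ hsx, t2.supp _ hsx]
  · exact integrable_indicator_wsing hn le_rfl hξ2 _
  · filter_upwards [hnull ξ, hnull 0] with x hx hx0 s hs
    have hs0 : 0 < s := by linarith [hs.1]
    have d1 := hE x ξ hx hx0 s hs0
    have d2 := ((hζ.differentiable one_ne_zero) (s • x)).hasFDerivAt.comp_hasDerivAt s
      ((hasDerivAt_id s).smul_const x)
    have d3 := (hasDerivAt_pow n s).mul (d1.mul d2)
    refine d3.congr_deriv ?_
    obtain ⟨m, rfl⟩ : ∃ m, n = m + 1 := ⟨n - 1, by omega⟩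
    simp only [hG', dilDiv, map_smul, smul_eq_mul, Function.comp, id, one_smul,
      Nat.add_sub_cancel, Pi.mul_apply]
    rw [pow_succ]
    field_simp
    ring

end

/-- The kernel `k(x, R ξ / |ξ|)`. -/
noncomputable def trker (R : ℝ) (k : E n → E n → ℝ) (x ξ : E n) : ℝ := k x ((R / ‖ξ‖) • ξ)

theorem measurable_trker {R : ℝ} {k : E n → E n → ℝ} (hm : Measurable (Function.uncurry k)) :
    Measurable (Function.uncurry (trker R k)) := by
  have h1 : Measurable fun q : E n × E n => (q.1, (R / ‖q.2‖) • q.2) := by fun_prop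
  exact hm.comp h1

/-- For `ξ = 0` the quotient `R / 0` is `0` and the projected point is the origin, so no exception
is needed. -/
theorem norm_radial_le {R : ℝ} (hR : 0 ≤ R) (ξ : E n) : ‖(R / ‖ξ‖) • ξ‖ ≤ R := by
  rw [norm_smul, norm_div, norm_norm, Real.norm_of_nonneg hR]
  rcases eq_or_ne ‖ξ‖ 0 with h | h
  · rw [h, mul_zero]
    exact hR
  · rw [div_mul_cancel₀ _ h]

section

variable {R C M : ℝ} {p r : E n → E n → ℝ} {ζ : E n → ℝ}

theorem hasDerivAt_slice_ray (hn : 1 ≤ n) (hR : 0 < R) (hpr : IsDilationPair R C p r)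
    (hζ : IsCTest R M ζ) {θ : E n} (hθ : ‖θ‖ = 1) {t : ℝ} (ht : 0 < t) (htR : t ≤ R) :
    HasDerivAt (fun t : ℝ => slice p ζ (t • θ))
      (t⁻¹ * (slice p (dilDiv ζ) (t • θ) + slice r ζ (t • θ))) t := by
  have hξ : ‖t • θ‖ ≤ R := by rwa [norm_smul, hθ, mul_one, Real.norm_of_nonneg ht.le]
  have h := hasDerivAt_slice_smul hn hR hpr hζ hξ
  have h1 : HasDerivAt (fun u : ℝ => u * t⁻¹) t⁻¹ t := by
    simpa using (hasDerivAt_id t).mul_const t⁻¹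
  have e : t * t⁻¹ = 1 := mul_inv_cancel₀ ht.ne'
  rw [← e] at h
  have h2 := HasDerivAt.comp t h h1
  rw [mul_comm] at h2
  refine h2.congr_of_eventuallyEq (Eventually.of_forall fun u => ?_)
  simp only [Function.comp, smul_smul]
  rw [mul_assoc, inv_mul_cancel₀ ht.ne', mul_one]

/-- The function whose integrals over rays vanish. -/
noncomputable def rayFun (R : ℝ) (p r : E n → E n → ℝ) (f ζ : E n → ℝ) (ξ : E n) : ℝ :=
  dilDiv f ξ * (slice p ζ ξ - slice (trker R p) ζ ξ)
    + f ξ * (slice p (dilDiv ζ) ξ + slice r ζ ξ)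

theorem measurable_rayFun (hpr : IsDilationPair R C p r) (hζ : IsCTest R M ζ) {f : E n → ℝ}
    (hf : ContDiff ℝ 1 f) : Measurable (rayFun R p r f ζ) := by
  have m1 := measurable_slice hpr.ker.meas hζ.isTest.meas
  have m2 := measurable_slice (measurable_trker (R := R) hpr.ker.meas) hζ.isTest.meas
  have m3 := measurable_slice hpr.ker.meas hζ.isTest_dilDiv.meas
  have m4 := measurable_slice hpr.ker_deriv.meas hζ.isTest.meas
  exact ((continuous_dilDiv hf).measurable.mul (m1.sub m2)).add
    (hf.continuous.measurable.mul (m3.add m4))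

theorem exists_bound_rayFun (hn : 1 ≤ n) (hR : 0 < R) (hpr : IsDilationPair R C p r)
    (hζ : IsCTest R M ζ) {f : E n → ℝ} (hf : ContDiff ℝ 1 f) :
    ∃ D, ∀ ξ, ‖ξ‖ ≤ R → |rayFun R p r f ζ ξ| ≤ D := by
  obtain ⟨F0, hF0⟩ := (isCompact_closedBall (0 : E n) R).exists_bound_of_continuousOn
    hf.continuous.continuousOn
  obtain ⟨F1, hF1⟩ := (isCompact_closedBall (0 : E n) R).exists_bound_of_continuousOn
    (continuous_dilDiv hf).continuousOn
  have hR2 : R ≤ 2 * R := by linarith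
  set T := M * C * wConst n (2 * R)
  set T' := (n + 1) * M * C * wConst n (2 * R)
  refine ⟨F1 * (T + T) + F0 * (T' + T), fun ξ hξ => ?_⟩
  have hF0' := hF0 ξ (by simpa using hξ)
  have hF1' := hF1 ξ (by simpa using hξ)
  have b1 := hpr.ker.abs_slice_le hn hζ.isTest hR2 (hξ.trans hR2)
  have b2 := hpr.ker.abs_slice_le hn hζ.isTest hR2 ((norm_radial_le hR.le ξ).trans hR2)
  have b3 := hpr.ker.abs_slice_le hn hζ.isTest_dilDiv hR2 (hξ.trans hR2)
  have b4 := hpr.ker_deriv.abs_slice_le hn hζ.isTest hR2 (hξ.trans hR2)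
  have h1 : |slice p ζ ξ - slice (trker R p) ζ ξ| ≤ T + T :=
    (abs_sub _ _).trans (add_le_add b1 b2)
  have h2 : |slice p (dilDiv ζ) ξ + slice r ζ ξ| ≤ T' + T :=
    (abs_add_le _ _).trans (add_le_add b3 b4)
  refine (abs_add_le _ _).trans (add_le_add ?_ ?_)
  · rw [abs_mul]
    exact mul_le_mul hF1' h1 (abs_nonneg _) ((norm_nonneg _).trans hF1')
  · rw [abs_mul]
    exact mul_le_mul hF0' h2 (abs_nonneg _) ((norm_nonneg _).trans hF0')

/-- The integrand is the derivative of `Φ`, which vanishes at `0` through the factor `t^n` and at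
`R` because the boundary value of the slice is subtracted. That subtraction turns the boundary term
into a volume integral containing the trace kernel. -/
theorem integral_ray_rayFun (hn : 1 ≤ n) (hR : 0 < R) (hpr : IsDilationPair R C p r)
    (hζ : IsCTest R M ζ) {f : E n → ℝ} (hf : ContDiff ℝ 1 f) {θ : E n} (hθ : ‖θ‖ = 1) :
    ∫ t in (0 : ℝ)..R, t ^ (n - 1) * rayFun R p r f ζ (t • θ) = 0 := by
  have hnorm : ∀ t : ℝ, 0 ≤ t → ‖t • θ‖ = t := fun t ht => by
    rw [norm_smul, hθ, mul_one, Real.norm_of_nonneg ht]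
  have hR2 : R ≤ 2 * R := by linarith
  set Φ : ℝ → ℝ := fun t => t ^ n * (f (t • θ) * (slice p ζ (t • θ) - slice p ζ (R • θ))) with hΦ
  have hder : ∀ t, 0 < t → t ≤ R →
      HasDerivAt Φ (t ^ (n - 1) * rayFun R p r f ζ (t • θ)) t := by
    intro t ht htR
    have d1 := hasDerivAt_slice_ray hn hR hpr hζ hθ ht htR
    have d2 := ((hf.differentiable one_ne_zero) (t • θ)).hasFDerivAt.comp_hasDerivAt t
      ((hasDerivAt_id t).smul_const θ)
    have d3 := (hasDerivAt_pow n t).mul (d2.mul (d1.sub_const (slice p ζ (R • θ))))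
    refine d3.congr_deriv ?_
    obtain ⟨m, rfl⟩ : ∃ m, n = m + 1 := ⟨n - 1, by omega⟩
    have e : slice (trker R p) ζ (t • θ) = slice p ζ (R • θ) := by
      simp only [slice, trker, hnorm t ht.le, smul_smul]
      rw [div_mul_cancel₀ _ ht.ne']
    simp only [rayFun, e, dilDiv, map_smul, smul_eq_mul, Function.comp, id, one_smul,
      Nat.add_sub_cancel, Pi.mul_apply]
    rw [pow_succ]
    field_simp
    ring
  obtain ⟨F0, hF0⟩ := (isCompact_closedBall (0 : E n) R).exists_bound_of_continuousOn
    hf.continuous.continuousOn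
  have hcont : ContinuousOn Φ (Icc 0 R) := by
    intro t ht
    rcases ht.1.eq_or_lt with h0 | h0
    · subst h0
      -- The slices are only known to be bounded near the origin, and the factor `t^n` with `n ≥ 1`
      -- forces continuity there.
      set T := M * C * wConst n (2 * R)
      have hΦ0 : Φ 0 = 0 := by
        simp only [hΦ]
        rw [zero_pow (by omega), zero_mul]
      rw [ContinuousWithinAt, hΦ0]
      have hlim : Tendsto (fun t : ℝ => t ^ n * (F0 * (T + T))) (𝓝[Icc 0 R] 0) (𝓝 0) := by
        have : Continuous fun t : ℝ => t ^ n * (F0 * (T + T)) := by fun_prop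
        have h := this.tendsto 0
        rw [zero_pow (by omega), zero_mul] at h
        exact h.mono_left nhdsWithin_le_nhds
      refine squeeze_zero_norm' ?_ hlim
      filter_upwards [self_mem_nhdsWithin] with t ht
      have htR : ‖t • θ‖ ≤ R := by rw [hnorm t ht.1]; exact ht.2
      have hRR : ‖R • θ‖ ≤ R := by rw [hnorm R hR.le]
      have b1 := hpr.ker.abs_slice_le hn hζ.isTest hR2 (htR.trans hR2)
      have b2 := hpr.ker.abs_slice_le hn hζ.isTest hR2 (hRR.trans hR2)
      have hF0' := hF0 (t • θ) (by simpa using htR)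
      rw [Real.norm_eq_abs, abs_mul, abs_of_nonneg (pow_nonneg ht.1 n), abs_mul]
      refine mul_le_mul_of_nonneg_left ?_ (pow_nonneg ht.1 n)
      exact mul_le_mul hF0' ((abs_sub _ _).trans (add_le_add b1 b2)) (abs_nonneg _)
        ((norm_nonneg _).trans hF0')
    · exact (hder t h0 ht.2).continuousAt.continuousWithinAt
  obtain ⟨D, hD⟩ := exists_bound_rayFun hn hR hpr hζ hf
  have hmeas := measurable_rayFun hpr hζ hf
  have hInt : IntervalIntegrable (fun t : ℝ => t ^ (n - 1) * rayFun R p r f ζ (t • θ))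
      volume 0 R := by
    rw [intervalIntegrable_iff_integrableOn_Ioc_of_le hR.le]
    refine Measure.integrableOn_of_bounded (M := R ^ (n - 1) * D) (by simp) ?_ ?_
    · have : Measurable fun t : ℝ => t ^ (n - 1) * rayFun R p r f ζ (t • θ) :=
        (measurable_id.pow_const _).mul (hmeas.comp (measurable_id.smul_const θ))
      exact this.aestronglyMeasurable
    · filter_upwards [ae_restrict_mem measurableSet_Ioc] with t ht
      have h1 := hD (t • θ) (by rw [hnorm t ht.1.le]; exact ht.2)
      rw [Real.norm_eq_abs, abs_mul, abs_of_nonneg (pow_nonneg ht.1.le _)]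
      exact mul_le_mul (pow_le_pow_left₀ ht.1.le ht.2 _) h1 (abs_nonneg _)
        (pow_nonneg hR.le _)
  rw [intervalIntegral.integral_eq_sub_of_hasDerivAt_of_le hR.le hcont
    (fun t ht => hder t ht.1 ht.2.le) hInt]
  simp only [hΦ, sub_self, mul_zero]
  rw [zero_pow (by omega), zero_mul, sub_zero]

theorem integral_rayFun (hn : 1 ≤ n) (hR : 0 < R) (hpr : IsDilationPair R C p r)
    (hζ : IsCTest R M ζ) {f : E n → ℝ} (hf : ContDiff ℝ 1 f) :
    ∫ ξ in B n R, rayFun R p r f ζ ξ = 0 := by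
  obtain ⟨D, hD⟩ := exists_bound_rayFun hn hR hpr hζ hf
  have hmeas := measurable_rayFun hpr hζ hf
  have hi : IntegrableOn (rayFun R p r f ζ) (B n R) :=
    Measure.integrableOn_of_bounded (M := D) measure_closedBall_lt_top.ne
      hmeas.aestronglyMeasurable
      ((ae_restrict_mem measurableSet_closedBall).mono fun ξ h => hD ξ (by simpa using h))
  rw [← integral_indicator measurableSet_closedBall,
    integral_polar _ (hi.integrable_indicator measurableSet_closedBall) hn]
  refine integral_eq_zero_of_ae (ae_of_all _ fun θ => ?_)
  have hθ : ‖(θ : E n)‖ = 1 := by simp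
  have h0 := integral_ray_rayFun hn hR hpr hζ hf hθ
  rw [Pi.zero_apply]
  refine Eq.trans ?_ h0
  beta_reduce
  rw [intervalIntegral.integral_of_le hR.le, ← integral_indicator measurableSet_Ioi, ← integral_indicator measurableSet_Ioc]
  congr 1
  ext t
  by_cases h0 : 0 < t
  · have hm : t • (θ : E n) ∈ B n R ↔ t ≤ R := by simp [norm_smul, abs_of_pos h0]
    simp [indicator, hm, h0]
  · simp [indicator, h0]

/-- Integration by parts along dilations. -/
theorem pairing_dilation (hn : 1 ≤ n) (hR : 0 < R) (hpr : IsDilationPair R C p r)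
    (hζ : IsCTest R M ζ) {f : E n → ℝ} (hf : ContDiff ℝ 1 f)
    {D : ℝ≥0} (htr : IsSchur (ballMeasure n R) (fun x ξ => ‖x‖ * trker R p x ξ) D) :
    pairing R p f (dilDiv ζ) = - pairing R r f ζ
      - (pairing R p (dilDiv f) ζ - pairing R (trker R p) (dilDiv f) ζ) := by
  have hR2 : R ≤ 2 * R := by linarith
  have t1 := hζ.isTest
  have t2 := hζ.isTest_dilDiv
  have hcf := continuous_dilDiv hf
  have a1 := integral_mul_slice t1 (hpr.ker.integrable_pairing hn hR2 hcf t1)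
  have a2 : Integrable (fun ξ => dilDiv f ξ * slice (trker R p) ζ ξ) (ballMeasure n R) ∧
      ∫ ξ in B n R, dilDiv f ξ * slice (trker R p) ζ ξ
        = pairing R (trker R p) (dilDiv f) ζ := by
    refine integral_mul_slice t1 ?_
    obtain ⟨F1, hF1⟩ := (isCompact_closedBall (0 : E n) R).exists_bound_of_continuousOn
      hcf.continuousOn
    have l1 : MemLp (dilDiv f) 2 (ballMeasure n R) :=
      MemLp.of_bound hcf.aestronglyMeasurable F1
        ((ae_restrict_mem measurableSet_closedBall).mono fun ξ h => hF1 ξ h)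
    -- Only `|x|` times the trace kernel passes Schur's test; the weight is compensated by dividing
    -- the test function by `|x|`, which leaves it bounded.
    have l2 : MemLp (fun x => ‖x‖⁻¹ * ζ x) 2 (ballMeasure n R) := by
      refine MemLp.of_bound (measurable_norm.inv.mul t1.meas).aestronglyMeasurable M
        (ae_of_all _ fun x => ?_)
      rw [norm_mul, norm_inv, norm_norm, Real.norm_eq_abs]
      rcases eq_or_ne x 0 with rfl | hx
      · simpa using t1.nonneg
      · rw [inv_mul_le_iff₀ (norm_pos_iff.2 hx), mul_comm]
        exact t1.bound x
    refine (htr.integrable_prod l1 l2).congr (ae_of_all _ fun q => ?_)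
    rcases eq_or_ne q.1 0 with h | h
    · have : ζ 0 = 0 := by simpa using t1.bound 0
      simp [h, this]
    · have := norm_ne_zero_iff.2 h
      simp only
      field_simp
  have a3 := integral_mul_slice t2 (hpr.ker.integrable_pairing hn hR2 hf.continuous t2)
  have a4 := integral_mul_slice t1 (hpr.ker_deriv.integrable_pairing hn hR2 hf.continuous t1)
  have h := integral_rayFun hn hR hpr hζ hf
  simp only [rayFun, mul_sub, mul_add] at h
  have e1 := integral_add (a1.1.sub a2.1) (a3.1.add a4.1)
  simp only [Pi.sub_apply, Pi.add_apply] at e1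
  rw [e1, integral_sub a1.1 a2.1, integral_add a3.1 a4.1, a1.2, a2.2, a3.2, a4.2] at h
  linarith

end

/-! ### Operators bounded on `H¹` -/

/-- The integral operator with kernel `k` maps functions with a square-integrable weak gradient to
such functions, with a bound on the gradient. -/
def IsH1Bounded (R : ℝ) (k : E n → E n → ℝ) : Prop :=
  ∃ A : ℝ≥0, ∀ (f : E n → ℝ) (F : E n → E n), MemLp f 2 (ballMeasure n R) →
    IsL2WeakGradient R f F → ∃ G : E n → E n, IsL2WeakGradient R (kop (ballMeasure n R) k f) G ∧
      eLpNorm G 2 (ballMeasure n R)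
        ≤ A * (eLpNorm f 2 (ballMeasure n R) + eLpNorm F 2 (ballMeasure n R))

/-- The gradient of the operator with kernel `k` is given by integral operators acting on `f` and
on the partial derivatives of `f`. -/
structure HasGradKernels (R : ℝ) (k : E n → E n → ℝ) (K₀ : Fin n → E n → E n → ℝ)
    (K₁ : Fin n → Fin n → E n → E n → ℝ) : Prop where
  schur : ∃ C, IsSchur (ballMeasure n R) k C
  schur_zero : ∀ j, ∃ C, IsSchur (ballMeasure n R) (K₀ j) C
  schur_one : ∀ j i, ∃ C, IsSchur (ballMeasure n R) (K₁ j i) C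
  integral_eq : ∀ f η : E n → ℝ, ContDiff ℝ 1 f → ContDiff ℝ ∞ η → HasCompactSupport η →
    tsupport η ⊆ ball 0 R → ∀ j,
      ∫ x in B n R, kop (ballMeasure n R) k f x * fderiv ℝ η x (ev j)
        = -((∫ x in B n R, kop (ballMeasure n R) (K₀ j) f x * η x)
          + ∑ i, ∫ x in B n R,
            kop (ballMeasure n R) (K₁ j i) (fun ξ => fderiv ℝ f ξ (ev i)) x * η x)

theorem memLp_ball_of_continuous {R : ℝ} {f : E n → ℝ} (hf : Continuous f) :
    MemLp f 2 (ballMeasure n R) := by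
  obtain ⟨F1, hF1⟩ := (isCompact_closedBall (0 : E n) R).exists_bound_of_continuousOn
    hf.continuousOn
  exact MemLp.of_bound hf.aestronglyMeasurable F1
    ((ae_restrict_mem measurableSet_closedBall).mono fun ξ h => hF1 ξ h)

theorem sum_smul_ev_apply (a : Fin n → ℝ) (i : Fin n) : (∑ j, a j • ev j : E n) i = a i := by
  simp [ev, Finset.sum_apply, Pi.single_apply]

theorem sum_coord_smul_ev (x : E n) : ∑ j, x j • ev j = x := by
  ext i
  exact sum_smul_ev_apply (fun j => x j) i

theorem norm_ev (i : Fin n) : ‖(ev i : E n)‖ = 1 := by simp [ev]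

theorem memLp_coord {μ : Measure (E n)} {F : E n → E n} (hF : MemLp F 2 μ) (i : Fin n) :
    MemLp (fun x => F x i) 2 μ :=
  (EuclideanSpace.proj i : E n →L[ℝ] ℝ).comp_memLp' hF

theorem eLpNorm_coord_le {μ : Measure (E n)} (F : E n → E n) (i : Fin n) :
    eLpNorm (fun x => F x i) 2 μ ≤ eLpNorm F 2 μ :=
  eLpNorm_mono fun x => PiLp.norm_apply_le (F x) i

/-- The formula for the gradient is known for `C¹` functions and involves only `L²`-bounded
operators of `f` and of its partial derivatives. It therefore persists under the approximation and
defines the weak gradient for Sobolev functions. -/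
theorem HasGradKernels.isH1Bounded {R : ℝ} (hR : 0 < R) {k : E n → E n → ℝ}
    {K₀ : Fin n → E n → E n → ℝ} {K₁ : Fin n → Fin n → E n → E n → ℝ}
    (h : HasGradKernels R k K₀ K₁) : IsH1Bounded R k := by
  set μ := ballMeasure n R with hμ
  obtain ⟨C, hC⟩ := h.schur
  choose C₀ hC₀ using h.schur_zero
  choose C₁ hC₁ using h.schur_one
  refine ⟨∑ j, (C₀ j + ∑ i, C₁ j i), fun f F hf hF => ?_⟩
  have hFi : ∀ i, MemLp (fun x => F x i) 2 μ := memLp_coord hF.1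
  set D : Fin n → E n → ℝ := fun j x =>
    kop μ (K₀ j) f x + ∑ i, kop μ (K₁ j i) (fun ξ => F ξ i) x with hD
  have m0 : ∀ j, MemLp (kop μ (K₀ j) f) 2 μ := fun j => (hC₀ j).memLp_kop hf
  have m1 : ∀ j i, MemLp (kop μ (K₁ j i) (fun ξ => F ξ i)) 2 μ := fun j i =>
    (hC₁ j i).memLp_kop (hFi i)
  have m1' : ∀ j, MemLp (fun x => ∑ i, kop μ (K₁ j i) (fun ξ => F ξ i) x) 2 μ := fun j =>
    memLp_finsetSum _ fun i _ => m1 j i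
  have mD : ∀ j, MemLp (D j) 2 μ := fun j => (m0 j).add (m1' j)
  have hDle : ∀ j, eLpNorm (D j) 2 μ
      ≤ ((C₀ j + ∑ i, C₁ j i : ℝ≥0) : ℝ≥0∞) * (eLpNorm f 2 μ + eLpNorm F 2 μ) := by
    intro j
    have h1 := (hC₀ j).eLpNorm_kop_le hf
    have h2 : eLpNorm (fun x => ∑ i, kop μ (K₁ j i) (fun ξ => F ξ i) x) 2 μ
        ≤ ∑ i, (C₁ j i : ℝ≥0∞) * eLpNorm F 2 μ := by
      have e : (fun x => ∑ i, kop μ (K₁ j i) (fun ξ => F ξ i) x)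
          = ∑ i, kop μ (K₁ j i) (fun ξ => F ξ i) := by ext x; simp
      rw [e]
      refine (eLpNorm_sum_le (fun i _ => (m1 j i).1) one_le_two).trans
        (Finset.sum_le_sum fun i _ => ?_)
      refine ((hC₁ j i).eLpNorm_kop_le (hFi i)).trans ?_
      gcongr
      exact eLpNorm_coord_le F i
    refine (eLpNorm_add_le (m0 j).1 (m1' j).1 one_le_two).trans ?_
    refine (add_le_add h1 h2).trans ?_
    rw [← Finset.sum_mul]
    push_cast
    rw [add_mul, mul_add, mul_add]
    exact add_le_add le_self_add le_add_self
  have mG : ∀ j, MemLp (fun x => D j x • (ev j : E n)) 2 μ := fun j => by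
    have := (ContinuousLinearMap.toSpanSingleton ℝ (ev j : E n)).comp_memLp' (mD j)
    simpa [Function.comp_def] using this
  refine ⟨fun x => ∑ j, D j x • ev j, ⟨memLp_finsetSum _ fun j _ => mG j, ?_⟩, ?_⟩
  · intro η hη hηc hηs j
    obtain ⟨u, hu, hu0, hu1⟩ := exists_contDiff_approx hR hf hF
    have mη : MemLp η 2 μ := memLp_ball_of_continuous hη.continuous
    have hηd : Continuous fun x => fderiv ℝ η x (ev j) :=
      (hη.continuous_fderiv (by simp)).clm_apply continuous_const
    have mdη : MemLp (fun x => fderiv ℝ η x (ev j)) 2 μ := memLp_ball_of_continuous hηd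
    have mu : ∀ m, MemLp (u m) 2 μ := fun m => memLp_ball_of_continuous (hu m).continuous
    have mdu : ∀ m i, MemLp (fun x => fderiv ℝ (u m) x (ev i)) 2 μ := fun m i =>
      memLp_ball_of_continuous
        (((hu m).continuous_fderiv one_ne_zero).clm_apply continuous_const)
    have l0 := hC.tendsto_integral_kop_mul mu hf mdη hu0
    have l1 := (hC₀ j).tendsto_integral_kop_mul mu hf mη hu0
    have l2 := fun i => (hC₁ j i).tendsto_integral_kop_mul (fun m => mdu m i) (hFi i) mη (hu1 i)
    have l3 := (l1.add (tendsto_finsetSum Finset.univ fun i _ => l2 i)).neg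
    have l4 := tendsto_nhds_unique l0
      (l3.congr fun m => (h.integral_eq (u m) η (hu m) hη hηc hηs j).symm)
    have hev : (EuclideanSpace.single j (1 : ℝ) : E n) = ev j := rfl
    simp only [hev, sum_smul_ev_apply]
    rw [l4]
    congr 1
    have i0 : Integrable (fun x => kop μ (K₀ j) f x * η x) μ := (m0 j).integrable_mul mη
    have i1 : ∀ i, Integrable (fun x => kop μ (K₁ j i) (fun ξ => F ξ i) x * η x) μ := fun i =>
      (m1 j i).integrable_mul mη
    simp only [hD, add_mul, Finset.sum_mul]
    rw [integral_add i0 (integrable_finsetSum _ fun i _ => i1 i),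
      integral_finsetSum _ fun i _ => i1 i]
  · have e : (fun x => ∑ j, D j x • (ev j : E n)) = ∑ j, fun x => D j x • (ev j : E n) := by
      ext x; simp
    rw [e]
    refine (eLpNorm_sum_le (fun j _ => (mG j).1) one_le_two).trans ?_
    push_cast
    rw [Finset.sum_mul]
    refine Finset.sum_le_sum fun j _ => ?_
    refine le_trans (eLpNorm_mono fun x => ?_) (by simpa using hDle j)
    rw [norm_smul, norm_ev, mul_one]

theorem IsL2WeakGradient.congr {R : ℝ} {f g : E n → ℝ} {F : E n → E n}
    (h : IsL2WeakGradient R f F) (hfg : f =ᵐ[ballMeasure n R] g) : IsL2WeakGradient R g F := by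
  refine ⟨h.1, fun η h1 h2 h3 i => ?_⟩
  rw [← h.2 η h1 h2 h3 i]
  exact integral_congr_ae (hfg.symm.mono fun x hx => by simp only [hx])

theorem IsL2WeakGradient.add {R : ℝ} {f g : E n → ℝ} {F G : E n → E n}
    (hF : IsL2WeakGradient R f F) (hG : IsL2WeakGradient R g G)
    (hf : MemLp f 2 (ballMeasure n R)) (hg : MemLp g 2 (ballMeasure n R)) :
    IsL2WeakGradient R (fun x => f x + g x) (fun x => F x + G x) := by
  refine ⟨hF.1.add hG.1, fun η h1 h2 h3 i => ?_⟩
  have mη : MemLp η 2 (ballMeasure n R) := memLp_ball_of_continuous h1.continuous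
  have mdη : MemLp (fun x => fderiv ℝ η x (EuclideanSpace.single i 1)) 2 (ballMeasure n R) :=
    memLp_ball_of_continuous ((h1.continuous_fderiv (by simp)).clm_apply continuous_const)
  have e1 := integral_add (hf.integrable_mul mdη) (hg.integrable_mul mdη)
  have e2 := integral_add ((memLp_coord hF.1 i).integrable_mul mη)
    ((memLp_coord hG.1 i).integrable_mul mη)
  simp only [Pi.mul_apply] at e1 e2
  simp only [add_mul, PiLp.add_apply]
  rw [e1, e2, hF.2 η h1 h2 h3 i, hG.2 η h1 h2 h3 i]
  ring

theorem IsH1Bounded.add {R : ℝ} {k l : E n → E n → ℝ} {C D : ℝ≥0}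
    (hk : IsSchur (ballMeasure n R) k C) (hl : IsSchur (ballMeasure n R) l D)
    (hk1 : IsH1Bounded R k) (hl1 : IsH1Bounded R l) :
    IsH1Bounded R (fun x ξ => k x ξ + l x ξ) := by
  obtain ⟨A, hA⟩ := hk1
  obtain ⟨A', hA'⟩ := hl1
  refine ⟨A + A', fun f F hf hF => ?_⟩
  obtain ⟨G, hG, hGle⟩ := hA f F hf hF
  obtain ⟨G', hG', hGle'⟩ := hA' f F hf hF
  refine ⟨fun x => G x + G' x, ?_, ?_⟩
  · refine (hG.add hG' (hk.memLp_kop hf) (hl.memLp_kop hf)).congr ?_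
    filter_upwards [hk.ae_integrable hf, hl.ae_integrable hf] with x h1 h2
    simp only [kop, add_mul]
    exact (integral_add h1 h2).symm
  · refine (eLpNorm_add_le hG.1.1 hG'.1.1 one_le_two).trans ?_
    push_cast
    rw [add_mul]
    exact add_le_add hGle hGle'

/-! ### Isometry-invariant kernels that vanish at the origin -/

/-- The kernel `|x|⁻² h(x, ξ)`. -/
noncomputable def dkern (h : E n → E n → ℝ) (x ξ : E n) : ℝ := (‖x‖ ^ 2)⁻¹ * h x ξ

/-- `h` is a weakly singular kernel that is invariant under isometries, has dilation derivative
`e`, and vanishes to first order at `x = 0`; the boundary values of `|x|⁻¹ h` define a bounded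
operator. -/
structure IsConeKernel (R C : ℝ) (D : ℝ≥0) (h e : E n → E n → ℝ) : Prop where
  meas : Measurable (Function.uncurry h)
  meas_euler : Measurable (Function.uncurry e)
  nonneg : 0 ≤ C
  isometry : ∀ (Q : E n ≃ₗᵢ[ℝ] E n) (x ξ : E n), h (Q x) (Q ξ) = h x ξ
  euler : ∀ x ξ : E n, x ≠ ξ → x ≠ 0 → ∀ s : ℝ, 0 < s →
    HasDerivAt (fun s : ℝ => h (s • x) (s • ξ)) (s⁻¹ * e (s • x) (s • ξ)) s
  bound : ∀ x ξ : E n, ‖x‖ ≤ 2 * R → ‖ξ‖ ≤ 2 * R → |h x ξ| ≤ C * ‖x‖ * wsing (x - ξ)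
  bound_euler : ∀ x ξ : E n, ‖x‖ ≤ 2 * R → ‖ξ‖ ≤ 2 * R → |e x ξ| ≤ C * ‖x‖ * wsing (x - ξ)
  trace : IsSchur (ballMeasure n R) (fun x ξ => ‖x‖ * trker R (dkern h) x ξ) D

theorem measurable_dkern {h : E n → E n → ℝ} (hm : Measurable (Function.uncurry h)) :
    Measurable (Function.uncurry (dkern h)) := by
  have h1 : Measurable fun q : E n × E n => (‖q.1‖ ^ 2)⁻¹ := by fun_prop
  exact h1.mul hm

theorem abs_dkern_le {h : E n → E n → ℝ} {C : ℝ} (hC : 0 ≤ C) {x ξ : E n}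
    (hb : |h x ξ| ≤ C * ‖x‖ * wsing (x - ξ)) : |dkern h x ξ| * ‖x‖ ≤ C * wsing (x - ξ) := by
  rcases eq_or_ne x 0 with rfl | hx
  · rw [norm_zero, mul_zero]
    exact mul_nonneg hC (wsing_nonneg _)
  · have : 0 < ‖x‖ := norm_pos_iff.2 hx
    rw [dkern, abs_mul, abs_of_pos (by positivity)]
    calc (‖x‖ ^ 2)⁻¹ * |h x ξ| * ‖x‖ ≤ (‖x‖ ^ 2)⁻¹ * (C * ‖x‖ * wsing (x - ξ)) * ‖x‖ := by gcongr
      _ = _ := by field_simp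

theorem IsWeakKernel.isSchur_norm_mul (hn : 1 ≤ n) {R C : ℝ} {k : E n → E n → ℝ}
    (hk : IsWeakKernel R C k) :
    IsSchur (ballMeasure n R) (fun x ξ => ‖x‖ * k x ξ) (C.toNNReal * wConst n R) := by
  have hm : Measurable (Function.uncurry fun x ξ : E n => ‖x‖ * k x ξ) :=
    (measurable_norm.comp measurable_fst).mul hk.meas
  have hle : ∀ x ξ : E n, ‖x‖ ≤ R → ‖ξ‖ ≤ R →
      |‖x‖ * k x ξ| ≤ C.toNNReal * |wsing (x - ξ)| := fun x ξ hx hξ => by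
    rw [abs_mul, abs_norm, mul_comm, abs_of_nonneg (wsing_nonneg _), Real.coe_toNNReal _ hk.nonneg]
    exact hk.bound x ξ hx hξ
  refine (isSchur_wsing hn R).of_abs_le hm _ ?_ ?_
  · filter_upwards [ae_mem_ball (n := n) R] with x hx
    filter_upwards [ae_mem_ball (n := n) R] with ξ hξ using hle x ξ hx hξ
  · filter_upwards [ae_mem_ball (n := n) R] with ξ hξ
    filter_upwards [ae_mem_ball (n := n) R] with x hx using hle x ξ hx hξ

theorem IsSchur.exists_of_ball_le {R : ℝ} {k l : E n → E n → ℝ} {C : ℝ≥0}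
    (hk : IsSchur (ballMeasure n R) k C) (hl : Measurable (Function.uncurry l)) {c : ℝ}
    (hle : ∀ x ξ : E n, ‖x‖ ≤ R → ‖ξ‖ ≤ R → |l x ξ| ≤ c * |k x ξ|) :
    ∃ C', IsSchur (ballMeasure n R) l C' := by
  have hle' : ∀ x ξ : E n, ‖x‖ ≤ R → ‖ξ‖ ≤ R → |l x ξ| ≤ c.toNNReal * |k x ξ| :=
    fun x ξ hx hξ => (hle x ξ hx hξ).trans (by gcongr; exact Real.le_coe_toNNReal c)
  refine ⟨_, hk.of_abs_le hl c.toNNReal ?_ ?_⟩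
  · filter_upwards [ae_mem_ball (n := n) R] with x hx
    filter_upwards [ae_mem_ball (n := n) R] with ξ hξ using hle' x ξ hx hξ
  · filter_upwards [ae_mem_ball (n := n) R] with ξ hξ
    filter_upwards [ae_mem_ball (n := n) R] with x hx using hle' x ξ hx hξ

/-- The kernel acting on `f` in the `j`-th derivative of the operator with kernel `h`. -/
noncomputable def gradKer₀ (R : ℝ) (h e : E n → E n → ℝ) (j : Fin n) (x ξ : E n) : ℝ :=
  x j * dkern e x ξ + (n * x j) * (dkern h x ξ - trker R (dkern h) x ξ)

/-- The kernel acting on `∂ᵢ f` in the `j`-th derivative of the operator with kernel `h`. -/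
noncomputable def gradKer₁ (R : ℝ) (h : E n → E n → ℝ) (j i : Fin n) (x ξ : E n) : ℝ :=
  ((if i = j then ∑ l, x l * ξ l else 0) - x i * ξ j) * dkern h x ξ
    + (x j * ξ i) * (dkern h x ξ - trker R (dkern h) x ξ)

section

variable {R C : ℝ} {D : ℝ≥0} {h e : E n → E n → ℝ}

theorem IsConeKernel.isWeakKernel (H : IsConeKernel R C D h e) :
    IsWeakKernel (2 * R) C (dkern h) :=
  ⟨measurable_dkern H.meas, H.nonneg, fun x ξ hx hξ => abs_dkern_le H.nonneg (H.bound x ξ hx hξ)⟩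

theorem IsConeKernel.isWeakKernel_euler (H : IsConeKernel R C D h e) :
    IsWeakKernel (2 * R) C (dkern e) :=
  ⟨measurable_dkern H.meas_euler, H.nonneg,
    fun x ξ hx hξ => abs_dkern_le H.nonneg (H.bound_euler x ξ hx hξ)⟩

/-- The factor `|x|⁻²` is homogeneous of degree `-2` under dilations, which contributes the term `-2
* dkern h`; the constant `3 C` covers both kernels. -/
theorem IsConeKernel.isDilationPair (H : IsConeKernel R C D h e) :
    IsDilationPair R (3 * C) (dkern h) (fun x ξ => dkern e x ξ - 2 * dkern h x ξ) := by
  have h1 := H.isWeakKernel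
  have h2 := H.isWeakKernel_euler
  have hC := H.nonneg
  refine ⟨⟨h1.meas, by positivity, fun x ξ hx hξ => ?_⟩,
    ⟨h2.meas.sub (h1.meas.const_mul 2), by positivity, fun x ξ hx hξ => ?_⟩, ?_⟩
  · refine (h1.bound x ξ hx hξ).trans ?_
    have := mul_nonneg hC (wsing_nonneg (x - ξ))
    linarith
  · have b1 := h1.bound x ξ hx hξ
    have b2 := h2.bound x ξ hx hξ
    calc |dkern e x ξ - 2 * dkern h x ξ| * ‖x‖
        ≤ (|dkern e x ξ| + |2 * dkern h x ξ|) * ‖x‖ := by gcongr; exact abs_sub _ _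
      _ = |dkern e x ξ| * ‖x‖ + 2 * (|dkern h x ξ| * ‖x‖) := by
        rw [abs_mul, abs_of_pos (zero_lt_two' ℝ)]; ring
      _ ≤ _ := by linarith
  · intro x ξ hx hx0 s hs
    have d1 := H.euler x ξ hx hx0 s hs
    have hx' : ‖x‖ ≠ 0 := norm_ne_zero_iff.2 hx0
    have d2 : HasDerivAt (fun s : ℝ => (s ^ 2)⁻¹) (-(2 * s) / (s ^ 2) ^ 2) s := by
      simpa using (hasDerivAt_pow 2 s).fun_inv (by positivity : s ^ 2 ≠ 0)
    have d3 := (d2.mul_const (‖x‖ ^ 2)⁻¹).mul d1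
    have e1 : ∀ u : ℝ, (‖u • x‖ ^ 2)⁻¹ = (u ^ 2)⁻¹ * (‖x‖ ^ 2)⁻¹ := fun u => by
      rw [norm_smul, mul_pow, mul_inv, Real.norm_eq_abs, sq_abs]
    refine (d3.congr_of_eventuallyEq (Eventually.of_forall fun u => ?_)).congr_deriv ?_
    · simp only [dkern, e1, Pi.mul_apply]
    · simp only [dkern, e1]
      field_simp
      ring

theorem IsConeKernel.exists_isSchur (hn : 1 ≤ n) (hR : 0 < R) (H : IsConeKernel R C D h e) :
    ∃ C', IsSchur (ballMeasure n R) h C' := by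
  refine (H.isWeakKernel.mono (by linarith : R ≤ 2 * R)).isSchur_norm_mul hn |>.exists_of_ball_le
    H.meas (c := R) fun x ξ hx _ => ?_
  rcases eq_or_ne x 0 with rfl | hx0
  · have h0 : |h 0 ξ| ≤ 0 := by
      have := H.bound 0 ξ (by simpa using hR.le) (by linarith)
      simpa using this
    refine h0.trans ?_
    simp
  · have : 0 < ‖x‖ := norm_pos_iff.2 hx0
    rw [dkern, abs_mul, abs_mul, abs_norm, abs_of_pos (a := (‖x‖ ^ 2)⁻¹) (by positivity)]
    calc |h x ξ| = ‖x‖ * (‖x‖ * ((‖x‖ ^ 2)⁻¹ * |h x ξ|)) := by field_simp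
      _ ≤ R * (‖x‖ * ((‖x‖ ^ 2)⁻¹ * |h x ξ|)) := by gcongr

theorem abs_sum_mul_le {x ξ : E n} : |∑ l, x l * ξ l| ≤ ‖x‖ * ‖ξ‖ := by
  have := abs_real_inner_le_norm ξ x
  rw [mul_comm]
  simpa [PiLp.inner_apply] using this

theorem abs_coord_le (x : E n) (i : Fin n) : |x i| ≤ ‖x‖ := PiLp.norm_apply_le x i

/-- In the gradient formula every singular kernel comes with a coefficient that vanishes at `x = 0`,
which restores the missing weight `|x|`. -/
theorem IsSchur.exists_coeff_mul {k : E n → E n → ℝ}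
    (hk : IsSchur (ballMeasure n R) (fun x ξ => ‖x‖ * k x ξ) D)
    (hm : Measurable (Function.uncurry k)) {a : E n → E n → ℝ} {c : ℝ}
    (ha : Measurable (Function.uncurry a))
    (hle : ∀ x ξ : E n, ‖x‖ ≤ R → ‖ξ‖ ≤ R → |a x ξ| ≤ c * ‖x‖) :
    ∃ C', IsSchur (ballMeasure n R) (fun x ξ => a x ξ * k x ξ) C' := by
  refine hk.exists_of_ball_le (ha.mul hm) (c := c) fun x ξ hx hξ => ?_
  rw [abs_mul, abs_mul, abs_norm, ← mul_assoc]
  gcongr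
  exact hle x ξ hx hξ

theorem IsConeKernel.exists_isSchur_gradKer (hn : 1 ≤ n) (hR : 0 < R)
    (H : IsConeKernel R C D h e) :
    (∀ j, ∃ C', IsSchur (ballMeasure n R) (gradKer₀ R h e j) C') ∧
      ∀ j i, ∃ C', IsSchur (ballMeasure n R) (gradKer₁ R h j i) C' := by
  have hR2 : R ≤ 2 * R := by linarith
  have s1 := (H.isWeakKernel.mono hR2).isSchur_norm_mul hn
  have s2 := (H.isWeakKernel_euler.mono hR2).isSchur_norm_mul hn
  have s3 := s1.sub H.trace
  simp only [← mul_sub] at s3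
  have m1 := measurable_dkern H.meas
  have m2 := measurable_dkern H.meas_euler
  have m3 : Measurable (Function.uncurry fun x ξ => dkern h x ξ - trker R (dkern h) x ξ) :=
    m1.sub (measurable_trker m1)
  have hc1 : ∀ i, Measurable fun q : E n × E n => q.1 i := fun i => by fun_prop
  have hc2 : ∀ i, Measurable fun q : E n × E n => q.2 i := fun i => by fun_prop
  have hprod : ∀ (i j : Fin n) (x ξ : E n), ‖ξ‖ ≤ R → |x i * ξ j| ≤ R * ‖x‖ :=
    fun i j x ξ hξ => by
      rw [abs_mul, mul_comm]
      exact mul_le_mul ((abs_coord_le ξ j).trans hξ) (abs_coord_le x i) (abs_nonneg _) hR.le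
  refine ⟨fun j => ?_, fun j i => ?_⟩
  · obtain ⟨A, hA⟩ := s2.exists_coeff_mul m2 (a := fun x _ => x j) (c := 1) (hc1 j)
      fun x ξ _ _ => by simpa using abs_coord_le x j
    obtain ⟨A', hA'⟩ := s3.exists_coeff_mul m3 (a := fun x _ => n * x j) (c := n)
      ((hc1 j).const_mul _) fun x ξ _ _ => by
        rw [abs_mul, Nat.abs_cast]
        gcongr
        exact abs_coord_le x j
    exact ⟨_, hA.add hA'⟩
  · obtain ⟨A, hA⟩ := s1.exists_coeff_mul m1
      (a := fun x ξ => (if i = j then ∑ l, x l * ξ l else 0) - x i * ξ j) (c := R + R)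
      (by
        refine Measurable.sub ?_ ((hc1 i).mul (hc2 j))
        by_cases hij : i = j
        · simp only [hij, if_true]
          exact Finset.measurable_sum _ fun l _ => (hc1 l).mul (hc2 l)
        · simp only [hij, if_false]
          exact measurable_const)
      (fun x ξ _ hξ => by
        rw [add_mul]
        refine (abs_sub _ _).trans (add_le_add ?_ (hprod i j x ξ hξ))
        split_ifs
        · refine abs_sum_mul_le.trans ?_
          rw [mul_comm]
          gcongr
        · rw [abs_zero]
          positivity)
    obtain ⟨A', hA'⟩ := s3.exists_coeff_mul m3 (a := fun x ξ => x j * ξ i) (c := R)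
      ((hc1 j).mul (hc2 i)) fun x ξ _ hξ => hprod j i x ξ hξ
    exact ⟨_, hA.add hA'⟩

end

/-! ### Partial derivatives expressed through rotations and dilations -/

section

variable {R : ℝ} {η : E n → ℝ}

theorem fderiv_coord_mul (hη : ContDiff ℝ 1 η) (i : Fin n) (x v : E n) :
    fderiv ℝ (fun x : E n => x i * η x) x v = v i * η x + x i * fderiv ℝ η x v := by
  have h1 : HasFDerivAt (fun x : E n => x i) (EuclideanSpace.proj i : E n →L[ℝ] ℝ) x :=
    (EuclideanSpace.proj i : E n →L[ℝ] ℝ).hasFDerivAt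
  have h2 := (hη.differentiable one_ne_zero x).hasFDerivAt
  have h3 := h1.mul h2
  have h4 : HasFDerivAt (fun x : E n => x i * η x)
    (x i • fderiv ℝ η x + η x • (EuclideanSpace.proj i : E n →L[ℝ] ℝ)) x := h3
  rw [h4.fderiv]
  simp
  ring

theorem exists_isCTest_coord_mul (hη : ContDiff ℝ 1 η) (hηc : HasCompactSupport η)
    (hηs : tsupport η ⊆ ball 0 R) (i : Fin n) : ∃ M, IsCTest R M fun x : E n => x i * η x := by
  have hc : ContDiff ℝ 1 fun x : E n => x i * η x :=
    (EuclideanSpace.proj i : E n →L[ℝ] ℝ).contDiff.mul hη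
  have hs : HasCompactSupport fun x : E n => x i * η x := hηc.mul_left
  obtain ⟨M1, hM1⟩ := hη.continuous.bounded_above_of_compact_support hηc
  obtain ⟨M2, hM2⟩ := (hc.continuous_fderiv one_ne_zero).bounded_above_of_compact_support
    (hs.fderiv ℝ)
  refine ⟨|M1| + |M2|, hc, by positivity, fun x => ?_, fun x => ?_, ?_⟩
  · rw [abs_mul, mul_comm]
    have h1 : |η x| ≤ |M1| + |M2| := (hM1 x).trans ((le_abs_self _).trans (by simp))
    exact mul_le_mul h1 (abs_coord_le x i) (abs_nonneg _) (by positivity)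
  · exact (hM2 x).trans ((le_abs_self _).trans (by simp))
  · exact (tsupport_mul_subset_right (f := fun x : E n => x i) (g := η)).trans hηs

theorem fderiv_eq_sum (f : E n → ℝ) (x v : E n) :
    fderiv ℝ f x v = ∑ i, v i * fderiv ℝ f x (ev i) := by
  conv_lhs => rw [← sum_coord_smul_ev v, map_sum]
  simp

/-- At bottom this is `|x|² ∂ⱼ = ∑ xᵢ (xᵢ ∂ⱼ - xⱼ ∂ᵢ) + xⱼ (x · ∇)`. Taking the multipliers `xᵢ` and
`xⱼ` inside the derivatives, and using `n g + x · ∇g` in place of `x · ∇g`, costs the last term. -/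
theorem norm_sq_mul_fderiv (hη : ContDiff ℝ 1 η) (j : Fin n) (x : E n) :
    ‖x‖ ^ 2 * fderiv ℝ η x (ev j)
      = (∑ i, fderiv ℝ (fun x : E n => x i * η x) x (rotGen i j x))
        + dilDiv (fun x : E n => x j * η x) x - 2 * (x j * η x) := by
  have e1 : ∀ i, fderiv ℝ (fun x : E n => x i * η x) x (rotGen i j x)
      = (x i * (if i = j then 1 else 0) - x j) * η x + x i ^ 2 * fderiv ℝ η x (ev j)
        - x j * (x i * fderiv ℝ η x (ev i)) := by
    intro i
    rw [fderiv_coord_mul hη, rotGen_apply, map_sub, map_smul, map_smul]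
    have : (x i • ev j - x j • ev i : E n) i = x i * (if i = j then 1 else 0) - x j := by
      simp [ev]
    rw [this]
    simp only [smul_eq_mul]
    ring
  simp only [e1, Finset.sum_sub_distrib, Finset.sum_add_distrib, ← Finset.sum_mul,
    ← Finset.mul_sum]
  rw [← fderiv_eq_sum, dilDiv, fderiv_coord_mul hη, EuclideanSpace.real_norm_sq_eq]
  simp
  ring

end

section

variable {R C M : ℝ} {D : ℝ≥0} {h e : E n → E n → ℝ}

theorem IsCTest.isTest_fderiv {ζ : E n → ℝ} (hζ : IsCTest R M ζ) (A : E n →L[ℝ] E n) :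
    IsTest R (M * ‖A‖) fun x => fderiv ℝ ζ x (A x) := by
  have hM := hζ.nonneg
  refine ⟨((hζ.contDiff.continuous_fderiv one_ne_zero).clm_apply A.continuous).measurable,
    by positivity, fun x => ?_, fun x hx => ?_⟩
  · calc |fderiv ℝ ζ x (A x)| ≤ ‖fderiv ℝ ζ x‖ * ‖A x‖ := (fderiv ℝ ζ x).le_opNorm _
      _ ≤ M * (‖A‖ * ‖x‖) := by
        gcongr
        · exact hζ.bound_fderiv x
        · exact A.le_opNorm x
      _ = _ := by ring
  · have h0 : x ∉ tsupport ζ := fun h => by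
      have := hζ.supp h
      rw [mem_ball_zero_iff] at this
      linarith
    rw [fderiv_of_notMem_tsupport ℝ h0]
    simp

theorem IsConeKernel.dkern_mul_norm_sq (hR : 0 < R) (H : IsConeKernel R C D h e) {x ξ : E n}
    (hξ : ‖ξ‖ ≤ R) : dkern h x ξ * ‖x‖ ^ 2 = h x ξ := by
  rcases eq_or_ne x 0 with rfl | hx0
  · have h0 : |h 0 ξ| ≤ 0 := by
      have := H.bound 0 ξ (by simpa using hR.le) (by linarith)
      simpa using this
    rw [abs_nonpos_iff.1 h0]
    simp
  · have := norm_ne_zero_iff.2 hx0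
    rw [dkern]
    field_simp

/-- The derivative of the operator falls on the kernel and on `f` after integration by parts along
rotations and dilations. -/
theorem IsConeKernel.pairing_fderiv (hn : 1 ≤ n) (hR : 0 < R) (H : IsConeKernel R C D h e)
    {f η : E n → ℝ} (hf : ContDiff ℝ 1 f) (hη : ContDiff ℝ 1 η) (hηc : HasCompactSupport η)
    (hηs : tsupport η ⊆ ball 0 R) (j : Fin n) :
    pairing R h f (fun x => fderiv ℝ η x (ev j))
      = -((∑ i, pairing R (dkern h) (fun ξ => fderiv ℝ f ξ (rotGen i j ξ)) fun x => x i * η x)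
        + pairing R (dkern e) f (fun x => x j * η x)
        + (pairing R (dkern h) (dilDiv f) (fun x => x j * η x)
          - pairing R (trker R (dkern h)) (dilDiv f) fun x => x j * η x)) := by
  have hR2 : R ≤ 2 * R := by linarith
  have hp := H.isWeakKernel
  have hq := H.isWeakKernel_euler
  choose M hζ using exists_isCTest_coord_mul hη hηc hηs
  set ζ : Fin n → E n → ℝ := fun i x => x i * η x with hζdef
  have hrot : ∀ i, pairing R (dkern h) f (fun x => fderiv ℝ (ζ i) x (rotGen i j x))
      = -pairing R (dkern h) (fun ξ => fderiv ℝ f ξ (rotGen i j ξ)) (ζ i) := by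
    intro i
    obtain ⟨Q, hQ0, hQ⟩ := exists_rotation i j
    refine pairing_rotation hn hp.meas (hp.mono hR2).bound ?_ hf (hζ i).contDiff (hζ i).nonneg
      (fun x _ => (hζ i).bound x) (fun x _ => (hζ i).bound_fderiv x) hQ0 hQ
    intro Q x ξ
    simp only [dkern, LinearIsometryEquiv.norm_map, H.isometry]
  have hdil := pairing_dilation hn hR H.isDilationPair (hζ j) hf H.trace
  have i1 := fun i => hp.integrable_pairing hn hR2 hf.continuous
    ((hζ i).isTest_fderiv (rotGen i j))
  have i2 := hp.integrable_pairing hn hR2 hf.continuous (hζ j).isTest_dilDiv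
  have i3 := hp.integrable_pairing hn hR2 hf.continuous (hζ j).isTest
  have i4 := hq.integrable_pairing hn hR2 hf.continuous (hζ j).isTest
  have hr : pairing R (fun x ξ => dkern e x ξ - 2 * dkern h x ξ) f (ζ j)
      = pairing R (dkern e) f (ζ j) - 2 * pairing R (dkern h) f (ζ j) := by
    rw [pairing, pairing, pairing, ← integral_const_mul, ← integral_sub i4 (i3.const_mul 2)]
    congr 1; ext q; ring
  -- Writing `h = |x|² dkern h` moves the factor `|x|²` to the derivative of the test function,
  -- where it is decomposed into rotations and the dilation.
  have hL : pairing R h f (fun x => fderiv ℝ η x (ev j))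
      = (∑ i, pairing R (dkern h) f (fun x => fderiv ℝ (ζ i) x (rotGen i j x)))
        + pairing R (dkern h) f (dilDiv (ζ j)) - 2 * pairing R (dkern h) f (ζ j) := by
    simp only [pairing]
    rw [← integral_finsetSum _ fun i _ => i1 i, ← integral_const_mul,
      ← integral_add (integrable_finsetSum _ fun i _ => i1 i) i2]
    have e1 := integral_sub ((integrable_finsetSum Finset.univ fun i _ => i1 i).add i2)
      (i3.const_mul 2)
    simp only [Pi.add_apply] at e1
    rw [← e1]
    refine integral_congr_ae ?_
    filter_upwards [ae_mem_ball_prod (n := n) R] with q hq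
    have h1 := norm_sq_mul_fderiv hη j q.1
    rw [← H.dkern_mul_norm_sq hR hq.2, ← Finset.mul_sum]
    linear_combination (dkern h q.1 q.2 * f q.2) * h1
  rw [hL, hdil, hr]
  simp only [hrot, Finset.sum_neg_distrib]
  ring

/-- It remains to expand the rotational and dilation derivatives of `f` into partial derivatives and
to sort by them; the coefficients are `gradKer₀` and `gradKer₁`. -/
theorem IsConeKernel.hasGradKernels (hn : 1 ≤ n) (hR : 0 < R) (H : IsConeKernel R C D h e) :
    HasGradKernels R h (gradKer₀ R h e) (gradKer₁ R h) := by
  obtain ⟨hs0, hs1⟩ := H.exists_isSchur_gradKer hn hR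
  refine ⟨H.exists_isSchur hn hR, hs0, hs1, fun f η hf hη' hηc hηs j => ?_⟩
  have hη : ContDiff ℝ 1 η := hη'.of_le (by simp)
  obtain ⟨C', hC'⟩ := H.exists_isSchur hn hR
  obtain ⟨C₀, hC₀⟩ := hs0 j
  choose C₁ hC₁ using hs1 j
  have hR2 : R ≤ 2 * R := by linarith
  have hp := H.isWeakKernel
  have hq := H.isWeakKernel_euler
  choose M hζ using exists_isCTest_coord_mul hη hηc hηs
  have mη : MemLp η 2 (ballMeasure n R) := memLp_ball_of_continuous hη.continuous
  have mdη : MemLp (fun x => fderiv ℝ η x (ev j)) 2 (ballMeasure n R) :=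
    memLp_ball_of_continuous ((hη.continuous_fderiv one_ne_zero).clm_apply continuous_const)
  have mf : MemLp f 2 (ballMeasure n R) := memLp_ball_of_continuous hf.continuous
  have hdf := hf.continuous_fderiv one_ne_zero
  have mdf : ∀ i, MemLp (fun ξ => fderiv ℝ f ξ (ev i)) 2 (ballMeasure n R) := fun i =>
    memLp_ball_of_continuous (hdf.clm_apply continuous_const)
  have mEf : MemLp (dilDiv f) 2 (ballMeasure n R) :=
    memLp_ball_of_continuous (continuous_dilDiv hf)
  rw [hC'.integral_kop_mul mf mdη, hC₀.integral_kop_mul mf mη]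
  simp only [fun i => (hC₁ i).integral_kop_mul (mdf i) mη]
  have hmain := H.pairing_fderiv hn hR hf hη hηc hηs j
  simp only [pairing] at hmain
  rw [hmain]
  congr 1
  have j1 := fun i => hp.integrable_pairing hn hR2
    (hdf.clm_apply (rotGen i j).continuous) (hζ i).isTest
  have j2 := hq.integrable_pairing hn hR2 hf.continuous (hζ j).isTest
  have j3 := hp.integrable_pairing hn hR2 (continuous_dilDiv hf) (hζ j).isTest
  obtain ⟨C₂, hC₂⟩ := H.trace.exists_coeff_mul (measurable_trker hp.meas) (a := fun x _ => x j)
    (c := 1) (by fun_prop) fun x ξ _ _ => by simpa using abs_coord_le x j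
  have j4 : Integrable (fun q : E n × E n => trker R (dkern h) q.1 q.2 * dilDiv f q.2
      * (q.1 j * η q.1)) ((ballMeasure n R).prod (ballMeasure n R)) := by
    refine (hC₂.integrable_prod mEf mη).congr (ae_of_all _ fun q => ?_)
    simp only
    ring
  rw [← integral_finsetSum _ fun i _ => j1 i, ← integral_sub j3 j4,
    ← integral_add (integrable_finsetSum _ fun i _ => j1 i) j2]
  have e1 := integral_add ((integrable_finsetSum Finset.univ fun i _ => j1 i).add j2) (j3.sub j4)
  simp only [Pi.add_apply, Pi.sub_apply] at e1
  rw [← e1, ← integral_finsetSum _ fun i _ => (hC₁ i).integrable_prod (mdf i) mη,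
    ← integral_add (hC₀.integrable_prod mf mη)
      (integrable_finsetSum _ fun i _ => (hC₁ i).integrable_prod (mdf i) mη)]
  congr 1
  ext q
  simp only [gradKer₀, gradKer₁, dilDiv, rotGen_apply, map_sub, map_smul, smul_eq_mul]
  rw [fderiv_eq_sum f q.2 q.2]
  have s1 : ∑ i, dkern h q.1 q.2 * (q.2 i * fderiv ℝ f q.2 (ev j) - q.2 j * fderiv ℝ f q.2 (ev i))
        * (q.1 i * η q.1)
      = dkern h q.1 q.2 * η q.1 * ((∑ i, q.1 i * q.2 i) * fderiv ℝ f q.2 (ev j)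
        - q.2 j * ∑ i, q.1 i * fderiv ℝ f q.2 (ev i)) := by
    rw [Finset.sum_mul, Finset.mul_sum, ← Finset.sum_sub_distrib, Finset.mul_sum]
    exact Finset.sum_congr rfl fun i _ => by ring
  have s2 : ∑ i, (((if i = j then ∑ l, q.1 l * q.2 l else 0) - q.1 i * q.2 j) * dkern h q.1 q.2
        + q.1 j * q.2 i * (dkern h q.1 q.2 - trker R (dkern h) q.1 q.2))
          * fderiv ℝ f q.2 (ev i) * η q.1
      = dkern h q.1 q.2 * η q.1 * ((∑ i, q.1 i * q.2 i) * fderiv ℝ f q.2 (ev j)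
        - q.2 j * ∑ i, q.1 i * fderiv ℝ f q.2 (ev i))
        + q.1 j * (dkern h q.1 q.2 - trker R (dkern h) q.1 q.2) * η q.1
          * ∑ i, q.2 i * fderiv ℝ f q.2 (ev i) := by
    have s3 : (∑ l, q.1 l * q.2 l) * fderiv ℝ f q.2 (ev j)
        = ∑ i, (if i = j then ∑ l, q.1 l * q.2 l else 0) * fderiv ℝ f q.2 (ev i) := by
      simp
    rw [s3, Finset.mul_sum (a := q.2 j), ← Finset.sum_sub_distrib, Finset.mul_sum, Finset.mul_sum,
      ← Finset.sum_add_distrib]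
    exact Finset.sum_congr rfl fun i _ => by ring
  rw [s1, s2]
  ring

theorem IsConeKernel.isH1Bounded (hn : 1 ≤ n) (hR : 0 < R) (H : IsConeKernel R C D h e) :
    IsH1Bounded R h :=
  (H.hasGradKernels hn hR).isH1Bounded hR

end

/-! ### The control kernels are bounded on `H¹` -/

/-- The density of the dilation derivative of a kernel with density `a`. -/
noncomputable def euDens (n : ℕ) (a : ℝ → ℝ) (u : ℝ) : ℝ := (2 - n) * a u + 2 * u * deriv a u

theorem continuous_euDens {a : ℝ → ℝ} (ha : ContDiff ℝ 1 a) : Continuous (euDens n a) :=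
  (continuous_const.mul ha.continuous).add
    ((continuous_const.mul continuous_id).mul (ha.continuous_deriv le_rfl))

/-- Euler's relation: the homogeneous factor of degree `2 - n` gives `(2 - n) a`, and the density,
whose argument scales by `s²`, gives `2 u a'(u)`. Dilation derivatives of the kernels are thus
kernels of the same kind. -/
theorem hasDerivAt_density_smul {a : ℝ → ℝ} (ha : ContDiff ℝ 1 a) (δ c : ℝ) {s : ℝ}
    (hs : 0 < s) :
    HasDerivAt (fun s : ℝ => a (s ^ 2 * δ) * (s ^ 2 / s ^ n * c))
      (s⁻¹ * (euDens n a (s ^ 2 * δ) * (s ^ 2 / s ^ n * c))) s := by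
  have d0 : HasDerivAt (fun s : ℝ => s ^ 2 * δ) (2 * s * δ) s := by
    simpa using (hasDerivAt_pow 2 s).mul_const δ
  have d1 := ((ha.differentiable one_ne_zero) (s ^ 2 * δ)).hasDerivAt.comp s d0
  have hsn : s ^ n ≠ 0 := (pow_pos hs n).ne'
  have d2 := (((hasDerivAt_pow 2 s).div (hasDerivAt_pow n s) hsn).mul_const c)
  have d3 := d1.mul d2
  refine d3.congr_deriv ?_
  have e : (n : ℝ) * s ^ (n - 1) = n * s ^ n / s := by
    rcases n with _ | m
    · simp
    · rw [Nat.add_sub_cancel, pow_succ]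
      field_simp
  simp only [e, euDens, Function.comp, Pi.div_apply]
  field_simp
  push_cast
  ring

theorem vker_smul {a : ℝ → ℝ} {x ξ : E n} {s : ℝ} (hs : 0 < s) :
    vker a (s • x) (s • ξ) = if ‖ξ‖ < ‖x‖ then
      a (s ^ 2 * (‖x‖ ^ 2 - ‖ξ‖ ^ 2)) * (s ^ 2 / s ^ n * (pois x ξ / sphereArea n)) else 0 := by
  have h1 : ‖s • ξ‖ < ‖s • x‖ ↔ ‖ξ‖ < ‖x‖ := by
    rw [norm_smul, norm_smul, Real.norm_of_nonneg hs.le, mul_lt_mul_iff_right₀ hs]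
  have h2 : ‖s • x‖ ^ 2 - ‖s • ξ‖ ^ 2 = s ^ 2 * (‖x‖ ^ 2 - ‖ξ‖ ^ 2) := by
    rw [norm_smul, norm_smul, Real.norm_of_nonneg hs.le]
    ring
  simp only [vker, h1, h2, pois_smul hs]
  split_ifs
  · ring
  · rfl

theorem hasDerivAt_vker_smul {a : ℝ → ℝ} (ha : ContDiff ℝ 1 a) (x ξ : E n) {s : ℝ} (hs : 0 < s) :
    HasDerivAt (fun s : ℝ => vker a (s • x) (s • ξ))
      (s⁻¹ * vker (euDens n a) (s • x) (s • ξ)) s := by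
  have hev : (fun s : ℝ => vker a (s • x) (s • ξ)) =ᶠ[𝓝 s] fun s : ℝ => if ‖ξ‖ < ‖x‖ then
      a (s ^ 2 * (‖x‖ ^ 2 - ‖ξ‖ ^ 2)) * (s ^ 2 / s ^ n * (pois x ξ / sphereArea n)) else 0 := by
    filter_upwards [Ioi_mem_nhds hs] with u hu using vker_smul hu
  refine HasDerivAt.congr_of_eventuallyEq ?_ hev
  rw [vker_smul hs]
  split_ifs
  · exact hasDerivAt_density_smul ha _ _ hs
  · simpa using hasDerivAt_const s (0 : ℝ)

theorem vker_isometry (a : ℝ → ℝ) (Q : E n ≃ₗᵢ[ℝ] E n) (x ξ : E n) :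
    vker a (Q x) (Q ξ) = vker a x ξ := by
  simp only [vker, pois_isometry, Q.norm_map]

theorem ae_ne_ball (hn : 1 ≤ n) (R : ℝ) (y : E n) : ∀ᵐ x ∂(ballMeasure n R), x ≠ y := by
  have := nontrivial_E hn
  refine ae_restrict_of_ae ?_
  rw [ae_iff]
  simp

theorem isH1Bounded_vker (hn : 1 ≤ n) {R : ℝ} (hR : 0 < R) {a : ℝ → ℝ} (ha : ContDiff ℝ 1 a) :
    IsH1Bounded (n := n) R (vker a) := by
  have hb := continuous_euDens (n := n) ha
  have hA := sphereArea_pos hn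
  obtain ⟨C1, hC1, hC1'⟩ := exists_bound_Icc ha.continuous (2 * R)
  obtain ⟨C2, hC2, hC2'⟩ := exists_bound_Icc hb (2 * R)
  have m1 : Measurable (Function.uncurry (vker a : E n → E n → ℝ)) :=
    measurable_vker ha.continuous.measurable
  have m2 : Measurable (Function.uncurry (vker (euDens n a) : E n → E n → ℝ)) :=
    measurable_vker hb.measurable
  have H : IsConeKernel (n := n) R (2 * (C1 + C2) / sphereArea n) (0 * wConst n R) (vker a)
      (vker (euDens n a)) := by
    refine ⟨m1, m2, by positivity, vker_isometry a,
      fun x ξ _ _ s hs => hasDerivAt_vker_smul ha x ξ hs, fun x ξ hx _ => ?_, fun x ξ hx _ => ?_, ?_⟩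
    · rw [mul_assoc]
      exact abs_vker_le hn hx (fun s hs => (hC1' s hs).trans (by linarith)) ξ
    · rw [mul_assoc]
      exact abs_vker_le hn hx (fun s hs => (hC2' s hs).trans (by linarith)) ξ
    -- The trace places `ξ` on the boundary sphere, where `|ξ| < |x|` fails for all `x` in the ball.
    -- The trace kernel vanishes almost everywhere, hence the factor `0` in its Schur constant.
    · have hz : ∀ x ξ : E n, ‖x‖ ≤ R → ξ ≠ 0 → ‖x‖ * trker R (dkern (vker a)) x ξ = 0 := by
        intro x ξ hx hξ
        have h1 : ‖(R / ‖ξ‖) • ξ‖ = R := by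
          rw [norm_smul, norm_div, norm_norm, Real.norm_of_nonneg hR.le,
            div_mul_cancel₀ _ (norm_ne_zero_iff.2 hξ)]
        rw [trker, dkern, vker, h1, if_neg (not_lt.2 hx), mul_zero, mul_zero]
      refine (isSchur_wsing hn R).of_abs_le ?_ 0 ?_ ?_
      · exact (measurable_norm.comp measurable_fst).mul (measurable_trker (measurable_dkern m1))
      · filter_upwards [ae_mem_ball (n := n) R] with x hx
        filter_upwards [ae_ne_ball hn R 0] with ξ hξ
        simp [hz x ξ hx hξ]
      · filter_upwards [ae_ne_ball hn R 0] with ξ hξ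
        filter_upwards [ae_mem_ball (n := n) R] with x hx
        simp [hz x ξ hx hξ]
  exact H.isH1Bounded hn hR

/-! ### The observer kernels are bounded on `H¹` -/

/-- A function of degree `2 - n`, smooth in `x` for `ξ ≠ 0`, that agrees with the Poisson-type
kernel `pois ξ x` at `x = 0`. -/
noncomputable def profile (x ξ : E n) : ℝ := ‖ξ‖ ^ (n + 2) / (‖x‖ ^ 2 + ‖ξ‖ ^ 2) ^ n

/-- The smooth kernel `a(|ξ|² - |x|²) profile(x, ξ)`, normalized by the area of the sphere. -/
noncomputable def smoothKer (a : ℝ → ℝ) (x ξ : E n) : ℝ :=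
  a (‖ξ‖ ^ 2 - ‖x‖ ^ 2) * profile x ξ / sphereArea n

theorem profile_nonneg (x ξ : E n) : 0 ≤ profile x ξ := by unfold profile; positivity

theorem inv_pow_le_wsing (hn : 1 ≤ n) {x ξ : E n} (h : x ≠ ξ) :
    ((‖x‖ + ‖ξ‖) ^ (n - 1))⁻¹ ≤ wsing (x - ξ) := by
  have h0 : 0 < ‖x - ξ‖ := norm_pos_iff.2 (sub_ne_zero.2 h)
  rw [wsing_eq_inv hn (sub_ne_zero.2 h)]
  gcongr
  exact norm_sub_le x ξ

theorem add_norm_pos {x ξ : E n} (h : x ≠ ξ) : 0 < ‖x‖ + ‖ξ‖ := by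
  have h0 : 0 < ‖x - ξ‖ := norm_pos_iff.2 (sub_ne_zero.2 h)
  exact h0.trans_le (norm_sub_le x ξ)

theorem sq_add_sq_ge (s t : ℝ) : (s + t) ^ 2 / 2 ≤ s ^ 2 + t ^ 2 := by
  nlinarith [sq_nonneg (s - t)]

theorem profile_le (hn : 1 ≤ n) {x ξ : E n} (h : x ≠ ξ) :
    profile x ξ ≤ 2 ^ n * ((‖x‖ + ‖ξ‖) * wsing (x - ξ)) := by
  have hN := add_norm_pos h
  have h1 := inv_pow_le_wsing hn h
  set N := ‖x‖ + ‖ξ‖ with hNdef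
  have h2 : N ^ 2 / 2 ≤ ‖x‖ ^ 2 + ‖ξ‖ ^ 2 := sq_add_sq_ge _ _
  have h3 : ‖ξ‖ ≤ N := by simp [hNdef]
  calc profile x ξ ≤ N ^ (n + 2) / (N ^ 2 / 2) ^ n := by
        unfold profile
        gcongr
    _ = 2 ^ n * (N * (N ^ (n - 1))⁻¹) := by
        obtain ⟨m, rfl⟩ : ∃ m, n = m + 1 := ⟨n - 1, by omega⟩
        rw [Nat.add_sub_cancel, div_pow, ← pow_mul]
        field_simp
        ring
    _ ≤ _ := by gcongr

/-- This is the comparison normalized to `|ξ| = 1`, with `t = |x|` and `u = |ξ - x|`. Both fractions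
equal `1` at `t = 0` and differ from it by `O(t)`. -/
theorem abs_unit_profile_sub_le (k : ℕ) {t u : ℝ} (ht : 0 ≤ t) (ht2 : t ≤ 1 / 2)
    (hu : |1 - u| ≤ t) :
    |(1 - t ^ 2) / u ^ k - 1 / (t ^ 2 + 1) ^ k| ≤ (2 ^ k + k * 2 ^ k + k) * t := by
  have hu1 : 1 / 2 ≤ u := by have := (abs_le.1 hu).2; linarith
  have hu0 : 0 < u := by linarith
  have hinv : u⁻¹ ≤ 2 := by
    rw [inv_le_comm₀ hu0 two_pos]
    linarith
  have hinv0 : 0 < u⁻¹ := inv_pos.2 hu0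
  have htt : t ^ 2 ≤ t := by nlinarith
  have a1 : |t ^ 2 * u⁻¹ ^ k| ≤ 2 ^ k * t := by
    rw [abs_of_nonneg (by positivity), mul_comm]
    gcongr
  have a2 : |u⁻¹ ^ k - 1 ^ k| ≤ k * 2 ^ k * t := by
    have h1 : |u⁻¹ - 1| ≤ 2 * t := by
      have : u⁻¹ - 1 = u⁻¹ * (1 - u) := by field_simp
      rw [this, abs_mul, abs_of_pos hinv0]
      gcongr
    have h2 : max |u⁻¹| |(1 : ℝ)| ≤ 2 := by
      rw [abs_of_pos hinv0, abs_one]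
      exact max_le hinv one_le_two
    refine (abs_pow_sub_pow_le _ _ _).trans ?_
    rcases k with _ | k
    · simp
    calc |u⁻¹ - 1| * ((k + 1 : ℕ) : ℝ) * max |u⁻¹| |(1 : ℝ)| ^ (k + 1 - 1)
        ≤ (2 * t) * ((k + 1 : ℕ) : ℝ) * 2 ^ (k + 1 - 1) := by gcongr
      _ = _ := by
        rw [Nat.add_sub_cancel, pow_succ]
        ring
  have a3 : |1 ^ k - ((t ^ 2 + 1)⁻¹) ^ k| ≤ k * t := by
    have hv : (t ^ 2 + 1)⁻¹ ≤ 1 := inv_le_one_of_one_le₀ (by nlinarith [sq_nonneg t])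
    have hv0 : 0 < (t ^ 2 + 1)⁻¹ := by positivity
    have h1 : |1 - (t ^ 2 + 1)⁻¹| ≤ t := by
      have : 1 - (t ^ 2 + 1)⁻¹ = t ^ 2 * (t ^ 2 + 1)⁻¹ := by field_simp; ring
      rw [this, abs_of_nonneg (by positivity)]
      nlinarith [sq_nonneg t]
    have h2 : max |(1 : ℝ)| |(t ^ 2 + 1)⁻¹| = 1 := by
      rw [abs_of_pos hv0, abs_one]
      exact max_eq_left hv
    refine (abs_pow_sub_pow_le _ _ _).trans ?_
    rw [h2, one_pow, mul_one, mul_comm]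
    gcongr
  have e : (1 - t ^ 2) / u ^ k - 1 / (t ^ 2 + 1) ^ k
      = -(t ^ 2 * u⁻¹ ^ k) + (u⁻¹ ^ k - 1 ^ k) + (1 ^ k - ((t ^ 2 + 1)⁻¹) ^ k) := by
    rw [inv_pow, inv_pow]
    ring
  rw [e]
  refine (abs_add_le _ _).trans ?_
  refine (add_le_add (abs_add_le _ _) le_rfl).trans ?_
  rw [abs_neg]
  linarith

/-- The constant in the comparison of `pois ξ x` with `profile x ξ`. -/
noncomputable def profileConst (n : ℕ) : ℝ := 2 ^ n + n * 2 ^ n + n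

theorem abs_pois_sub_profile_le (hn : 1 ≤ n) {x ξ : E n} (h : 2 * ‖x‖ < ‖ξ‖) :
    |pois ξ x - profile x ξ| ≤ profileConst n * 2 ^ n * (‖x‖ * wsing (x - ξ)) := by
  have hρ : 0 < ‖ξ‖ := by linarith [norm_nonneg x]
  have hne : x ≠ ξ := by
    rintro rfl
    linarith
  have hw := inv_pow_le_wsing hn hne
  have ht2 : ‖x‖ / ‖ξ‖ ≤ 1 / 2 := by
    rw [div_le_iff₀ hρ]
    linarith
  have hu : |1 - ‖ξ - x‖ / ‖ξ‖| ≤ ‖x‖ / ‖ξ‖ := by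
    have h1 : 1 - ‖ξ - x‖ / ‖ξ‖ = (‖ξ‖ - ‖ξ - x‖) / ‖ξ‖ := by field_simp
    rw [h1, abs_div, abs_of_pos hρ]
    gcongr
    refine (abs_norm_sub_norm_le ξ (ξ - x)).trans ?_
    simp
  have hd : 0 < ‖ξ - x‖ := norm_pos_iff.2 (sub_ne_zero.2 hne.symm)
  have hk := abs_unit_profile_sub_le n (by positivity) ht2 hu
  have e : pois ξ x - profile x ξ = ‖ξ‖ ^ 2 / ‖ξ‖ ^ n
      * ((1 - (‖x‖ / ‖ξ‖) ^ 2) / (‖ξ - x‖ / ‖ξ‖) ^ n - 1 / ((‖x‖ / ‖ξ‖) ^ 2 + 1) ^ n) := by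
    have e1 : (‖x‖ / ‖ξ‖) ^ 2 + 1 = (‖x‖ ^ 2 + ‖ξ‖ ^ 2) / ‖ξ‖ ^ 2 := by field_simp
    have e2 : 1 - (‖x‖ / ‖ξ‖) ^ 2 = (‖ξ‖ ^ 2 - ‖x‖ ^ 2) / ‖ξ‖ ^ 2 := by field_simp
    have hN : 0 < ‖x‖ ^ 2 + ‖ξ‖ ^ 2 := by positivity
    rw [pois, profile, e1, e2, div_pow, div_pow _ (‖ξ‖ ^ 2)]
    generalize ‖x‖ ^ 2 + ‖ξ‖ ^ 2 = N at hN ⊢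
    have h1 : (‖ξ‖ ^ 2) ^ n = ‖ξ‖ ^ n * ‖ξ‖ ^ n := by rw [← pow_mul, mul_comm, pow_mul, sq]
    rw [h1, pow_add]
    have h2 : ‖ξ‖ ^ n ≠ 0 := by positivity
    have h3 : ‖ξ - x‖ ^ n ≠ 0 := by positivity
    have h4 : N ^ n ≠ 0 := by positivity
    field_simp
  rw [e, abs_mul, abs_of_nonneg (by positivity : 0 ≤ ‖ξ‖ ^ 2 / ‖ξ‖ ^ n)]
  have hK : 0 ≤ profileConst n := by unfold profileConst; positivity
  have hle : ‖ξ‖ / ‖ξ‖ ^ n ≤ 2 ^ n * wsing (x - ξ) := by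
    obtain ⟨m, rfl⟩ : ∃ m, n = m + 1 := ⟨n - 1, by omega⟩
    rw [Nat.add_sub_cancel] at hw
    have h1 : ‖ξ‖ / ‖ξ‖ ^ (m + 1) = 2 ^ m * ((2 * ‖ξ‖) ^ m)⁻¹ := by
      rw [pow_succ, mul_pow]
      field_simp
    have h2 : ((2 * ‖ξ‖) ^ m)⁻¹ ≤ ((‖x‖ + ‖ξ‖) ^ m)⁻¹ := by
      gcongr
      linarith [norm_nonneg x]
    rw [h1]
    have h3 := h2.trans hw
    have h4 : (2 : ℝ) ^ m ≤ 2 ^ (m + 1) := pow_le_pow_right₀ one_le_two (by omega)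
    exact mul_le_mul h4 h3 (by positivity) (by positivity)
  calc ‖ξ‖ ^ 2 / ‖ξ‖ ^ n * _ ≤ ‖ξ‖ ^ 2 / ‖ξ‖ ^ n * (profileConst n * (‖x‖ / ‖ξ‖)) := by
        gcongr
        exact hk
    _ = profileConst n * ‖x‖ * (‖ξ‖ / ‖ξ‖ ^ n) := by field_simp
    _ ≤ profileConst n * ‖x‖ * (2 ^ n * wsing (x - ξ)) := by gcongr
    _ = _ := by ring

theorem exists_bound_sym {a : ℝ → ℝ} (ha : Continuous a) (r : ℝ) :
    ∃ C, 0 ≤ C ∧ ∀ s, |s| ≤ r ^ 2 → |a s| ≤ C := by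
  obtain ⟨C, hC⟩ := isCompact_Icc.exists_bound_of_continuousOn
    (s := Icc (-(r ^ 2)) (r ^ 2)) ha.continuousOn
  refine ⟨C, (norm_nonneg _).trans (hC 0 ⟨by simp; positivity, by positivity⟩), fun s hs => ?_⟩
  exact hC s (abs_le.1 hs)

theorem abs_sq_sub_sq_le {s t r : ℝ} (hs : 0 ≤ s) (ht : 0 ≤ t) (hsr : s ≤ r) (htr : t ≤ r) :
    |s ^ 2 - t ^ 2| ≤ r ^ 2 := by
  rw [abs_le]
  constructor <;> nlinarith

/-- The part of the observer kernel that vanishes at the origin. -/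
noncomputable def coneKer (a : ℝ → ℝ) (x ξ : E n) : ℝ :=
  if x = ξ then 0 else vker a ξ x - smoothKer a x ξ

/-- The constant in the bound of `coneKer`. -/
noncomputable def coneConst (n : ℕ) (C : ℝ) : ℝ :=
  C / sphereArea n * (4 + 3 * 2 ^ n + profileConst n * 2 ^ n)

theorem abs_smoothKer_le (hn : 1 ≤ n) {a : ℝ → ℝ} {C : ℝ} {x ξ : E n} (hne : x ≠ ξ)
    (hC : |a (‖ξ‖ ^ 2 - ‖x‖ ^ 2)| ≤ C) :
    |smoothKer a x ξ| ≤ C / sphereArea n * (2 ^ n * ((‖x‖ + ‖ξ‖) * wsing (x - ξ))) := by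
  have hA := sphereArea_pos hn
  rw [smoothKer, abs_div, abs_mul, abs_of_pos hA, abs_of_nonneg (profile_nonneg x ξ),
    div_mul_eq_mul_div]
  have h1 := profile_le hn hne
  have h2 := profile_nonneg x ξ
  have h3 := (abs_nonneg _).trans hC
  gcongr

/-- If `|ξ| ≤ 2 |x|`, each of the two kernels is bounded by a multiple of `|x| |x - ξ|^(1-n)` on its
own. If `|ξ| > 2 |x|`, they share the density factor, and the cancellation of `pois ξ x` against
`profile x ξ` gives the factor `|x|`. -/
theorem abs_coneKer_le (hn : 1 ≤ n) {a : ℝ → ℝ} {C r : ℝ} (hC0 : 0 ≤ C)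
    (hC : ∀ s, |s| ≤ r ^ 2 → |a s| ≤ C) {x ξ : E n} (hx : ‖x‖ ≤ r) (hξ : ‖ξ‖ ≤ r) :
    |coneKer a x ξ| ≤ coneConst n C * ‖x‖ * wsing (x - ξ) := by
  have hA := sphereArea_pos hn
  have hw := wsing_nonneg (x - ξ)
  have hK : 0 ≤ profileConst n := by unfold profileConst; positivity
  have hCa := hC _ (abs_sq_sub_sq_le (norm_nonneg ξ) (norm_nonneg x) hξ hx)
  have hxw : 0 ≤ ‖x‖ * wsing (x - ξ) := by positivity
  unfold coneKer coneConst
  split_ifs with hne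
  -- On the diagonal `wsing` is `0` by the convention for division, while `smoothKer` need not
  -- vanish there; prescribing the value `0` makes the bound hold everywhere.
  · rw [abs_zero]
    positivity
  rcases le_or_gt ‖ξ‖ (2 * ‖x‖) with h | h
  · have b1 := abs_vker_le hn hξ
      (fun s hs => hC s (abs_le.2 ⟨by linarith [hs.1, sq_nonneg r], hs.2⟩)) x
    rw [wsing_sub_comm] at b1
    have b2 := abs_smoothKer_le hn hne hCa
    have b3 : ‖ξ‖ * wsing (x - ξ) ≤ 2 * (‖x‖ * wsing (x - ξ)) := by
      rw [← mul_assoc]; gcongr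
    have b4 : (‖x‖ + ‖ξ‖) * wsing (x - ξ) ≤ 3 * (‖x‖ * wsing (x - ξ)) := by
      rw [← mul_assoc]; gcongr; linarith
    calc |vker a ξ x - smoothKer a x ξ| ≤ |vker a ξ x| + |smoothKer a x ξ| := abs_sub _ _
      _ ≤ 2 * C / sphereArea n * (2 * (‖x‖ * wsing (x - ξ)))
          + C / sphereArea n * (2 ^ n * (3 * (‖x‖ * wsing (x - ξ)))) := by
        refine add_le_add (b1.trans ?_) (b2.trans ?_) <;> gcongr
      _ = C / sphereArea n * (4 + 3 * 2 ^ n) * (‖x‖ * wsing (x - ξ)) := by ring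
      _ ≤ C / sphereArea n * (4 + 3 * 2 ^ n + profileConst n * 2 ^ n)
          * (‖x‖ * wsing (x - ξ)) := by
        refine mul_le_mul_of_nonneg_right (mul_le_mul_of_nonneg_left ?_ (by positivity)) hxw
        have : 0 ≤ profileConst n * 2 ^ n := by positivity
        linarith
      _ = _ := by ring
  · have hlt : ‖x‖ < ‖ξ‖ := by linarith [norm_nonneg x]
    have e : vker a ξ x - smoothKer a x ξ
        = a (‖ξ‖ ^ 2 - ‖x‖ ^ 2) / sphereArea n * (pois ξ x - profile x ξ) := by
      rw [vker, if_pos hlt, smoothKer]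
      ring
    rw [e, abs_mul, abs_div, abs_of_pos hA]
    calc |a (‖ξ‖ ^ 2 - ‖x‖ ^ 2)| / sphereArea n * |pois ξ x - profile x ξ|
        ≤ C / sphereArea n * (profileConst n * 2 ^ n * (‖x‖ * wsing (x - ξ))) := by
          gcongr
          exact abs_pois_sub_profile_le hn h
      _ = C / sphereArea n * (profileConst n * 2 ^ n) * (‖x‖ * wsing (x - ξ)) := by ring
      _ ≤ C / sphereArea n * (4 + 3 * 2 ^ n + profileConst n * 2 ^ n)
          * (‖x‖ * wsing (x - ξ)) := by
        refine mul_le_mul_of_nonneg_right (mul_le_mul_of_nonneg_left ?_ (by positivity)) hxw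
        have : (0 : ℝ) ≤ 4 + 3 * 2 ^ n := by positivity
        linarith
      _ = _ := by ring

theorem measurable_profile : Measurable (Function.uncurry (profile : E n → E n → ℝ)) := by
  unfold profile Function.uncurry
  fun_prop

theorem measurable_smoothKer {a : ℝ → ℝ} (ha : Measurable a) :
    Measurable (Function.uncurry (smoothKer a : E n → E n → ℝ)) := by
  have h : Measurable fun q : E n × E n => a (‖q.2‖ ^ 2 - ‖q.1‖ ^ 2) := ha.comp (by fun_prop)
  exact (h.mul measurable_profile).div_const _

theorem measurable_coneKer {a : ℝ → ℝ} (ha : Measurable a) :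
    Measurable (Function.uncurry (coneKer a : E n → E n → ℝ)) := by
  unfold coneKer Function.uncurry
  refine Measurable.ite (measurableSet_eq_fun measurable_fst measurable_snd) measurable_const ?_
  exact ((measurable_vker ha).comp measurable_swap).sub (measurable_smoothKer ha)

theorem coneKer_isometry (a : ℝ → ℝ) (Q : E n ≃ₗᵢ[ℝ] E n) (x ξ : E n) :
    coneKer a (Q x) (Q ξ) = coneKer a x ξ := by
  simp only [coneKer, smoothKer, profile, vker_isometry, Q.norm_map, Q.injective.eq_iff]

theorem hasDerivAt_smoothKer_smul {a : ℝ → ℝ} (ha : ContDiff ℝ 1 a) (x ξ : E n) {s : ℝ}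
    (hs : 0 < s) :
    HasDerivAt (fun s : ℝ => smoothKer a (s • x) (s • ξ))
      (s⁻¹ * smoothKer (euDens n a) (s • x) (s • ξ)) s := by
  have e : ∀ (b : ℝ → ℝ) (u : ℝ), 0 < u → smoothKer b (u • x) (u • ξ)
      = b (u ^ 2 * (‖ξ‖ ^ 2 - ‖x‖ ^ 2)) * (u ^ 2 / u ^ n * (profile x ξ / sphereArea n)) := by
    intro b u hu
    have h1 : (u * ‖ξ‖) ^ 2 - (u * ‖x‖) ^ 2 = u ^ 2 * (‖ξ‖ ^ 2 - ‖x‖ ^ 2) := by ring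
    have h2 : (u * ‖x‖) ^ 2 + (u * ‖ξ‖) ^ 2 = u ^ 2 * (‖x‖ ^ 2 + ‖ξ‖ ^ 2) := by ring
    have h3 : (u * ‖ξ‖) ^ (n + 2) / (u ^ 2 * (‖x‖ ^ 2 + ‖ξ‖ ^ 2)) ^ n
        = u ^ 2 / u ^ n * (‖ξ‖ ^ (n + 2) / (‖x‖ ^ 2 + ‖ξ‖ ^ 2) ^ n) := by
      rw [div_mul_div_comm, mul_pow, mul_pow, ← pow_mul]
      have h4 : u ^ n ≠ 0 := by positivity
      have h5 : u ^ (2 * n) = u ^ n * u ^ n := by rw [mul_comm, pow_mul, sq]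
      rw [h5, pow_add u, mul_assoc, mul_assoc, mul_div_mul_left _ _ h4]
    simp only [smoothKer, profile, norm_smul, Real.norm_of_nonneg hu.le]
    rw [h1, h2, h3]
    ring
  rw [e _ s hs]
  refine (hasDerivAt_density_smul ha _ _ hs).congr_of_eventuallyEq ?_
  filter_upwards [Ioi_mem_nhds hs] with u hu using e a u hu

theorem hasDerivAt_coneKer_smul {a : ℝ → ℝ} (ha : ContDiff ℝ 1 a) {x ξ : E n} (hne : x ≠ ξ)
    {s : ℝ} (hs : 0 < s) :
    HasDerivAt (fun s : ℝ => coneKer a (s • x) (s • ξ))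
      (s⁻¹ * coneKer (euDens n a) (s • x) (s • ξ)) s := by
  have e : ∀ (b : ℝ → ℝ) (u : ℝ), 0 < u → coneKer b (u • x) (u • ξ)
      = vker b (u • ξ) (u • x) - smoothKer b (u • x) (u • ξ) := fun b u hu => by
    rw [coneKer, if_neg]
    exact fun h => hne (smul_right_injective _ hu.ne' h)
  rw [e _ s hs, mul_sub]
  refine ((hasDerivAt_vker_smul ha ξ x hs).sub
    (hasDerivAt_smoothKer_smul ha x ξ hs)).congr_of_eventuallyEq ?_
  filter_upwards [Ioi_mem_nhds hs] with u hu using e a u hu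

/-! ### The boundary trace of the observer kernel -/

theorem ae_norm_lt (hn : 1 ≤ n) (R : ℝ) : ∀ᵐ x ∂(ballMeasure n R), ‖x‖ < R := by
  have := nontrivial_E hn
  have h : ∀ᵐ x : E n, x ∉ sphere (0 : E n) R :=
    measure_eq_zero_iff_ae_notMem.1 (Measure.addHaar_sphere volume 0 R)
  filter_upwards [ae_mem_ball (n := n) R, ae_restrict_of_ae h] with x h1 h2
  refine lt_of_le_of_ne h1 fun h3 => h2 ?_
  simpa using h3

theorem norm_radial {R : ℝ} (hR : 0 ≤ R) {ξ : E n} (hξ : ξ ≠ 0) : ‖(R / ‖ξ‖) • ξ‖ = R := by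
  rw [norm_smul, norm_div, norm_norm, Real.norm_of_nonneg hR,
    div_mul_cancel₀ _ (norm_ne_zero_iff.2 hξ)]

theorem lintegral_sphere_pois_le (hn : 1 ≤ n) {R : ℝ} (hR : 0 < R) {x : E n} (hx : ‖x‖ < R) :
    ∫⁻ θ : sphere (0 : E n) 1, ‖pois (R • (θ : E n)) x‖ₑ ∂(surf n)
      ≤ ENNReal.ofReal (R ^ 2 / R ^ n * sphereArea n) := by
  have hx1 : ‖R⁻¹ • x‖ < 1 := by
    rw [norm_smul, norm_inv, Real.norm_of_nonneg hR.le, inv_mul_lt_iff₀ hR, mul_one]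
    exact hx
  have hnn : ∀ θ : sphere (0 : E n) 1, 0 ≤ pois (θ : E n) (R⁻¹ • x) := fun θ =>
    pois_nonneg (by rw [norm_eq_of_mem_sphere]; exact hx1.le)
  have e : ∀ θ : sphere (0 : E n) 1, pois (R • (θ : E n)) x
      = R ^ 2 / R ^ n * pois (θ : E n) (R⁻¹ • x) := fun θ => by
    rw [← pois_smul hR, smul_smul, mul_inv_cancel₀ hR.ne', one_smul]
  have hi := integral_sphere_pois hn hx1
  have hInt : Integrable (fun θ : sphere (0 : E n) 1 => pois (θ : E n) (R⁻¹ • x)) (surf n) := by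
    by_contra h
    rw [integral_undef h] at hi
    exact (sphereArea_pos hn).ne hi
  rw [← hi, ← integral_const_mul, ofReal_integral_eq_lintegral_ofReal (hInt.const_mul _)
    (ae_of_all _ fun θ => mul_nonneg (by positivity) (hnn θ))]
  refine lintegral_mono fun θ => ?_
  simp only [e]
  rw [Real.enorm_of_nonneg (mul_nonneg (by positivity) (hnn θ))]

/-- The Poisson kernel of the sphere of radius `R`, extended radially, defines a bounded
operator. -/
theorem exists_isSchur_pois_trace (hn : 1 ≤ n) {R : ℝ} (hR : 0 < R) :
    ∃ C, IsSchur (ballMeasure n R) (fun x ξ => pois ((R / ‖ξ‖) • ξ) x) C := by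
  have hm : Measurable (Function.uncurry fun x ξ : E n => pois ((R / ‖ξ‖) • ξ) x) := by
    unfold pois Function.uncurry
    fun_prop
  -- The weak-singularity estimate is not available for rows, since only the direction of `ξ` varies
  -- the singular point. The exact total mass of the Poisson kernel takes its place, uniformly up to
  -- the boundary.
  have hrow : ∀ x : E n, ‖x‖ < R → ∫⁻ ξ in B n R, ‖pois ((R / ‖ξ‖) • ξ) x‖ₑ
      ≤ radialMass n R * ENNReal.ofReal (R ^ 2 / R ^ n * sphereArea n) := by
    intro x hx
    have h1 : Measurable fun y : E n => pois (R • y) x := by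
      unfold pois
      fun_prop
    have h2 := lintegral_ball_radial hn R (fun y : E n => ‖pois (R • y) x‖ₑ) h1.enorm
    simp only [smul_smul, ← div_eq_mul_inv] at h2
    rw [h2]
    gcongr
    exact lintegral_sphere_pois_le hn hR hx
  have hcol : ∀ ξ : E n, ∫⁻ x in B n R, ‖pois ((R / ‖ξ‖) • ξ) x‖ₑ
      ≤ ENNReal.ofReal (2 * R) * wConst n R := by
    intro ξ
    have hy := norm_radial_le hR.le ξ
    set y := (R / ‖ξ‖) • ξ
    calc ∫⁻ x in B n R, ‖pois y x‖ₑ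
        ≤ ∫⁻ x in B n R, ENNReal.ofReal (2 * R) * ‖wsing (y - x)‖ₑ := by
          refine setLIntegral_mono' measurableSet_closedBall fun x hx => ?_
          have hx' : ‖x‖ ≤ R := by simpa using hx
          rw [← Real.enorm_of_nonneg (by positivity : 0 ≤ 2 * R), ← enorm_mul]
          refine enorm_le_iff_norm_le.2 ?_
          rw [Real.norm_eq_abs, Real.norm_eq_abs,
            abs_of_nonneg (mul_nonneg (by positivity : 0 ≤ 2 * R) (wsing_nonneg (y - x)))]
          refine (abs_pois_le y x).trans ?_
          have := wsing_nonneg (y - x)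
          gcongr
          linarith
      _ = ENNReal.ofReal (2 * R) * ∫⁻ x in B n R, ‖wsing (y - x)‖ₑ :=
          lintegral_const_mul' _ _ ENNReal.ofReal_ne_top
      _ ≤ _ := by
          gcongr
          exact lintegral_wsing_sub_le hn hy
  have hfin1 : radialMass n R * ENNReal.ofReal (R ^ 2 / R ^ n * sphereArea n) ≠ ⊤ :=
    ENNReal.mul_ne_top (radialMass_lt_top n R).ne (by simp)
  have hfin2 : ENNReal.ofReal (2 * R) * wConst n R ≠ ⊤ := ENNReal.mul_ne_top ENNReal.ofReal_ne_top (by simp)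
  refine ⟨(radialMass n R * ENNReal.ofReal (R ^ 2 / R ^ n * sphereArea n)).toNNReal
    + (ENNReal.ofReal (2 * R) * wConst n R).toNNReal, hm, ?_, ?_⟩
  · filter_upwards [ae_norm_lt hn R] with x hx
    rw [ENNReal.coe_add, ENNReal.coe_toNNReal hfin1, ENNReal.coe_toNNReal hfin2]
    exact (hrow x hx).trans le_self_add
  · refine ae_of_all _ fun ξ => ?_
    rw [ENNReal.coe_add, ENNReal.coe_toNNReal hfin1, ENNReal.coe_toNNReal hfin2]
    exact (hcol ξ).trans le_add_self

theorem isSchur_one (R : ℝ) :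
    IsSchur (ballMeasure n R) (fun _ _ => (1 : ℝ)) (volume (B n R)).toNNReal := by
  have h : (volume (B n R)) ≠ ⊤ := measure_closedBall_lt_top.ne
  refine ⟨measurable_const, ae_of_all _ fun x => ?_, ae_of_all _ fun x => ?_⟩ <;>
    simp [ENNReal.coe_toNNReal h]

/-- Near the origin the boundary is far away and the first-order zero of the kernel suffices. For
`|x| > R / 2` the weight `|x|⁻¹` is bounded, and the kernel is a bounded term plus a multiple of the
Poisson kernel. -/
theorem abs_coneKer_trace_le (hn : 1 ≤ n) {R : ℝ} (hR : 0 < R) {a : ℝ → ℝ} {C : ℝ} (hC0 : 0 ≤ C)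
    (hC : ∀ s, |s| ≤ (2 * R) ^ 2 → |a s| ≤ C) :
    ∃ c, ∀ x ξ : E n, ‖x‖ < R → ξ ≠ 0 →
      |‖x‖ * trker R (dkern (coneKer a)) x ξ| ≤ c * |1 + pois ((R / ‖ξ‖) • ξ) x| := by
  have hA := sphereArea_pos hn
  have hA' : 0 ≤ C / sphereArea n := by positivity
  set c1 := coneConst n C * ((R / 2) ^ (n - 1))⁻¹ with hc1
  set c2 := C / sphereArea n * (R ^ (n + 2) / ((R / 2) ^ 2) ^ n) with hc2
  have hcone : 0 ≤ coneConst n C := by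
    unfold coneConst profileConst
    positivity
  have hc10 : 0 ≤ c1 := by positivity
  have hc20 : 0 ≤ c2 := by positivity
  refine ⟨c1 + 2 / R * (C / sphereArea n + c2), fun x ξ hx hξ => ?_⟩
  have hy := norm_radial hR.le hξ
  set y := (R / ‖ξ‖) • ξ with hydef
  have hp : 0 ≤ pois y x := pois_nonneg (by rw [hy]; exact hx.le)
  rw [abs_of_nonneg (by positivity : 0 ≤ 1 + pois y x)]
  have hne : x ≠ y := by
    rintro h
    rw [h, hy] at hx
    exact lt_irrefl _ hx
  rw [show trker R (dkern (coneKer a)) x ξ = dkern (coneKer a) x y from rfl]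
  rcases le_or_gt ‖x‖ (R / 2) with hx2 | hx2
  · have b1 : |coneKer a x y| ≤ coneConst n C * ‖x‖ * wsing (x - y) :=
      abs_coneKer_le hn hC0 hC (by linarith) (by linarith)
    have b2 := abs_dkern_le hcone b1
    have b3 : wsing (x - y) ≤ ((R / 2) ^ (n - 1))⁻¹ := by
      rw [wsing_eq_inv hn (sub_ne_zero.2 hne)]
      gcongr
      have := norm_sub_norm_le y x
      rw [norm_sub_rev]
      linarith
    rw [abs_mul, abs_norm, mul_comm]
    calc |dkern (coneKer a) x y| * ‖x‖ ≤ coneConst n C * wsing (x - y) := b2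
      _ ≤ c1 := by rw [hc1]; gcongr
      _ ≤ (c1 + 2 / R * (C / sphereArea n + c2)) * 1 := by
        have : 0 ≤ 2 / R * (C / sphereArea n + c2) := by positivity
        linarith
      _ ≤ _ := by
        gcongr
        linarith
  · have hx0 : 0 < ‖x‖ := by linarith
    have hCa : |a (‖y‖ ^ 2 - ‖x‖ ^ 2)| ≤ C :=
      hC _ (abs_sq_sub_sq_le (norm_nonneg _) (norm_nonneg _) (by linarith) (by linarith))
    have b1 : |vker a y x| ≤ C / sphereArea n * pois y x := by
      rw [vker, if_pos (by rw [hy]; exact hx), abs_div, abs_mul, abs_of_pos hA, abs_of_nonneg hp,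
        div_mul_eq_mul_div]
      gcongr
    have b2 : |smoothKer a x y| ≤ c2 := by
      rw [smoothKer, abs_div, abs_mul, abs_of_pos hA, abs_of_nonneg (profile_nonneg x y), hc2,
        div_mul_eq_mul_div]
      have h3 : profile x y ≤ R ^ (n + 2) / ((R / 2) ^ 2) ^ n := by
        rw [profile, hy]
        gcongr
        have : (R / 2) ^ 2 ≤ ‖x‖ ^ 2 := by gcongr
        nlinarith
      have h4 := profile_nonneg x y
      gcongr
    have b3 : |coneKer a x y| ≤ (C / sphereArea n + c2) * (1 + pois y x) := by
      rw [coneKer, if_neg hne]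
      refine (abs_sub _ _).trans ((add_le_add b1 b2).trans ?_)
      nlinarith [mul_nonneg hc20 hp]
    have b4 : ‖x‖⁻¹ ≤ 2 / R := by
      rw [← inv_div]
      gcongr
    rw [dkern, abs_mul, abs_mul, abs_norm, abs_of_pos (a := (‖x‖ ^ 2)⁻¹) (by positivity)]
    calc ‖x‖ * ((‖x‖ ^ 2)⁻¹ * |coneKer a x y|) = ‖x‖⁻¹ * |coneKer a x y| := by field_simp
      _ ≤ 2 / R * ((C / sphereArea n + c2) * (1 + pois y x)) := by gcongr
      _ = 2 / R * (C / sphereArea n + c2) * (1 + pois y x) := by ring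
      _ ≤ _ := by
        gcongr
        linarith

theorem isH1Bounded_coneKer (hn : 1 ≤ n) {R : ℝ} (hR : 0 < R) {a : ℝ → ℝ} (ha : ContDiff ℝ 1 a) :
    (∃ C, IsSchur (ballMeasure n R) (coneKer a) C) ∧ IsH1Bounded (n := n) R (coneKer a) := by
  have hb := continuous_euDens (n := n) ha
  have hA := sphereArea_pos hn
  obtain ⟨C1, hC1, hC1'⟩ := exists_bound_sym ha.continuous (2 * R)
  obtain ⟨C2, hC2, hC2'⟩ := exists_bound_sym hb (2 * R)
  have m1 : Measurable (Function.uncurry (coneKer a : E n → E n → ℝ)) :=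
    measurable_coneKer ha.continuous.measurable
  have m2 : Measurable (Function.uncurry (coneKer (euDens n a) : E n → E n → ℝ)) :=
    measurable_coneKer hb.measurable
  obtain ⟨c, hc⟩ := abs_coneKer_trace_le hn hR hC1 hC1'
  obtain ⟨C3, hC3⟩ := exists_isSchur_pois_trace hn hR
  have hsch := ((isSchur_one (n := n) R).add hC3).of_abs_le
    ((measurable_norm.comp measurable_fst).mul (measurable_trker (R := R) (measurable_dkern m1)))
    c.toNNReal (l := fun x ξ => ‖x‖ * trker R (dkern (coneKer a)) x ξ)
    (by
      filter_upwards [ae_norm_lt hn R] with x hx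
      filter_upwards [ae_ne_ball hn R 0] with ξ hξ
      refine (hc x ξ hx hξ).trans ?_
      gcongr
      exact Real.le_coe_toNNReal c)
    (by
      filter_upwards [ae_ne_ball hn R 0] with ξ hξ
      filter_upwards [ae_norm_lt hn R] with x hx
      refine (hc x ξ hx hξ).trans ?_
      gcongr
      exact Real.le_coe_toNNReal c)
  have H : IsConeKernel (n := n) R (coneConst n (C1 + C2))
      (c.toNNReal * ((volume (B n R)).toNNReal + C3)) (coneKer a)
      (coneKer (euDens n a)) := by
    refine ⟨m1, m2, by unfold coneConst profileConst; positivity, coneKer_isometry a,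
      fun x ξ hne _ s hs => hasDerivAt_coneKer_smul ha hne hs, fun x ξ hx hξ => ?_,
      fun x ξ hx hξ => ?_, hsch⟩
    · exact abs_coneKer_le hn (by positivity) (fun s hs => (hC1' s hs).trans (by linarith)) hx hξ
    · exact abs_coneKer_le hn (by positivity) (fun s hs => (hC2' s hs).trans (by linarith)) hx hξ
  exact ⟨H.exists_isSchur hn hR, H.isH1Bounded hn hR⟩

/-! ### The smooth part of the observer kernel -/

/-- The partial derivative of `smoothKer` in the `j`-th coordinate of `x`. -/
noncomputable def smoothKerGrad (a : ℝ → ℝ) (j : Fin n) (x ξ : E n) : ℝ :=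
  -(2 * x j) * (deriv a (‖ξ‖ ^ 2 - ‖x‖ ^ 2) * profile x ξ
    + n * a (‖ξ‖ ^ 2 - ‖x‖ ^ 2) * (profile x ξ / (‖x‖ ^ 2 + ‖ξ‖ ^ 2))) / sphereArea n

theorem measurable_smoothKerGrad {a : ℝ → ℝ} (ha : ContDiff ℝ 1 a) (j : Fin n) :
    Measurable (Function.uncurry (smoothKerGrad a j)) := by
  have h0 : Measurable fun q : E n × E n => ‖q.2‖ ^ 2 - ‖q.1‖ ^ 2 := by fun_prop
  have h1 : Measurable fun q : E n × E n => a (‖q.2‖ ^ 2 - ‖q.1‖ ^ 2) :=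
    ha.continuous.measurable.comp h0
  have h2 : Measurable fun q : E n × E n => deriv a (‖q.2‖ ^ 2 - ‖q.1‖ ^ 2) :=
    (ha.continuous_deriv le_rfl).measurable.comp h0
  have h3 : Measurable fun q : E n × E n => -(2 * q.1 j) := by fun_prop
  have h4 : Measurable fun q : E n × E n => ‖q.1‖ ^ 2 + ‖q.2‖ ^ 2 := by fun_prop
  exact (h3.mul ((h2.mul measurable_profile).add
    ((h1.const_mul _).mul (measurable_profile.div h4)))).div_const _

theorem hasFDerivAt_smoothKer {a : ℝ → ℝ} (ha : ContDiff ℝ 1 a) {ξ : E n} (hξ : ξ ≠ 0)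
    (x : E n) : ∃ L : E n →L[ℝ] ℝ, HasFDerivAt (fun x => smoothKer a x ξ) L x ∧
      ∀ j, L (ev j) = smoothKerGrad a j x ξ := by
  have hρ : 0 < ‖ξ‖ := norm_pos_iff.2 hξ
  have hN : 0 < ‖x‖ ^ 2 + ‖ξ‖ ^ 2 := by positivity
  have d1 : HasDerivAt (fun t : ℝ => a (‖ξ‖ ^ 2 - t))
      (deriv a (‖ξ‖ ^ 2 - ‖x‖ ^ 2) * -1) (‖x‖ ^ 2) :=
    ((ha.differentiable one_ne_zero) _).hasDerivAt.comp _
      ((hasDerivAt_id _).const_sub (‖ξ‖ ^ 2))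
  have d2 : HasDerivAt (fun t : ℝ => (t + ‖ξ‖ ^ 2) ^ n)
      (n * (‖x‖ ^ 2 + ‖ξ‖ ^ 2) ^ (n - 1) * 1) (‖x‖ ^ 2) :=
    ((hasDerivAt_id _).add_const (‖ξ‖ ^ 2)).pow n
  have d3 := (d1.mul ((d2.fun_inv (by positivity)).const_mul (‖ξ‖ ^ (n + 2)))).div_const
    (sphereArea n)
  have d4 := d3.comp_hasFDerivAt x (hasStrictFDerivAt_norm_sq x).hasFDerivAt
  refine ⟨_, d4.congr_of_eventuallyEq (Eventually.of_forall fun y => ?_), fun j => ?_⟩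
  · simp only [smoothKer, profile, Function.comp, Pi.mul_apply]
    ring
  · have e : (n : ℝ) * (‖x‖ ^ 2 + ‖ξ‖ ^ 2) ^ (n - 1)
        = n * (‖x‖ ^ 2 + ‖ξ‖ ^ 2) ^ n / (‖x‖ ^ 2 + ‖ξ‖ ^ 2) := by
      rcases n with _ | m
      · simp
      · rw [Nat.add_sub_cancel, pow_succ _ m, ← mul_assoc, mul_div_cancel_right₀ _ hN.ne']
    simp only [e, smoothKerGrad, profile, smul_apply, innerSL_apply_apply,
      inner_ev_right, smul_eq_mul, nsmul_eq_mul]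
    generalize ‖x‖ ^ 2 + ‖ξ‖ ^ 2 = N at hN ⊢
    have : N ^ n ≠ 0 := by positivity
    field_simp
    push_cast
    ring

theorem continuous_smoothKer {a : ℝ → ℝ} (ha : ContDiff ℝ 1 a) {ξ : E n} (hξ : ξ ≠ 0) :
    Continuous fun x => smoothKer a x ξ := by
  have hf : Differentiable ℝ fun x => smoothKer a x ξ := fun x => by
    obtain ⟨L, hL, -⟩ := hasFDerivAt_smoothKer ha hξ x
    exact hL.differentiableAt
  exact hf.continuous

theorem continuous_smoothKerGrad {a : ℝ → ℝ} (ha : ContDiff ℝ 1 a) (j : Fin n) {ξ : E n}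
    (hξ : ξ ≠ 0) : Continuous fun x => smoothKerGrad a j x ξ := by
  have hρ : 0 < ‖ξ‖ := norm_pos_iff.2 hξ
  have hN : Continuous fun x : E n => ‖x‖ ^ 2 + ‖ξ‖ ^ 2 := by fun_prop
  have hN0 : ∀ x : E n, ‖x‖ ^ 2 + ‖ξ‖ ^ 2 ≠ 0 := fun x => by positivity
  have hp : Continuous fun x : E n => profile x ξ :=
    continuous_const.div (hN.pow n) fun x => pow_ne_zero _ (hN0 x)
  have h0 : Continuous fun x : E n => ‖ξ‖ ^ 2 - ‖x‖ ^ 2 := by fun_prop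
  have h1 := ha.continuous.comp h0
  have h2 := (ha.continuous_deriv le_rfl).comp h0
  have h3 : Continuous fun x : E n => -(2 * x j) := by fun_prop
  exact (h3.mul ((h2.mul hp).add ((continuous_const.mul h1).mul (hp.div hN hN0)))).div_const _

/-- With `S = |x| + |ξ|`, the coordinate and the profile supply `S · S |x - ξ|^(1-n)`, and
differentiating the denominator of the profile costs at most `2 S⁻²`. The result is again of order
`|x - ξ|^(1-n)`. -/
theorem abs_smoothKerGrad_le (hn : 1 ≤ n) {R : ℝ} {a : ℝ → ℝ} {C C' : ℝ} (hC0 : 0 ≤ C)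
    (hC0' : 0 ≤ C') (hC : ∀ s, |s| ≤ R ^ 2 → |a s| ≤ C)
    (hC' : ∀ s, |s| ≤ R ^ 2 → |deriv a s| ≤ C') (j : Fin n)
    {x ξ : E n} (hx : ‖x‖ ≤ R) (hξ : ‖ξ‖ ≤ R) (hne : x ≠ ξ) :
    |smoothKerGrad a j x ξ|
      ≤ (2 * 2 ^ n * C' * (2 * R) ^ 2 + 4 * n * 2 ^ n * C) / sphereArea n * wsing (x - ξ) := by
  have hA := sphereArea_pos hn
  have hS := add_norm_pos hne
  have hw := wsing_nonneg (x - ξ)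
  have hp := profile_le hn hne
  have hp0 := profile_nonneg x ξ
  have hs := abs_sq_sub_sq_le (norm_nonneg ξ) (norm_nonneg x) hξ hx
  have h1 := hC _ hs
  have h2 := hC' _ hs
  have h3 : |x j| ≤ ‖x‖ + ‖ξ‖ := (abs_coord_le x j).trans (by simp)
  have h4 := sq_add_sq_ge ‖x‖ ‖ξ‖
  have hSR : ‖x‖ + ‖ξ‖ ≤ 2 * R := by linarith
  have hN : 0 < ‖x‖ ^ 2 + ‖ξ‖ ^ 2 := lt_of_lt_of_le (by positivity) h4
  set S := ‖x‖ + ‖ξ‖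
  have h5 : profile x ξ / (‖x‖ ^ 2 + ‖ξ‖ ^ 2) ≤ 2 ^ n * (S * wsing (x - ξ)) / (S ^ 2 / 2) := by
    gcongr
  have h6 : 0 ≤ profile x ξ / (‖x‖ ^ 2 + ‖ξ‖ ^ 2) := by positivity
  rw [smoothKerGrad, abs_div, abs_of_pos hA, div_mul_eq_mul_div, abs_mul, abs_neg, abs_mul,
    abs_of_pos (zero_lt_two' ℝ)]
  refine div_le_div_of_nonneg_right ?_ hA.le
  have h7 : |deriv a (‖ξ‖ ^ 2 - ‖x‖ ^ 2) * profile x ξ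
      + n * a (‖ξ‖ ^ 2 - ‖x‖ ^ 2) * (profile x ξ / (‖x‖ ^ 2 + ‖ξ‖ ^ 2))|
      ≤ C' * (2 ^ n * (S * wsing (x - ξ)))
        + n * C * (2 ^ n * (S * wsing (x - ξ)) / (S ^ 2 / 2)) := by
    refine (abs_add_le _ _).trans (add_le_add ?_ ?_)
    · rw [abs_mul, abs_of_nonneg hp0]
      gcongr
    · rw [abs_mul, abs_mul, Nat.abs_cast, abs_of_nonneg h6]
      gcongr
  calc 2 * |x j| * _ ≤ 2 * S * (C' * (2 ^ n * (S * wsing (x - ξ)))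
        + n * C * (2 ^ n * (S * wsing (x - ξ)) / (S ^ 2 / 2))) := by gcongr
    _ = (2 * 2 ^ n * C' * S ^ 2 + 4 * n * 2 ^ n * C) * wsing (x - ξ) := by
        field_simp
        ring
    _ ≤ _ := by gcongr

theorem exists_isSchur_of_wsing_le (hn : 1 ≤ n) {R c : ℝ} {l : E n → E n → ℝ}
    (hl : Measurable (Function.uncurry l))
    (hle : ∀ x ξ : E n, ‖x‖ ≤ R → ‖ξ‖ ≤ R → x ≠ ξ → |l x ξ| ≤ c * wsing (x - ξ)) :
    ∃ C, IsSchur (ballMeasure n R) l C := by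
  have hle' : ∀ x ξ : E n, ‖x‖ ≤ R → ‖ξ‖ ≤ R → x ≠ ξ →
      |l x ξ| ≤ c.toNNReal * |wsing (x - ξ)| := fun x ξ hx hξ hne => by
    rw [abs_of_nonneg (wsing_nonneg _)]
    refine (hle x ξ hx hξ hne).trans ?_
    have := wsing_nonneg (x - ξ)
    gcongr
    exact Real.le_coe_toNNReal c
  refine ⟨_, (isSchur_wsing hn R).of_abs_le hl c.toNNReal ?_ ?_⟩
  · filter_upwards [ae_mem_ball (n := n) R] with x hx
    filter_upwards [ae_mem_ball (n := n) R, ae_ne_ball hn R x] with ξ hξ hne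
      using hle' x ξ hx hξ hne.symm
  · filter_upwards [ae_mem_ball (n := n) R] with ξ hξ
    filter_upwards [ae_mem_ball (n := n) R, ae_ne_ball hn R ξ] with x hx hne
      using hle' x ξ hx hξ hne

theorem exists_isSchur_smoothKer (hn : 1 ≤ n) (R : ℝ) {a : ℝ → ℝ} (ha : Continuous a) :
    ∃ C, IsSchur (ballMeasure n R) (smoothKer a) C := by
  obtain ⟨C, hC0, hC⟩ := exists_bound_sym ha R
  have hA := sphereArea_pos hn
  refine exists_isSchur_of_wsing_le hn (c := C / sphereArea n * (2 ^ n * (2 * R)))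
    (measurable_smoothKer ha.measurable) fun x ξ hx hξ hne => ?_
  refine (abs_smoothKer_le hn hne
    (hC _ (abs_sq_sub_sq_le (norm_nonneg ξ) (norm_nonneg x) hξ hx))).trans ?_
  have hw := wsing_nonneg (x - ξ)
  calc C / sphereArea n * (2 ^ n * ((‖x‖ + ‖ξ‖) * wsing (x - ξ)))
      ≤ C / sphereArea n * (2 ^ n * ((2 * R) * wsing (x - ξ))) := by
        gcongr
        linarith
    _ = _ := by ring

theorem setIntegral_mul_of_tsupport {R : ℝ} (u : E n → ℝ) {g : E n → ℝ}
    (hg : ∀ x, R < ‖x‖ → g x = 0) : ∫ x in B n R, u x * g x = ∫ x, u x * g x := by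
  rw [setIntegral_eq_integral_of_forall_compl_eq_zero]
  intro x hx
  rw [hg x (by simpa using hx), mul_zero]

/-- After exchanging the integrations, one integrates by parts in `x` for each fixed `ξ ≠ 0`, where
the kernel is differentiable. No derivative reaches `f`, so the second family of kernels is zero. -/
theorem hasGradKernels_smoothKer (hn : 1 ≤ n) (R : ℝ) {a : ℝ → ℝ} (ha : ContDiff ℝ 1 a) :
    HasGradKernels (n := n) R (smoothKer a) (smoothKerGrad a) (fun _ _ _ _ => 0) := by
  obtain ⟨C, hC0, hC⟩ := exists_bound_sym ha.continuous R
  obtain ⟨C', hC0', hC'⟩ := exists_bound_sym (ha.continuous_deriv le_rfl) R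
  have hs0 : ∀ j : Fin n, ∃ D, IsSchur (ballMeasure n R) (smoothKerGrad a j) D := fun j =>
    exists_isSchur_of_wsing_le hn (measurable_smoothKerGrad ha j) fun x ξ hx hξ hne =>
      abs_smoothKerGrad_le hn hC0 hC0' hC hC' j hx hξ hne
  have hs := exists_isSchur_smoothKer (n := n) hn R ha.continuous
  refine ⟨hs, hs0, fun _ _ => ⟨0, measurable_const, by simp, by simp⟩, ?_⟩
  intro f η hf hη hηc hηs j
  obtain ⟨D, hD⟩ := hs
  obtain ⟨D₀, hD₀⟩ := hs0 j
  have mη : MemLp η 2 (ballMeasure n R) := memLp_ball_of_continuous hη.continuous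
  have hdη : Continuous fun x => fderiv ℝ η x (ev j) :=
    (hη.continuous_fderiv (by simp)).clm_apply continuous_const
  have mdη : MemLp (fun x => fderiv ℝ η x (ev j)) 2 (ballMeasure n R) :=
    memLp_ball_of_continuous hdη
  have mf : MemLp f 2 (ballMeasure n R) := memLp_ball_of_continuous hf.continuous
  have hz : ∀ x : E n, R < ‖x‖ → x ∉ tsupport η := fun x hx h => by
    have := hηs h
    rw [mem_ball_zero_iff] at this
    linarith
  have hkop0 : ∀ g : E n → ℝ, kop (ballMeasure n R) (fun _ _ => (0 : ℝ)) g = 0 := fun g => by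
    ext x
    simp [kop]
  simp only [hkop0, Pi.zero_apply, zero_mul, integral_zero, Finset.sum_const_zero, add_zero]
  rw [hD.integral_kop_mul_swap mf mdη, hD₀.integral_kop_mul_swap mf mη, ← integral_neg]
  refine integral_congr_ae ?_
  filter_upwards [ae_ne_ball hn R 0] with ξ hξ
  have hdiff : Differentiable ℝ fun x => smoothKer a x ξ := fun x => by
    obtain ⟨L, hL, -⟩ := hasFDerivAt_smoothKer ha hξ x
    exact hL.differentiableAt
  have hfd : ∀ x, fderiv ℝ (fun x => smoothKer a x ξ) x (ev j) = smoothKerGrad a j x ξ := by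
    intro x
    obtain ⟨L, hL, hLj⟩ := hasFDerivAt_smoothKer ha hξ x
    rw [hL.fderiv, hLj]
  have hdηc : HasCompactSupport fun x => fderiv ℝ η x (ev j) := hηc.fderiv_apply ℝ (ev j)
  have hparts := integral_mul_fderiv_eq_neg_fderiv_mul_of_integrable (μ := volume)
    (f := fun x => smoothKer a x ξ) (g := η) (v := ev j)
    (by
      simp only [hfd]
      exact ((continuous_smoothKerGrad ha j hξ).mul hη.continuous).integrable_of_hasCompactSupport
        hηc.mul_left)
    (((continuous_smoothKer ha hξ).mul hdη).integrable_of_hasCompactSupport hdηc.mul_left)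
    (((continuous_smoothKer ha hξ).mul hη.continuous).integrable_of_hasCompactSupport
      hηc.mul_left)
    (fun x _ => hdiff x) (fun x _ => hη.differentiable (by simp) x)
  simp only [hfd] at hparts
  simp only [kop]
  rw [setIntegral_mul_of_tsupport _ fun x hx => image_eq_zero_of_notMem_tsupport (hz x hx),
    setIntegral_mul_of_tsupport _ fun x hx => by
      rw [fderiv_of_notMem_tsupport ℝ (hz x hx)]; simp, hparts]
  ring

/-- The two pieces recombine off the diagonal, and for fixed `x` the single point `ξ = x` has
measure zero. -/
theorem isH1Bounded_vker_transpose (hn : 1 ≤ n) {R : ℝ} (hR : 0 < R) {a : ℝ → ℝ}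
    (ha : ContDiff ℝ 1 a) : IsH1Bounded (n := n) R (fun x ξ => vker a ξ x) := by
  obtain ⟨⟨C, hC⟩, h1⟩ := isH1Bounded_coneKer (n := n) hn hR ha
  obtain ⟨D, hD⟩ := exists_isSchur_smoothKer (n := n) hn R ha.continuous
  have h2 := (hasGradKernels_smoothKer (n := n) hn R ha).isH1Bounded hR
  have h3 := IsH1Bounded.add hC hD h1 h2
  have e : ∀ f, kop (ballMeasure n R) (fun x ξ => coneKer a x ξ + smoothKer a x ξ) f
      = kop (ballMeasure n R) (fun x ξ => vker a ξ x) f := fun f => by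
    ext x
    refine integral_congr_ae ?_
    filter_upwards [ae_ne_ball hn R x] with ξ hξ
    rw [coneKer, if_neg hξ.symm, sub_add_cancel]
  obtain ⟨A, hA⟩ := h3
  refine ⟨A, fun f F hf hF => ?_⟩
  rw [← e]
  exact hA f F hf hF

/-! ### Norms and uniqueness of weak gradients -/

theorem integral_norm_sq_eq {X V : Type*} [MeasurableSpace X] {μ : Measure X}
    [NormedAddCommGroup V] {F : X → V} (hF : AEStronglyMeasurable F μ) :
    ∫ x, ‖F x‖ ^ 2 ∂μ = (eLpNorm F 2 μ).toReal ^ 2 := by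
  have hm : AEStronglyMeasurable (fun x => ‖F x‖ ^ 2) μ := hF.norm.pow 2
  rw [← eLpNorm_norm, ← ENNReal.toReal_pow, eLpNorm_two_sq,
    integral_eq_lintegral_of_nonneg_ae (ae_of_all _ fun x => by positivity) hm]
  congr 1
  refine lintegral_congr fun x => ?_
  rw [ENNReal.ofReal_pow (norm_nonneg _), enorm_norm, ofReal_norm]

theorem l2Norm_eq {R : ℝ} {f : E n → ℝ} (hf : MemL2 R f) :
    l2Norm R f = (eLpNorm f 2 (ballMeasure n R)).toReal := by
  have h := integral_norm_sq_eq hf.1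
  simp only [Real.norm_eq_abs, sq_abs] at h
  rw [l2Norm, h, Real.sqrt_sq ENNReal.toReal_nonneg]

/-- The fundamental lemma of the calculus of variations on the open ball, together with the sphere
being a null set. It makes `h1Norm` independent of the chosen gradient. -/
theorem IsL2WeakGradient.ae_eq (hn : 1 ≤ n) {R : ℝ} {f : E n → ℝ} {F G : E n → E n}
    (hF : IsL2WeakGradient R f F) (hG : IsL2WeakGradient R f G) :
    F =ᵐ[ballMeasure n R] G := by
  have hcoord : ∀ i, ∀ᵐ x ∂(ballMeasure n R), F x i - G x i = 0 := by
    intro i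
    have mD : MemLp (fun x => F x i - G x i) 2 (ballMeasure n R) :=
      (memLp_coord hF.1 i).sub (memLp_coord hG.1 i)
    have hInt : IntegrableOn (fun x => F x i - G x i) (B n R) := mD.integrable one_le_two
    have hz := isOpen_ball.ae_eq_zero_of_integral_contDiff_smul_eq_zero (U := ball (0 : E n) R)
      (μ := volume) ((hInt.mono_set ball_subset_closedBall).locallyIntegrableOn) ?_
    · filter_upwards [ae_restrict_of_ae hz, ae_norm_lt hn R] with x h1 h2
      exact h1 (by simpa using h2)
    · intro η h1 h2 h3
      have mη : MemLp η 2 (ballMeasure n R) := memLp_ball_of_continuous h1.continuous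
      have e1 := hF.2 η h1 h2 h3 i
      have e2 := hG.2 η h1 h2 h3 i
      have e3 := integral_sub ((memLp_coord hF.1 i).integrable_mul mη)
        ((memLp_coord hG.1 i).integrable_mul mη)
      simp only [Pi.mul_apply] at e3
      have hout : ∀ x : E n, R < ‖x‖ → η x = 0 := fun x hx =>
        image_eq_zero_of_notMem_tsupport fun h => by
          have := h3 h
          rw [mem_ball_zero_iff] at this
          linarith
      simp only [smul_eq_mul, mul_comm (η _)]
      rw [← setIntegral_mul_of_tsupport _ hout]
      simp only [sub_mul]
      rw [e3]
      linarith
  filter_upwards [ae_all_iff.2 hcoord] with x hx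
  ext i
  exact sub_eq_zero.1 (hx i)

theorem isL2WeakGradient_weakGradient {R : ℝ} {f : E n → ℝ} (hf : MemH1 R f) :
    IsL2WeakGradient R f (weakGradient R f) := by
  have h := hf.2
  rw [weakGradient, dif_pos h]
  exact h.choose_spec

theorem h1Norm_eq (hn : 1 ≤ n) {R : ℝ} {f : E n → ℝ} (hf : MemL2 R f) {F : E n → E n}
    (hF : IsL2WeakGradient R f F) :
    h1Norm R f = √((eLpNorm f 2 (ballMeasure n R)).toReal ^ 2
      + (eLpNorm F 2 (ballMeasure n R)).toReal ^ 2) := by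
  have hw := isL2WeakGradient_weakGradient ⟨hf, F, hF⟩
  rw [h1Norm, l2Norm_eq hf, integral_norm_sq_eq hw.1.1, eLpNorm_congr_ae (hw.ae_eq hn hF)]

/-! ### Boundedness and inversion of the transformations -/

theorem exists_norm_bounds (hn : 1 ≤ n) {R : ℝ} {k : E n → E n → ℝ} {C : ℝ≥0}
    (hk : IsSchur (ballMeasure n R) k C) (hk1 : IsH1Bounded R k) :
    ∃ c : ℝ, 0 < c ∧ ∀ f g : E n → ℝ, MemL2 R f →
      g =ᵐ[ballMeasure n R] (fun x => f x + kop (ballMeasure n R) k f x) →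
      l2Norm R g ≤ c * l2Norm R f ∧ (MemH1 R f → MemH1 R g ∧ h1Norm R g ≤ c * h1Norm R f) := by
  set μ := ballMeasure n R with hμ
  obtain ⟨A, hA⟩ := hk1
  -- `C` bounds the operator on `L²` and `A` its gradient; the factor `2` comes from estimating `α +
  -- β` by twice the Euclidean norm of `(α, β)`.
  refine ⟨2 * (1 + C + A), by positivity, fun f g hf hg => ?_⟩
  have hkf := hk.memLp_kop hf
  have hgL : MemL2 R g := (memLp_congr_ae hg).2 (hf.add hkf)
  set α := (eLpNorm f 2 μ).toReal with hα
  have hα0 : 0 ≤ α := ENNReal.toReal_nonneg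
  have hC0 : (0 : ℝ) ≤ C := C.2
  have hA0 : (0 : ℝ) ≤ A := A.2
  have hgα : (eLpNorm g 2 μ).toReal ≤ (1 + C) * α := by
    have h1 : eLpNorm g 2 μ ≤ eLpNorm f 2 μ + C * eLpNorm f 2 μ := by
      rw [eLpNorm_congr_ae hg]
      refine (eLpNorm_add_le hf.1 hkf.1 one_le_two).trans ?_
      gcongr
      exact hk.eLpNorm_kop_le hf
    have hfin : (C : ℝ≥0∞) * eLpNorm f 2 μ ≠ ⊤ := ENNReal.mul_ne_top (by simp) hf.2.ne
    have h2 := ENNReal.toReal_mono (ENNReal.add_ne_top.2 ⟨hf.2.ne, hfin⟩) h1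
    rw [ENNReal.toReal_add hf.2.ne hfin, ENNReal.toReal_mul, ENNReal.coe_toReal] at h2
    linarith
  refine ⟨?_, fun hf1 => ?_⟩
  · rw [l2Norm_eq hf, l2Norm_eq hgL]
    refine hgα.trans ?_
    gcongr
    linarith
  · obtain ⟨F, hF⟩ := hf1.2
    obtain ⟨G, hG, hGle⟩ := hA f F hf hF
    have hFG := (hF.add hG hf hkf).congr hg.symm
    refine ⟨⟨hgL, _, hFG⟩, ?_⟩
    rw [h1Norm_eq hn hf hF, h1Norm_eq hn hgL hFG]
    set β := (eLpNorm F 2 μ).toReal with hβ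
    have hβ0 : 0 ≤ β := ENNReal.toReal_nonneg
    set γ := (eLpNorm g 2 μ).toReal
    have hγ0 : 0 ≤ γ := ENNReal.toReal_nonneg
    have hδ : (eLpNorm (fun x => F x + G x) 2 μ).toReal ≤ β + A * (α + β) := by
      have h1 : eLpNorm (fun x => F x + G x) 2 μ
          ≤ eLpNorm F 2 μ + A * (eLpNorm f 2 μ + eLpNorm F 2 μ) :=
        (eLpNorm_add_le hF.1.1 hG.1.1 one_le_two).trans (add_le_add le_rfl hGle)
      have hfin0 : eLpNorm f 2 μ + eLpNorm F 2 μ ≠ ⊤ :=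
        ENNReal.add_ne_top.2 ⟨hf.2.ne, hF.1.2.ne⟩
      have hfin : (A : ℝ≥0∞) * (eLpNorm f 2 μ + eLpNorm F 2 μ) ≠ ⊤ :=
        ENNReal.mul_ne_top (by simp) hfin0
      have h2 := ENNReal.toReal_mono (ENNReal.add_ne_top.2 ⟨hF.1.2.ne, hfin⟩) h1
      rwa [ENNReal.toReal_add hF.1.2.ne hfin, ENNReal.toReal_mul, ENNReal.coe_toReal,
        ENNReal.toReal_add hf.2.ne hF.1.2.ne] at h2
    set δ := (eLpNorm (fun x => F x + G x) 2 μ).toReal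
    have hδ0 : 0 ≤ δ := ENNReal.toReal_nonneg
    have h1 : √(γ ^ 2 + δ ^ 2) ≤ γ + δ := by
      rw [Real.sqrt_le_left (by positivity)]
      nlinarith [mul_nonneg hγ0 hδ0]
    have h2 : α ≤ √(α ^ 2 + β ^ 2) := Real.le_sqrt_of_sq_le (by nlinarith [sq_nonneg β])
    have h3 : β ≤ √(α ^ 2 + β ^ 2) := Real.le_sqrt_of_sq_le (by nlinarith [sq_nonneg α])
    calc √(γ ^ 2 + δ ^ 2) ≤ γ + δ := h1
      _ ≤ (1 + C) * α + (β + A * (α + β)) := add_le_add hgα hδ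
      _ ≤ (1 + C + A) * (α + β) := by nlinarith [mul_nonneg hC0 hβ0]
      _ ≤ (1 + C + A) * (√(α ^ 2 + β ^ 2) + √(α ^ 2 + β ^ 2)) := by gcongr
      _ = _ := by ring

theorem kop_neg {X : Type*} [MeasurableSpace X] (μ : Measure X) (k : X → X → ℝ) (f : X → ℝ)
    (x : X) : kop μ (fun x ξ => -k x ξ) f x = -kop μ k f x := by
  simp only [kop, neg_mul, integral_neg]

theorem IsL2WeakGradient.neg {R : ℝ} {f : E n → ℝ} {F : E n → E n}
    (hF : IsL2WeakGradient R f F) : IsL2WeakGradient R (fun x => -f x) (fun x => -F x) := by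
  refine ⟨hF.1.neg, fun η h1 h2 h3 i => ?_⟩
  simp only [neg_mul, integral_neg, PiLp.neg_apply]
  rw [hF.2 η h1 h2 h3 i]

theorem IsH1Bounded.neg {R : ℝ} {k : E n → E n → ℝ} (hk : IsH1Bounded R k) :
    IsH1Bounded R (fun x ξ => -k x ξ) := by
  obtain ⟨A, hA⟩ := hk
  refine ⟨A, fun f F hf hF => ?_⟩
  obtain ⟨G, hG, hGle⟩ := hA f F hf hF
  refine ⟨fun x => -G x, ?_, ?_⟩
  · have e : kop (ballMeasure n R) (fun x ξ => -k x ξ) f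
        = fun x => -kop (ballMeasure n R) k f x := by
      ext x
      exact kop_neg _ _ _ _
    rw [e]
    exact hG.neg
  · exact (eLpNorm_neg G 2 _).trans_le hGle

theorem IsSchur.neg {R : ℝ} {k : E n → E n → ℝ} {C : ℝ≥0} (hk : IsSchur (ballMeasure n R) k C) :
    IsSchur (ballMeasure n R) (fun x ξ => -k x ξ) C :=
  ⟨hk.meas.neg, by simpa using hk.row, by simpa using hk.col⟩

/-- Two transformations given by mutually inverse Volterra-type operators are inverse to each
other and bounded on `L²` and on `H¹`. -/
theorem exists_transform_bounds (hn : 1 ≤ n) {R : ℝ} {k l : E n → E n → ℝ} {C D : ℝ≥0}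
    (hk : IsSchur (ballMeasure n R) k C) (hl : IsSchur (ballMeasure n R) l D)
    (hk1 : IsH1Bounded R k) (hl1 : IsH1Bounded R l)
    (hkl : ∀ᵐ x ∂(ballMeasure n R), ∀ᵐ ξ ∂(ballMeasure n R),
      ∫ η, k x η * l η ξ ∂(ballMeasure n R) = k x ξ - l x ξ)
    (hlk : ∀ᵐ x ∂(ballMeasure n R), ∀ᵐ ξ ∂(ballMeasure n R),
      ∫ η, l x η * k η ξ ∂(ballMeasure n R) = k x ξ - l x ξ)
    {T S : (E n → ℝ) → E n → ℝ}
    (hT : ∀ f, T f =ᵐ[ballMeasure n R] fun x => f x + kop (ballMeasure n R) k f x)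
    (hS : ∀ g, S g =ᵐ[ballMeasure n R] fun x => g x - kop (ballMeasure n R) l g x) :
    ∃ C₁ C₂ C₃ C₄ : ℝ, 0 < C₁ ∧ 0 < C₂ ∧ 0 < C₃ ∧ 0 < C₄ ∧ ∀ f g : E n → ℝ,
      ((MemL2 R f ∧ g =ᵐ[ballMeasure n R] T f) ↔ (MemL2 R g ∧ f =ᵐ[ballMeasure n R] S g)) ∧
      (MemL2 R f → g =ᵐ[ballMeasure n R] T f →
        l2Norm R g ≤ C₁ * l2Norm R f ∧ l2Norm R f ≤ C₂ * l2Norm R g ∧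
        (MemH1 R f ↔ MemH1 R g) ∧
        (MemH1 R f → h1Norm R g ≤ C₃ * h1Norm R f ∧ h1Norm R f ≤ C₄ * h1Norm R g)) := by
  obtain ⟨c, hc, hc'⟩ := exists_norm_bounds hn hk hk1
  obtain ⟨d, hd, hd'⟩ := exists_norm_bounds hn hl.neg hl1.neg
  -- The inverse is `1 + (-l)`, so the same norm bound covers it once the sign is absorbed into the
  -- kernel.
  simp only [kop_neg, ← sub_eq_add_neg] at hd'
  have hforw : ∀ f g, MemL2 R f → g =ᵐ[ballMeasure n R] T f →
      MemL2 R g ∧ f =ᵐ[ballMeasure n R] fun x => g x - kop (ballMeasure n R) l g x :=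
    fun f g hf hg => hk.resolvent hl hlk hf (hg.trans (hT f))
  refine ⟨c, d, c, d, hc, hd, hc, hd, fun f g => ⟨⟨fun h => ?_, fun h => ?_⟩, fun hf hg => ?_⟩⟩
  · have h1 := hforw f g h.1 h.2
    exact ⟨h1.1, h1.2.trans (hS g).symm⟩
  · have h1 := hk.resolvent' hl hkl h.1 (h.2.trans (hS g))
    exact ⟨h1.1, h1.2.trans (hT f).symm⟩
  · obtain ⟨hgL, hfg⟩ := hforw f g hf hg
    have a := hc' f g hf (hg.trans (hT f))
    have b := hd' g f hgL hfg
    exact ⟨a.1, b.1, ⟨fun h => (a.2 h).1, fun h => (b.2 h).1⟩,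
      fun h => ⟨(a.2 h).2, (b.2 (a.2 h).1).2⟩⟩

theorem ae_integral_vker_mul_vker (hn : 1 ≤ n) {R : ℝ} {a b : ℝ → ℝ} (ha : Continuous a)
    (hb : Continuous b) : ∀ᵐ x ∂(ballMeasure n R), ∀ᵐ ξ ∂(ballMeasure n R),
      ∫ η, vker a x η * vker b η ξ ∂(ballMeasure n R) = vker (vconv a b) x ξ := by
  obtain ⟨C, hC⟩ := exists_isSchur_vker (n := n) hn R ha
  obtain ⟨D, hD⟩ := exists_isSchur_vker (n := n) hn R hb
  filter_upwards [hC.ae_integrable_comp hD, ae_mem_ball (n := n) R] with x h1 hx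
  filter_upwards [h1] with ξ h2 using integral_vker_mul_vker hn ha hb hx h2

/-- Transposition reverses the order of composition, hence `vconv b a`; the formula for the control
kernels then applies with `x` and `ξ` exchanged. -/
theorem ae_integral_vker_mul_vker_transpose (hn : 1 ≤ n) {R : ℝ} {a b : ℝ → ℝ}
    (ha : Continuous a) (hb : Continuous b) :
    ∀ᵐ x ∂(ballMeasure n R), ∀ᵐ ξ ∂(ballMeasure n R),
      ∫ η, vker a η x * vker b ξ η ∂(ballMeasure n R) = vker (vconv b a) ξ x := by
  obtain ⟨C, hC⟩ := exists_isSchur_vker (n := n) hn R ha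
  obtain ⟨D, hD⟩ := exists_isSchur_vker (n := n) hn R hb
  filter_upwards [hC.transpose.ae_integrable_comp hD.transpose] with x h1
  filter_upwards [h1, ae_mem_ball (n := n) R] with ξ h2 hξ
  simp only [mul_comm (vker a _ x)] at h2 ⊢
  exact integral_vker_mul_vker hn hb ha hξ h2

end BallBackstepping

theorem proposition1 (n : ℕ) (hn : 1 ≤ n) (R lam eps : ℝ)
    (hR : 0 < R) (hlam : 0 < lam) (heps : 0 < eps) :
    -- the integrals that define the four transformations converge on `L²`, almost everywhere
    (∀ f : E n → ℝ, MemL2 R f → ∀ᵐ x ∂(ballMeasure n R),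
      IntegrableOn (fun ξ => kernelK lam eps x ξ * f ξ) (B n ‖x‖) ∧
      IntegrableOn (fun ξ => kernelL lam eps x ξ * f ξ) (B n ‖x‖) ∧
      IntegrableOn (fun ξ => kernelP lam eps x ξ * f ξ) (B n R \ B n ‖x‖) ∧
      IntegrableOn (fun ξ => kernelR lam eps x ξ * f ξ) (B n R \ B n ‖x‖)) ∧
    -- the control transformation and its inverse
    (∃ C_KL C_LL C_KH C_LH : ℝ, 0 < C_KL ∧ 0 < C_LL ∧ 0 < C_KH ∧ 0 < C_LH ∧
      ∀ f g : E n → ℝ,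
        ((MemL2 R f ∧ g =ᵐ[ballMeasure n R] transK lam eps f) ↔
          (MemL2 R g ∧ f =ᵐ[ballMeasure n R] transL lam eps g)) ∧
        (MemL2 R f → g =ᵐ[ballMeasure n R] transK lam eps f →
          l2Norm R g ≤ C_KL * l2Norm R f ∧ l2Norm R f ≤ C_LL * l2Norm R g ∧
          (MemH1 R f ↔ MemH1 R g) ∧
          (MemH1 R f →
            h1Norm R g ≤ C_KH * h1Norm R f ∧ h1Norm R f ≤ C_LH * h1Norm R g))) ∧
    -- the observer transformation and its inverse
    (∃ C_PL C_RL C_PH C_RH : ℝ, 0 < C_PL ∧ 0 < C_RL ∧ 0 < C_PH ∧ 0 < C_RH ∧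
      ∀ f g : E n → ℝ,
        ((MemL2 R f ∧ g =ᵐ[ballMeasure n R] transP R lam eps f) ↔
          (MemL2 R g ∧ f =ᵐ[ballMeasure n R] transR R lam eps g)) ∧
        (MemL2 R f → g =ᵐ[ballMeasure n R] transP R lam eps f →
          l2Norm R g ≤ C_PL * l2Norm R f ∧ l2Norm R f ≤ C_RL * l2Norm R g ∧
          (MemH1 R f ↔ MemH1 R g) ∧
          (MemH1 R f →
            h1Norm R g ≤ C_PH * h1Norm R f ∧ h1Norm R f ≤ C_RH * h1Norm R g))) := by
  have hc : 0 < lam / eps := div_pos hlam heps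
  set a := besselDensity (lam / eps) 1 with ha_def
  set b := besselDensity (lam / eps) (-1) with hb_def
  have ha : ContDiff ℝ 1 a := (contDiff_besselDensity _ _).of_le (by simp)
  have hb : ContDiff ℝ 1 b := (contDiff_besselDensity _ _).of_le (by simp)
  obtain ⟨C, hC⟩ := exists_isSchur_vker (n := n) hn R ha.continuous
  obtain ⟨D, hD⟩ := exists_isSchur_vker (n := n) hn R hb.continuous
  have kK : ∀ x ξ : E n, ‖ξ‖ ≤ ‖x‖ → kernelK lam eps x ξ = -vker a x ξ :=
    fun x ξ h => kernelK_eq hc.le h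
  have kL : ∀ x ξ : E n, ‖ξ‖ ≤ ‖x‖ → kernelL lam eps x ξ = -vker b x ξ :=
    fun x ξ h => kernelL_eq hc.le h
  have kP : ∀ x ξ : E n, ‖x‖ ≤ ‖ξ‖ → kernelP lam eps x ξ = -vker a ξ x :=
    fun x ξ h => (kernelP_eq_kernelK x ξ).trans (kernelK_eq hc.le h)
  have kR : ∀ x ξ : E n, ‖x‖ ≤ ‖ξ‖ → kernelR lam eps x ξ = -vker b ξ x :=
    fun x ξ h => (kernelR_eq_kernelL x ξ).trans (kernelL_eq hc.le h)
  refine ⟨fun f hf => ?_, ?_, ?_⟩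
  · filter_upwards [ae_mem_ball (n := n) R, hC.ae_integrable hf, hD.ae_integrable hf,
      hC.transpose.ae_integrable hf, hD.transpose.ae_integrable hf] with x hx h1 h2 h3 h4
    exact ⟨integrableOn_ball_kernel hx (kK x) h1, integrableOn_ball_kernel hx (kL x) h2,
      integrableOn_shell_kernel (kP x) h3, integrableOn_shell_kernel (kR x) h4⟩
  · refine exists_transform_bounds hn hC hD (isH1Bounded_vker hn hR ha)
      (isH1Bounded_vker hn hR hb) ?_ ?_ (fun f => ?_) (fun g => ?_)
    · simpa only [ha_def, hb_def, vker_vconv_besselDensity hc] using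
        ae_integral_vker_mul_vker (n := n) (R := R) hn ha.continuous hb.continuous
    -- Composing in the other order gives `b ⋆ a`, which commutativity reduces to the same Bessel
    -- identity.
    · have h := ae_integral_vker_mul_vker (n := n) (R := R) hn hb.continuous ha.continuous
      rw [vconv_comm] at h
      simpa only [ha_def, hb_def, vker_vconv_besselDensity hc] using h
    · filter_upwards [ae_mem_ball (n := n) R] with x hx
      rw [transK, integral_ball_kernel hx (kK x), sub_neg_eq_add]
    · filter_upwards [ae_mem_ball (n := n) R] with x hx
      rw [transL, integral_ball_kernel hx (kL x), sub_eq_add_neg]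
  · refine exists_transform_bounds hn hC.transpose hD.transpose
      (isH1Bounded_vker_transpose hn hR ha) (isH1Bounded_vker_transpose hn hR hb) ?_ ?_
      (fun f => ?_) (fun g => ?_)
    · have h := ae_integral_vker_mul_vker_transpose (n := n) (R := R) hn ha.continuous
        hb.continuous
      rw [vconv_comm] at h
      simpa only [ha_def, hb_def, vker_vconv_besselDensity hc] using h
    · simpa only [ha_def, hb_def, vker_vconv_besselDensity hc] using
        ae_integral_vker_mul_vker_transpose (n := n) (R := R) hn hb.continuous ha.continuous
    · filter_upwards [ae_mem_ball (n := n) R] with x hx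
      rw [transP, integral_shell_kernel (kP x), sub_neg_eq_add]
    · filter_upwards [ae_mem_ball (n := n) R] with x hx
      rw [transR, integral_shell_kernel (kR x), sub_eq_add_neg]
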